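/- **Setting.** Let $B\ge 4$ (batch size) and $k\ge 2$ (number of batches). Let $G=I-\frac1B\mathbf 1\mathbf 1^T\in\mathbb R^{B\times B}$, and for $\phi:\mathbb R\to\mathbb R$ let $\mathcal B_\phi(x)=\phi\big(\sqrt B\,Gx/\|Gx\|\big)$ for $x\in\mathbb R^B$ ($\phi$ applied coordinatewise), and $\mathcal B_\phi^{\oplus k}(h_1,\dots,h_k)=(\mathcal B_\phi(h_1),\dots,\mathcal B_\phi(h_k))$. Write matrices of size $kB\times kB$ as $k\times k$ block matrices with blocks $M^{ij}\in\mathbb R^{B\times B}$, and let $M^G$ be the matrix with blocks $GM^{ij}G$. *Forward dynamics.* On positive semidefinite $\Sigma\in\mathbb R^{kB\times kB}$ put $V(\Sigma)=\mathbb E_{h\sim\mathcal N(0,\Sigma)}\big[\mathcal B_\phi^{\oplus k}(h)\,\mathcal B_\phi^{\oplus k}(h)^T\big]$. A cross-batch BSB1 fixed point is a positive semidefinite $\Sigma^*$ with $V(\Sigma^*)=\Sigma^*$ whose diagonal blocks all have diagonal entries $a$ and off-diagonal entries $b\neq a$, and whose off-diagonal blocks are constant, all equal to one constant $c$. A number $\lambda$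 is the forward eigenvalue $\lambda^\uparrow$ at $\Sigma^*$ if $V$ is Fréchet differentiable at $\Sigma^*$ within the positive semidefinite matrices, with a derivative $L$ such that $L\{\Lambda\}=\lambda\,\Lambda^G$ for every symmetric $\Lambda$ with zero diagonal blocks (so $L\{\Lambda\}=\lambda\Lambda$ if moreover $\Lambda^G=\Lambda$). *Backward dynamics.* With $J(h)$ the Jacobian of $\mathcal B_\phi^{\oplus k}$ at $h$, put $T(\Pi)=\mathbb E_{h\sim\mathcal N(0,\Sigma^*)}\big[J(h)^T\,\Pi\,J(h)\big]$. A number $\lambda$ is the backward multiplier $\lambda^\downarrow$ at $\Sigma^*$ if, for every $\Pi$ and all $i\ne j$, the expectation defining the block $T(\Pi)^{ij}$ exists and $T(\Pi)^{ij}=\lambda\,G\,\Pi^{ij}G$ (so it is $\lambda\,\Pi^{ij}$ if $G\Pi^{ij}G=\Pi^{ij}$). *Special functions.* $C_l=C_l^{((B-3)/2)}$ are the Gegenbauer polynomials ($C^{(\alpha)}_0=1$, $C^{(\alpha)}_1=2\alpha x$, $nC_n^{(\alpha)}=2(n-1+\alpha)xC_{n-1}^{(\alpha)}-(n-2+2\alpha)C_{n-2}^{(\alpha)}$),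 orthogonal for the weight $(1-x^2)^{(B-4)/2}$ on $(-1,1)$; $c_{B-1,l}=\frac{B-3}{B-3+2l}$; $\mathrm{Beta}(a,b)=\Gamma(a)\Gamma(b)/\Gamma(a+b)$; $\mathrm{Poch}(a,b)=\Gamma(a+b)/\Gamma(a)$. We say that $\phi(\sqrt{B-1}\,x)$ has Gegenbauer expansion $\sum_l a_l c_{B-1,l}^{-1}C_l(x)$ if the series converges to it in $L^2\big((1-x^2)^{(B-4)/2}dx\big)$. **Theorem (Batchnorm causes information loss).** Let $\phi$ be measurable with $\phi(\sqrt{B-1}\,x)\in L^2\big((-1,1),(1-x^2)^{(B-4)/2}dx\big)$ and let $\Sigma^*$ be a cross-batch BSB1 fixed point of the forward dynamics of $\phi$. Then there is a real $\lambda$ such that: 1. $\lambda$ is the forward eigenvalue $\lambda^\uparrow$ at $\Sigma^*$. 2. If $\phi$ is locally absolutely continuous on $(-\sqrt{B-1},\sqrt{B-1})$ and $\phi'(\sqrt{B-1}\,x)$ is integrable on $(-1,1)$ against $(1-x^2)^{(B-3)/2}dx$, then $\lambda$ is also the backward multiplier: $\lambda^\downarrow=\lambda=\lambda^\uparrow$.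 3. If $\phi(\sqrt{B-1}\,x)$ has Gegenbauer expansion $\sum_l a_l c_{B-1,l}^{-1}C_l(x)$, then $$\lambda=\frac{\frac1{2\pi}B(B-1)\,a_1^2\,\mathrm{Beta}\left(\frac B2,\frac12\right)^2}{\sum_{l=0}^\infty a_l^2\,\frac1{c_{B-1,l}}\left(C_l(1)-C_l\left(\frac{-1}{B-1}\right)\right)},$$ where the series in the denominator converges and is positive. 4. $\lambda<1$. 5. $\lambda\le\lambda_{\mathrm{id}}$ for the forward eigenvalue $\lambda_{\mathrm{id}}$ at any cross-batch BSB1 fixed point for $\phi=\mathrm{id}$ (same $B$, $k$). For $\phi=\mathrm{id}$ a cross-batch BSB1 fixed point exists, and at it $\lambda^\uparrow=\lambda^\downarrow=\rho_B:=\frac{B-1}2\,\mathrm{Poch}\left(\frac B2,\frac12\right)^{-2}$. The sequence $(\rho_B)_{B\ge4}$ is strictly increasing, $\rho_B<1$, and $\rho_B\to1$ as $B\to\infty$. -/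

import Mathlib

open MeasureTheory ProbabilityTheory Filter Topology
open scoped Polynomial Kronecker

noncomputable section

namespace CrossBatchNorm

/-! ### Special functions -/

/-- The Pochhammer symbol `Γ(a + b) / Γ(a)` for real arguments. -/
def poch (a b : ℝ) : ℝ := Real.Gamma (a + b) / Real.Gamma a

/-- The Gegenbauer polynomials `C_l^{(α)}`, by their three-term recurrence. -/
def gegenbauer (α : ℝ) : ℕ → ℝ[X]
  | 0 => 1
  | 1 => Polynomial.C (2 * α) * Polynomial.X
  | n + 2 =>
      Polynomial.C (((n : ℝ) + 2)⁻¹) *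
        (Polynomial.C (2 * ((n : ℝ) + 1 + α)) * Polynomial.X * gegenbauer α (n + 1)
          - Polynomial.C ((n : ℝ) + 2 * α) * gegenbauer α n)

/-- `C_l = C_l^{((B-3)/2)}` evaluated at `x`. -/
def geg (B l : ℕ) (x : ℝ) : ℝ := (gegenbauer (((B : ℝ) - 3) / 2) l).eval x

/-- The constant `c_{B-1,l} = (B-3) / (B-3+2l)`. -/
def gegC (B l : ℕ) : ℝ := ((B : ℝ) - 3) / ((B : ℝ) - 3 + 2 * l)

/-- The measure `(1 - x²)^{(B-4)/2} dx` on `(-1, 1)`, for which the polynomials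
`C_l^{((B-3)/2)}` are orthogonal. -/
def gegMeasure (B : ℕ) : Measure ℝ :=
  (volume.restrict (Set.Ioo (-1) 1)).withDensity
    fun x => ENNReal.ofReal ((1 - x ^ 2) ^ (((B : ℝ) - 4) / 2))

/-- The function `x ↦ φ(√(B-1) x)`. -/
def rescale (B : ℕ) (φ : ℝ → ℝ) (x : ℝ) : ℝ := φ (√((B : ℝ) - 1) * x)

/-- `φ(√(B-1) x)` has the Gegenbauer expansion `∑ a_l c_{B-1,l}⁻¹ C_l(x)`: the series converges
to it in `L²` of the orthogonality weight. -/
def HasGegenbauerExpansion (B : ℕ) (φ : ℝ → ℝ) (a : ℕ → ℝ) : Prop :=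
  Tendsto (fun N : ℕ => eLpNorm
      (fun x => rescale B φ x - ∑ l ∈ Finset.range N, a l * (gegC B l)⁻¹ * geg B l x)
      2 (gegMeasure B))
    atTop (𝓝 0)

/-- The `l`-th term `a_l² c_{B-1,l}⁻¹ (C_l(1) - C_l(-1/(B-1)))`. -/
def gegTerm (B : ℕ) (a : ℕ → ℝ) (l : ℕ) : ℝ :=
  a l ^ 2 * (gegC B l)⁻¹ * (geg B l 1 - geg B l (-1 / ((B : ℝ) - 1)))

/-- `((B-1)/2) · Poch(B/2, 1/2)⁻²`. -/
def idRate (B : ℕ) : ℝ := ((B : ℝ) - 1) / 2 * (poch ((B : ℝ) / 2) (1 / 2)) ^ (-2 : ℤ)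

/-! ### Batch normalization -/

/-- The mean of a batch. -/
def avg {B : ℕ} (x : Fin B → ℝ) : ℝ := (∑ p, x p) / B

/-- Batch normalization followed by the coordinatewise nonlinearity `φ`. -/
def batchNorm {B : ℕ} (φ : ℝ → ℝ) (x : Fin B → ℝ) (p : Fin B) : ℝ :=
  φ ((x p - avg x) / √((∑ q, (x q - avg x) ^ 2) / B))

/-- Preactivations of `k` batches of size `B`; the index `(i, p)` is sample `p` of batch `i`. -/
abbrev Preact (k B : ℕ) := EuclideanSpace ℝ (Fin k × Fin B)

/-- Block matrices with `k × k` blocks of size `B × B`. -/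
abbrev BlockMat (k B : ℕ) := Matrix (Fin k × Fin B) (Fin k × Fin B) ℝ

variable {k B : ℕ}

/-- The `k`-fold direct sum of batch normalization: each batch is normalized separately. -/
def multiBatchNorm (φ : ℝ → ℝ) (h : Preact k B) (r : Fin k × Fin B) : ℝ :=
  batchNorm φ (fun p => h (r.1, p)) r.2

/-- The Jacobian matrix of `multiBatchNorm φ` at `h`, with rows indexed by outputs. -/
def jac (φ : ℝ → ℝ) (h : Preact k B) : BlockMat k B :=
  Matrix.of fun r s =>
    fderiv ℝ (fun z : Preact k B => multiBatchNorm φ z r) h (EuclideanSpace.single s 1)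

/-- The centering projection `G = I - (1/B) 𝟏𝟏ᵀ`. -/
def centering (B : ℕ) : Matrix (Fin B) (Fin B) ℝ :=
  1 - (B : ℝ)⁻¹ • Matrix.of fun _ _ => 1

/-- Conjugation of every block by `G`: `M ↦ (G ⊕ ⋯ ⊕ G) M (G ⊕ ⋯ ⊕ G)`. -/
def blockCenter (M : BlockMat k B) : BlockMat k B :=
  ((1 : Matrix (Fin k) (Fin k) ℝ) ⊗ₖ centering B) * M *
    ((1 : Matrix (Fin k) (Fin k) ℝ) ⊗ₖ centering B)

/-! ### Forward dynamics -/

/-- One step of the forward cross-batch dynamics: the uncentered second moment matrix of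
`multiBatchNorm φ h`, where `h ∼ N(0, S)`. -/
def forward (φ : ℝ → ℝ) (S : BlockMat k B) : BlockMat k B :=
  Matrix.of fun r s =>
    ∫ h : Preact k B, multiBatchNorm φ h r * multiBatchNorm φ h s ∂(multivariateGaussian 0 S)

/-- `S` is a cross-batch BSB1 fixed point of the forward dynamics: a covariance matrix whose
diagonal blocks all have diagonal entries `a` and off-diagonal entries `b`, whose off-diagonal
blocks are constant equal to `c`, and which is fixed by the dynamics. If `a = b`, then all
samples of a batch coincide almost surely and their normalization is the undefined `0 / 0`; so
`a ≠ b` is required. -/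
structure IsFixedPoint (φ : ℝ → ℝ) (S : BlockMat k B) : Prop where
  posSemidef : S.PosSemidef
  cbsb1 : ∃ a b c : ℝ, a ≠ b ∧ ∀ i j p q,
    S (i, p) (j, q) = if i = j then (if p = q then a else b) else c
  fixed : forward φ S = S

/-- `lam` is the eigenvalue, on block matrices with zero diagonal blocks, of the derivative `L` at
`S` of the forward dynamics on covariance matrices. The derivative centers its argument, so the
relation for a general symmetric `M` with zero diagonal blocks is `L M = lam • blockCenter M`; it
contains `L M = lam • M` for the centered ones (`blockCenter M = M`). (The values of such an `L`
on symmetric matrices are determined, since the cone of positive semidefinite matrices has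
nonempty interior in their space.) -/
def IsForwardRate (φ : ℝ → ℝ) (S : BlockMat k B) (lam : ℝ) : Prop :=
  ∃ L : BlockMat k B →L[ℝ] BlockMat k B,
    HasFDerivWithinAt (forward φ) L {T : BlockMat k B | T.PosSemidef} S ∧
    ∀ M : BlockMat k B, M.IsSymm → (∀ i p q, M (i, p) (i, q) = 0) →
      L M = lam • blockCenter M

/-! ### Backward dynamics -/

/-- The matrix `Jᵀ P J`, with `J` the Jacobian of `multiBatchNorm φ` at `h`. -/
def pullback (φ : ℝ → ℝ) (P : BlockMat k B) (h : Preact k B) : BlockMat k B :=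
  (jac φ h).transpose * P * jac φ h

/-- One step of the backward dynamics of gradient covariances at `S`: `P ↦ E[Jᵀ P J]`, with `J`
the Jacobian of `multiBatchNorm φ` at `h ∼ N(0, S)`. -/
def backward (φ : ℝ → ℝ) (S P : BlockMat k B) : BlockMat k B :=
  Matrix.of fun r s => ∫ h : Preact k B, pullback φ P h r s ∂(multivariateGaussian 0 S)

/-- The cross-batch blocks `Ξ = P_{ij}`, `i ≠ j`, of gradient covariances evolve by
`Ξ ↦ lam • GΞG` (the expectations existing): multiplication by `lam` on the centered matrices,
which contain all matrices reached after one step. -/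
def IsBackwardRate (φ : ℝ → ℝ) (S : BlockMat k B) (lam : ℝ) : Prop :=
  ∀ (P : BlockMat k B) (i j : Fin k), i ≠ j → ∀ p q : Fin B,
    Integrable (fun h : Preact k B => pullback φ P h (i, p) (j, q)) (multivariateGaussian 0 S) ∧
    backward φ S P (i, p) (j, q) = lam * blockCenter P (i, p) (j, q)

/-- What is needed for the mean Jacobian of batch normalization to make sense: `φ` is locally
absolutely continuous on `(-√(B-1), √(B-1))` (the range of normalized samples), and
`φ'(√(B-1) x)` is integrable against `(1 - x²)^{(B-3)/2}`. -/
structure HasBackward (B : ℕ) (φ : ℝ → ℝ) : Prop where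
  absCont : ∀ r, 0 < r → r < √((B : ℝ) - 1) → AbsolutelyContinuousOnInterval φ (-r) r
  integrable : IntegrableOn
    (fun x => deriv φ (√((B : ℝ) - 1) * x) * (1 - x ^ 2) ^ (((B : ℝ) - 3) / 2))
    (Set.Ioo (-1) 1)

end CrossBatchNorm

end

open CrossBatchNorm

noncomputable section

namespace CrossBatchNorm

/-! ### Algebra of the Gegenbauer polynomials -/

section Gegenbauer

open Polynomial

variable {α : ℝ}

/-! A centred batch is a vector of the hyperplane `Hyp B`, of dimension `B - 1`, and batch
normalization sees only its direction: the normalized samples are `√(B - 1)` times its inner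
products `t_p` with the unit vectors `unitVec hB p`, the vertices of a regular simplex. Write `ψ =
rescale B φ`. On centred tuples the covariance of a fixed point is the scalar `v = a - b`, so the
centred batches are independent isotropic Gaussians. Norm and direction of such a vector are
independent, and one coordinate of the direction follows the normalized Gegenbauer weight
(`map_inner_dir`). Everything therefore reduces to spherical moments and moments of a norm.

Forward: an entry of the forward map is the Gaussian mean of a function `f` that is homogeneous of
degree zero. Written through the precision operator it is a quotient of two integrals, and its
derivative at `v • 1` along `H` is `(2v)⁻¹ Cov(f, ⟪z, H z⟫)` (`hasFDerivAt_gaussInt_div`). If `H`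
comes from a matrix with zero diagonal blocks, independence and sign flips of batches leave only
products of first moments `E[ψ(t_p) z_q] = linCoeff B ψ * G p q`. The eigenvalue is `linCoeff B ψ ^
2 / v`.

Backward: for distinct batches independence splits `E[Jᵀ Π J]` into two mean Jacobians, and
integration by parts against the weight (`integral_gradient`) shows that each is `linCoeff B ψ / √v`
times `G`. The two factors multiply to the same number.

Size: the fixed point equation gives `v = E ψ(t_p)² - E ψ(t_p) ψ(t_q)` for `p ≠ q`, and `linCoeff B
ψ ^ 2 = B * idRate B * m²` with `m = E[x ψ(x)]`. The Gegenbauer polynomials are orthogonal for two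
correlated coordinates as well, with `E C_l(t_p) C_l(t_q) = c_l C_l(-1/(B-1))` (`twoPoint`,
`integral_geg_mul_geg`). This turns `v` into the series of the denominator and `m` into `a 1`.
Removing the linear part of `ψ` proves `B m² ≤ v`, with equality for linear `ψ`
(`firstMoment_sq_le`), so the rate is at most `idRate B`, the rate of the identity. Finally `idRate
B` is `(E‖z‖)² / E‖z‖²` in dimension `B - 1`, and the relation `chiRatio n * chiRatio (n + 1) = n /
(n + 1)` controls its size, monotonicity and limit. -/

lemma gegenbauer_zero : gegenbauer α 0 = 1 := rfl

lemma gegenbauer_one : gegenbauer α 1 = C (2 * α) * X := rfl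

/-- The denominator is cleared so that the recurrence can enter `linear_combination` over `ℝ[X]`. -/
lemma gegenbauer_add_two (n : ℕ) :
    ((n : ℝ[X]) + 2) * gegenbauer α (n + 2) =
      2 * ((n : ℝ[X]) + 1 + C α) * X * gegenbauer α (n + 1)
        - ((n : ℝ[X]) + 2 * C α) * gegenbauer α n := by
  have h : ((n : ℝ[X]) + 2) * C (((n : ℝ) + 2)⁻¹) = 1 := by
    have : ((n : ℝ[X]) + 2) = C ((n : ℝ) + 2) := by
      simp only [map_add, map_natCast, map_ofNat]
    rw [this, ← C_mul, mul_inv_cancel₀ (by positivity), C_1]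
  rw [gegenbauer, ← mul_assoc, h]
  simp only [map_mul, map_add, map_natCast, map_ofNat, map_one, one_mul]

/-- Two classical relations between the Gegenbauer polynomials and their derivatives. -/
lemma gegenbauer_derivative (n : ℕ) :
    ((n : ℝ[X]) + 2 * C α) * gegenbauer α n =
        derivative (gegenbauer α (n + 1)) - X * derivative (gegenbauer α n) ∧
      (X ^ 2 - 1) * derivative (gegenbauer α n) =
        ((n : ℝ[X]) + 1) * gegenbauer α (n + 1)
          - ((n : ℝ[X]) + 2 * C α) * X * gegenbauer α n := by
  induction n with
  | zero =>
    simp only [gegenbauer_zero, gegenbauer_one, zero_add, map_mul, map_ofNat]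
    constructor <;> simp
  | succ n ih =>
    obtain ⟨h3, h1⟩ := ih
    have R := gegenbauer_add_two (α := α) n
    have dR := congrArg derivative R
    have dn : derivative (n : ℝ[X]) = 0 := derivative_natCast
    have d2 : derivative (2 : ℝ[X]) = 0 := derivative_ofNat 2
    simp only [derivative_mul, derivative_sub, derivative_add, dn, d2, derivative_C, derivative_X,
      derivative_one] at dR
    -- A third classical relation, obtained from the two induction hypotheses; together with the
    -- differentiated recurrence it closes the induction.
    have h2 : X * derivative (gegenbauer α (n + 1)) - derivative (gegenbauer α n) =
        ((n : ℝ[X]) + 1) * gegenbauer α (n + 1) := by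
      linear_combination (-X) * h3 + h1
    have hn : ((n : ℝ[X]) + 2) ≠ 0 := by
      have : ((n : ℝ[X]) + 2) = ((n + 2 : ℕ) : ℝ[X]) := by push_cast; ring
      rw [this]; exact_mod_cast Nat.succ_ne_zero (n + 1)
    push_cast
    constructor
    · apply mul_left_cancel₀ hn
      linear_combination (-1) * dR - ((n : ℝ[X]) + 2 * C α) * h2
    · linear_combination (-1) * R + X * h1 + (-(X ^ 2 - 1)) * h3

lemma degree_const_mul_le (a : ℝ) (p : ℝ[X]) : (C a * p).degree ≤ p.degree := by
  rw [← smul_eq_C_mul]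
  exact degree_smul_le a p

lemma degree_gegenbauer_le (n : ℕ) : (gegenbauer α n).degree ≤ n := by
  induction n using Nat.strong_induction_on with
  | _ n ih =>
    match n with
    | 0 => simp [gegenbauer_zero]
    | 1 =>
      rw [gegenbauer_one]
      exact degree_C_mul_X_le _
    | n + 2 =>
      rw [gegenbauer]
      refine (degree_const_mul_le _ _).trans ((degree_sub_le _ _).trans (max_le ?_ ?_))
      · rw [mul_assoc]
        refine (degree_const_mul_le _ _).trans ?_
        rw [degree_mul, degree_X]
        refine (add_le_add_right (ih (n + 1) (by omega)) 1).trans (le_of_eq ?_)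
        push_cast; ring
      · refine (degree_const_mul_le _ _).trans ((ih n (by omega)).trans ?_)
        exact_mod_cast (by omega : n ≤ n + 2)

/-- With the degree bound this makes the degree exactly `n`, so that leading terms can be divided
off by `C_n`. -/
lemma coeff_gegenbauer_pos (hα : 0 < α) (n : ℕ) : 0 < (gegenbauer α n).coeff n := by
  induction n using Nat.strong_induction_on with
  | _ n ih =>
    match n with
    | 0 => simp [gegenbauer_zero]
    | 1 => simpa [gegenbauer_one] using hα
    | n + 2 =>
      have h0 : (gegenbauer α n).coeff (n + 2) = 0 :=
        coeff_eq_zero_of_degree_lt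
          ((degree_gegenbauer_le n).trans_lt (by exact_mod_cast (by omega : n < n + 2)))
      rw [gegenbauer, coeff_C_mul, coeff_sub, mul_assoc, coeff_C_mul, coeff_C_mul, coeff_X_mul, h0]
      have := ih (n + 1) (by omega)
      simp only [mul_zero, sub_zero]
      positivity

/-- At `1` the factor `X² - 1` of the second derivative relation vanishes. -/
lemma gegenbauer_eval_one_succ (n : ℕ) :
    ((n : ℝ) + 1) * (gegenbauer α (n + 1)).eval 1 =
      ((n : ℝ) + 2 * α) * (gegenbauer α n).eval 1 := by
  have h := congrArg (eval 1) (gegenbauer_derivative (α := α) n).2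
  simp at h
  linarith

/-- A linear functional on polynomials that annihilates `(1 - X²) p' - (2α + 1) X p`, as does
integration against the weight `(1 - x²)^{α - 1/2}`. -/
structure IsGegenbauerFunctional (α : ℝ) (ℓ : ℝ[X] →ₗ[ℝ] ℝ) : Prop where
  map_one : ℓ 1 = 1
  map_eq_zero : ∀ p : ℝ[X], ℓ ((1 - X ^ 2) * derivative p - C (2 * α + 1) * X * p) = 0

namespace IsGegenbauerFunctional

variable {ℓ : ℝ[X] →ₗ[ℝ] ℝ}

lemma map_C_mul (ℓ : ℝ[X] →ₗ[ℝ] ℝ) (a : ℝ) (p : ℝ[X]) : ℓ (C a * p) = a * ℓ p := by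
  rw [← smul_eq_C_mul, map_smul, smul_eq_mul]

/-- For `p = C_{m+1}` the annihilated polynomial is a combination of `C_m` and `C_{m+2}`, which
gives an induction in steps of two. -/
lemma map_gegenbauer (h : IsGegenbauerFunctional α ℓ) (hα : 0 < α) (n : ℕ) :
    ℓ (gegenbauer α (n + 1)) = 0 := by
  induction n using Nat.strong_induction_on with
  | _ n ih =>
    match n with
    | 0 =>
      have h1 := h.map_eq_zero 1
      simp only [derivative_one, mul_zero, mul_one, zero_sub, map_neg, neg_eq_zero] at h1
      rw [map_C_mul] at h1
      rw [zero_add, gegenbauer_one, map_C_mul]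
      have : ℓ X = 0 := by
        rcases mul_eq_zero.1 h1 with h2 | h2
        · linarith
        · exact h2
      rw [this, mul_zero]
    | m + 1 =>
      have h1 := h.map_eq_zero (gegenbauer α (m + 1))
      have R := gegenbauer_add_two (α := α) m
      have D := (gegenbauer_derivative (α := α) (m + 1)).2
      have key : C (2 * ((m : ℝ) + 1 + α)) * ((1 - X ^ 2) * derivative (gegenbauer α (m + 1))
          - C (2 * α + 1) * X * gegenbauer α (m + 1)) =
          C ((m : ℝ) * (m + 2 * α)) * gegenbauer α m
            - C (((m : ℝ) + 2) * (m + 2 + 2 * α)) * gegenbauer α (m + 2) := by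
        simp only [map_mul, map_add, map_natCast, map_ofNat, Polynomial.C_1] at D ⊢
        push_cast at D
        linear_combination (-2 * ((m : ℝ[X]) + 1 + C α)) * D - (m : ℝ[X]) * R
      have h2 := congrArg ℓ key
      rw [map_C_mul, h1, map_sub, map_C_mul, map_C_mul, mul_zero] at h2
      -- The factor `m` is essential: for `m = 0` the value `ℓ C_0 = 1` is not zero, but its
      -- coefficient is.
      have h3 : (m : ℝ) * (m + 2 * α) * ℓ (gegenbauer α m) = 0 := by
        rcases m with _ | m
        · simp
        · rw [ih m (by omega), mul_zero]
      rw [h3, zero_sub, eq_comm, neg_eq_zero] at h2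
      exact (mul_eq_zero.1 h2).resolve_left (by positivity)

/-- The three-term recurrence trades one power of `X` for a shift of the index by `±1`, which keeps
the index above the exponent. -/
lemma map_X_pow_mul_gegenbauer (h : IsGegenbauerFunctional α ℓ) (hα : 0 < α) (m n : ℕ)
    (hmn : m < n) : ℓ (X ^ m * gegenbauer α n) = 0 := by
  induction m generalizing n with
  | zero =>
    obtain ⟨n, rfl⟩ := Nat.exists_eq_succ_of_ne_zero hmn.ne'
    simpa using h.map_gegenbauer hα n
  | succ m ih =>
    obtain ⟨n, rfl⟩ := Nat.exists_eq_succ_of_ne_zero (by omega : n ≠ 0)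
    have R := gegenbauer_add_two (α := α) n
    have key : C (2 * ((n : ℝ) + 1 + α)) * (X ^ (m + 1) * gegenbauer α (n + 1)) =
        C ((n : ℝ) + 2) * (X ^ m * gegenbauer α (n + 2))
          + C ((n : ℝ) + 2 * α) * (X ^ m * gegenbauer α n) := by
      simp only [map_mul, map_add, map_natCast, map_ofNat, Polynomial.C_1]
      linear_combination (-X ^ m) * R
    have h2 := congrArg ℓ key
    rw [map_C_mul, map_add, map_C_mul, map_C_mul, ih (n + 2) (by omega), ih n (by omega)] at h2
    simp only [mul_zero, add_zero] at h2
    exact (mul_eq_zero.1 h2).resolve_left (by positivity)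

lemma map_mul_gegenbauer (h : IsGegenbauerFunctional α ℓ) (hα : 0 < α) {f : ℝ[X]} {n : ℕ}
    (hf : f.degree < n) : ℓ (f * gegenbauer α n) = 0 := by
  by_cases hf0 : f = 0
  · rw [hf0, zero_mul, map_zero]
  rw [f.as_sum_range' n ((natDegree_lt_iff_degree_lt hf0).2 hf), Finset.sum_mul, map_sum]
  refine Finset.sum_eq_zero fun i hi => ?_
  rw [← C_mul_X_pow_eq_monomial, mul_assoc, map_C_mul,
    h.map_X_pow_mul_gegenbauer hα i n (Finset.mem_range.1 hi), mul_zero]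

/-- The mixed value `ℓ (C_n X C_{n+1})` can be expressed by the norm of `C_n` (`up`) and by that of
`C_{n+1}` (`down`). The resulting ratio of consecutive norms agrees with the ratio of the values at
`1`, up to the factor `α / (n + α)`. -/
lemma map_gegenbauer_mul_self (h : IsGegenbauerFunctional α ℓ) (hα : 0 < α) (n : ℕ) :
    ((n : ℝ) + α) * ℓ (gegenbauer α n * gegenbauer α n) = α * (gegenbauer α n).eval 1 := by
  have low : ∀ m n : ℕ, m < n → ℓ (gegenbauer α m * gegenbauer α n) = 0 := fun m n hmn =>
    h.map_mul_gegenbauer hα ((degree_gegenbauer_le m).trans_lt (by exact_mod_cast hmn))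
  have up : ∀ n : ℕ, 2 * ((n : ℝ) + 1 + α) * ℓ (gegenbauer α n * (X * gegenbauer α (n + 1))) =
      ((n : ℝ) + 2 * α) * ℓ (gegenbauer α n * gegenbauer α n) := fun n => by
    have R := gegenbauer_add_two (α := α) n
    have key : C (2 * ((n : ℝ) + 1 + α)) * (gegenbauer α n * (X * gegenbauer α (n + 1))) =
        C ((n : ℝ) + 2) * (gegenbauer α n * gegenbauer α (n + 2))
          + C ((n : ℝ) + 2 * α) * (gegenbauer α n * gegenbauer α n) := by
      simp only [map_mul, map_add, map_natCast, map_ofNat, Polynomial.C_1]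
      linear_combination (-gegenbauer α n) * R
    have h2 := congrArg ℓ key
    rwa [map_C_mul, map_add, map_C_mul, map_C_mul, low n (n + 2) (by omega), mul_zero,
      zero_add] at h2
  have down : ∀ n : ℕ, ((n : ℝ) + 1) * ℓ (gegenbauer α (n + 1) * gegenbauer α (n + 1)) =
      2 * ((n : ℝ) + α) * ℓ (gegenbauer α n * (X * gegenbauer α (n + 1))) := fun n => by
    rcases n with _ | n
    · have key : gegenbauer α 1 * gegenbauer α 1 =
          C (2 * α) * (gegenbauer α 0 * (X * gegenbauer α 1)) := by
        rw [gegenbauer_zero, gegenbauer_one]; ring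
      rw [zero_add, key, map_C_mul]; simp
    · have R := gegenbauer_add_two (α := α) n
      have key : C ((n : ℝ) + 2) * (gegenbauer α (n + 2) * gegenbauer α (n + 2)) =
          C (2 * ((n : ℝ) + 1 + α)) * (gegenbauer α (n + 1) * (X * gegenbauer α (n + 2)))
            - C ((n : ℝ) + 2 * α) * (gegenbauer α n * gegenbauer α (n + 2)) := by
        simp only [map_mul, map_add, map_natCast, map_ofNat, Polynomial.C_1]
        linear_combination (gegenbauer α (n + 2)) * R
      have h2 := congrArg ℓ key
      rw [map_C_mul, map_sub, map_C_mul, map_C_mul, low n (n + 2) (by omega), mul_zero,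
        sub_zero] at h2
      push_cast
      linear_combination h2
  induction n with
  | zero => simp [gegenbauer_zero, h.map_one]
  | succ n ih =>
    have e := gegenbauer_eval_one_succ (α := α) n
    have hn : ((n : ℝ) + 1) ≠ 0 := by positivity
    apply mul_left_cancel₀ hn
    push_cast
    linear_combination ((n : ℝ) + 1 + α) * down n + ((n : ℝ) + α) * up n +
      ((n : ℝ) + 2 * α) * ih - α * e

/-- If a symmetric form `β` on polynomials is represented by a degree-preserving operator `T`,
`β p f = ℓ (T p * f)`, with `(T p)(1) = p(ρ)`, then the Gegenbauer polynomials are orthogonal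
for `β`, with `β C_n C_n = α / (n + α) C_n(ρ)`. -/
lemma twoPoint (h : IsGegenbauerFunctional α ℓ) (hα : 0 < α)
    (hpos : ∀ r : ℝ[X], ℓ (r * r) = 0 → r = 0) {β : ℝ[X] → ℝ[X] → ℝ} {T : ℝ[X] → ℝ[X]} {ρ : ℝ}
    (hsymm : ∀ p q, β p q = β q p) (hT : ∀ p f, β p f = ℓ (T p * f))
    (hdeg : ∀ p, (T p).degree ≤ p.degree) (heval : ∀ p, (T p).eval 1 = p.eval ρ) (m n : ℕ) :
    β (gegenbauer α m) (gegenbauer α n) =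
      if m = n then α / (n + α) * (gegenbauer α n).eval ρ else 0 := by
  have hlt : ∀ (p : ℝ[X]) (n : ℕ), p.degree < n → β p (gegenbauer α n) = 0 := fun p n hp => by
    rw [hT, h.map_mul_gegenbauer hα ((hdeg p).trans_lt hp)]
  split_ifs with hmn
  · subst hmn
    -- The constant `c` matches leading coefficients, so `r` has degree below `m`. The aim is `r =
    -- 0`: then `C_m` is an eigenvector of `T`, and evaluation at `1` identifies `c`.
    set c := (T (gegenbauer α m)).coeff m / (gegenbauer α m).coeff m with hc
    have hne := (coeff_gegenbauer_pos hα m).ne'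
    set r := T (gegenbauer α m) - C c * gegenbauer α m with hr
    have hrdeg : r.degree < m := by
      rw [degree_lt_iff_coeff_zero]
      intro i hi
      rcases hi.eq_or_lt with rfl | hi
      · rw [hr, coeff_sub, coeff_C_mul, hc, div_mul_cancel₀ _ hne, sub_self]
      · have h1 : (gegenbauer α m).degree < i :=
          (degree_gegenbauer_le m).trans_lt (by exact_mod_cast hi)
        rw [hr, coeff_sub, coeff_C_mul, coeff_eq_zero_of_degree_lt h1,
          coeff_eq_zero_of_degree_lt ((hdeg _).trans_lt h1), mul_zero, sub_zero]
    have hr0 : r = 0 := by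
      apply hpos
      -- The first term is `β C_m r = β r C_m`, where symmetry lets the degree of `r` count; the
      -- second is `ℓ (r C_m)`. Both vanish by degree.
      have h1 : r * r = T (gegenbauer α m) * r - C c * (r * gegenbauer α m) := by
        rw [hr]; ring
      rw [h1, map_sub, ← hT, hsymm, hlt r m hrdeg, map_C_mul, h.map_mul_gegenbauer hα hrdeg,
        mul_zero, sub_zero]
    have hTm : T (gegenbauer α m) = C c * gegenbauer α m := sub_eq_zero.1 hr0
    have h1 := heval (gegenbauer α m)
    rw [hTm, eval_mul, eval_C] at h1
    have h2 := h.map_gegenbauer_mul_self hα m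
    rw [hT, hTm, mul_assoc, map_C_mul, ← h1]
    field_simp
    linear_combination c * h2
  · rcases lt_or_gt_of_ne hmn with hlt' | hlt'
    · exact hlt _ _ ((degree_gegenbauer_le m).trans_lt (by exact_mod_cast hlt'))
    · rw [hsymm]
      exact hlt _ _ ((degree_gegenbauer_le n).trans_lt (by exact_mod_cast hlt'))

end IsGegenbauerFunctional

end Gegenbauer

/-! ### Standard Gaussian measures -/

section Direction

variable {E : Type*} [NormedAddCommGroup E] [NormedSpace ℝ E]

/-- The direction of a vector. -/
def dir (z : E) : E := ‖z‖⁻¹ • z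

lemma norm_smul_dir {z : E} : ‖z‖ • dir z = z := by
  by_cases hz : z = 0
  · simp [hz]
  · rw [dir, smul_inv_smul₀ (norm_ne_zero_iff.2 hz)]

lemma norm_dir_le (z : E) : ‖dir z‖ ≤ 1 := by
  rw [dir, norm_smul, norm_inv, norm_norm]
  exact inv_mul_le_one

lemma dir_smul {c : ℝ} (hc : 0 < c) (z : E) : dir (c • z) = dir z := by
  rw [dir, dir, norm_smul, Real.norm_of_nonneg hc.le, smul_smul]
  congr 1
  field_simp

end Direction

section StdGaussian

open scoped RealInnerProductSpace

variable {E : Type*} [NormedAddCommGroup E] [InnerProductSpace ℝ E] [FiniteDimensional ℝ E]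
  [MeasurableSpace E] [BorelSpace E]
variable {F : Type*} [NormedAddCommGroup F] [InnerProductSpace ℝ F] [FiniteDimensional ℝ F]
  [MeasurableSpace F] [BorelSpace F]

lemma charFun_map_continuousLinearMap (μ : Measure E) (A : E →L[ℝ] F) (t : F) :
    charFun (μ.map A) t = charFun μ (A.adjoint t) := by
  rw [charFun_apply, charFun_apply, integral_map (by fun_prop) (by fun_prop)]
  simp_rw [ContinuousLinearMap.adjoint_inner_right]

/-- The characteristic function of the image at `t` depends on `‖A.adjoint t‖` only. This serves for
orthonormal coordinates and for the projection to a single batch. -/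
lemma stdGaussian_map_of_norm_adjoint (A : E →L[ℝ] F) (hA : ∀ t, ‖A.adjoint t‖ = ‖t‖) :
    (stdGaussian E).map A = stdGaussian F := by
  have : IsProbabilityMeasure ((stdGaussian E).map A) :=
    Measure.isProbabilityMeasure_map (by fun_prop)
  apply Measure.ext_of_charFun
  ext t
  rw [charFun_map_continuousLinearMap, charFun_stdGaussian, charFun_stdGaussian, hA]

/-- The normalizing constant of the standard Gaussian density. -/
def gaussNorm (E : Type*) [NormedAddCommGroup E] [InnerProductSpace ℝ E] [FiniteDimensional ℝ E]
    [MeasurableSpace E] [BorelSpace E] : ℝ :=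
  ∫ z : E, Real.exp (-(1 / 2) * ‖z‖ ^ 2)

lemma gaussNorm_pos : 0 < gaussNorm E := by
  rw [gaussNorm, GaussianFourier.integral_rexp_neg_mul_sq_norm (by norm_num)]
  positivity

lemma integrable_exp_neg_mul_norm_sq {c : ℝ} (hc : 0 < c) :
    Integrable fun z : E => Real.exp (-c * ‖z‖ ^ 2) := by
  have h := GaussianFourier.integrable_cexp_neg_mul_sq_norm_add (b := (c : ℂ)) (by simpa using hc)
    0 (0 : E)
  convert h.norm using 2 with z
  simp [Complex.norm_exp, ← Complex.ofReal_pow]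

/-- Both sides have the same characteristic function, by the Gaussian Fourier integral; `gaussNorm`
cancels its constant. -/
lemma stdGaussian_eq_withDensity :
    stdGaussian E = (volume : Measure E).withDensity
      fun z => ENNReal.ofReal ((gaussNorm E)⁻¹ * Real.exp (-(1 / 2) * ‖z‖ ^ 2)) := by
  have hint : Integrable fun z : E => (gaussNorm E)⁻¹ * Real.exp (-(1 / 2) * ‖z‖ ^ 2) :=
    (integrable_exp_neg_mul_norm_sq (by norm_num)).const_mul _
  have hpos := gaussNorm_pos (E := E)
  have : IsFiniteMeasure ((volume : Measure E).withDensity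
      fun z => ENNReal.ofReal ((gaussNorm E)⁻¹ * Real.exp (-(1 / 2) * ‖z‖ ^ 2))) :=
    isFiniteMeasure_withDensity_ofReal hint.2
  apply Measure.ext_of_charFun
  ext t
  rw [charFun_stdGaussian, charFun_apply, integral_withDensity_eq_integral_toReal_smul
    (by fun_prop) (by simp)]
  have hZ : ((gaussNorm E : ℝ) : ℂ) =
      (Real.pi / (1 / 2 : ℂ)) ^ (Module.finrank ℝ E / 2 : ℂ) := by
    rw [← GaussianFourier.integral_cexp_neg_mul_sq_norm (V := E) (by norm_num), gaussNorm,
      ← integral_complex_ofReal]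
    congr 1 with z
    push_cast; rfl
  have h := GaussianFourier.integral_cexp_neg_mul_sq_norm_add (b := (1 / 2 : ℂ)) (by norm_num)
    Complex.I t
  rw [← hZ] at h
  have e : ∀ z : E, (ENNReal.ofReal ((gaussNorm E)⁻¹ * Real.exp (-(1 / 2) * ‖z‖ ^ 2))).toReal •
      Complex.exp (⟪z, t⟫ * Complex.I) = ((gaussNorm E : ℝ) : ℂ)⁻¹ *
        Complex.exp (-(1 / 2) * ‖z‖ ^ 2 + Complex.I * ⟪t, z⟫) := fun z => by
    rw [ENNReal.toReal_ofReal (by positivity), Complex.real_smul, Complex.exp_add,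
      real_inner_comm t z]
    push_cast
    ring_nf
  simp_rw [e]
  rw [integral_const_mul, h, inv_mul_cancel_left₀ (by exact_mod_cast hpos.ne')]
  congr 1
  simp
  ring

lemma integral_stdGaussian {V : Type*} [NormedAddCommGroup V] [NormedSpace ℝ V] (f : E → V) :
    ∫ z, f z ∂(stdGaussian E) =
      (gaussNorm E)⁻¹ • ∫ z : E, Real.exp (-(1 / 2) * ‖z‖ ^ 2) • f z := by
  have hpos := gaussNorm_pos (E := E)
  rw [stdGaussian_eq_withDensity, integral_withDensity_eq_integral_toReal_smul
    (by fun_prop) (by simp), ← integral_smul]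
  congr 1 with z
  rw [ENNReal.toReal_ofReal (by positivity), mul_smul]

lemma integrable_stdGaussian_iff {V : Type*} [NormedAddCommGroup V] [NormedSpace ℝ V]
    {f : E → V} : Integrable f (stdGaussian E) ↔
      Integrable fun z : E => Real.exp (-(1 / 2) * ‖z‖ ^ 2) • f z := by
  have hpos := gaussNorm_pos (E := E)
  rw [stdGaussian_eq_withDensity, integrable_withDensity_iff_integrable_smul'
    (by fun_prop) (by simp)]
  have e : ∀ z : E, (ENNReal.ofReal ((gaussNorm E)⁻¹ * Real.exp (-(1 / 2) * ‖z‖ ^ 2))).toReal •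
      f z = (gaussNorm E)⁻¹ • (Real.exp (-(1 / 2) * ‖z‖ ^ 2) • f z) := fun z => by
    rw [ENNReal.toReal_ofReal (by positivity), mul_smul]
  simp_rw [e]
  exact integrable_smul_iff (inv_ne_zero hpos.ne') _

lemma stdGaussian_absolutelyContinuous : stdGaussian E ≪ (volume : Measure E) := by
  rw [stdGaussian_eq_withDensity]
  exact withDensity_absolutelyContinuous _ _

/-! ### Norm and direction -/

lemma measurable_dir : Measurable (dir : E → E) := by
  unfold dir; fun_prop

/-- Polar coordinates. The two factors are left unnormalized, since setting `f` or `g` to `1`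
eliminates their constants later. -/
lemma exists_integral_norm_dir [Nontrivial E] (f : E → ℝ) (g : ℝ → ℝ) :
    ∫ z, g ‖z‖ * f (dir z) ∂(stdGaussian E) =
      (∫ u : Metric.sphere (0 : E) 1, f u ∂(volume : Measure E).toSphere) *
        ∫ r : Set.Ioi (0 : ℝ), (gaussNorm E)⁻¹ * (Real.exp (-(1 / 2) * (r : ℝ) ^ 2) * g r)
          ∂(Measure.volumeIoiPow (Module.finrank ℝ E - 1)) := by
  rw [integral_stdGaussian, ← integral_smul]
  have h1 : ∫ z : E, (gaussNorm E)⁻¹ • Real.exp (-(1 / 2) * ‖z‖ ^ 2) • (g ‖z‖ * f (dir z)) =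
      ∫ z : ({0}ᶜ : Set E), (gaussNorm E)⁻¹ •
        Real.exp (-(1 / 2) * ‖z.1‖ ^ 2) • (g ‖z.1‖ * f (dir z.1))
          ∂((volume : Measure E).comap (↑)) := by
    rw [integral_subtype_comap (measurableSet_singleton _).compl
      fun z : E => (gaussNorm E)⁻¹ • Real.exp (-(1 / 2) * ‖z‖ ^ 2) • (g ‖z‖ * f (dir z)),
      restrict_compl_singleton]
  rw [h1, ← integral_prod_mul]
  rw [← (volume : Measure E).measurePreserving_homeomorphUnitSphereProd.integral_comp
    (Homeomorph.measurableEmbedding _)]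
  congr 1 with z
  simp only [homeomorphUnitSphereProd_apply_snd_coe, homeomorphUnitSphereProd_apply_fst_coe,
    smul_eq_mul, dir]
  ring

/-- Four instances of the polar formula suffice: the one with `f = g = 1` says that the product of
the two total masses is `1`, so the mean of a product factors. -/
lemma indepFun_norm_dir [Nontrivial E] :
    IndepFun (fun z : E => ‖z‖) dir (stdGaussian E) := by
  refine (indepFun_iff_integral_comp_mul (hfm := measurable_norm) (hgm := measurable_dir)).2 ?_
  intro g f _ _ _ _
  have h := exists_integral_norm_dir (E := E) f g
  have hg := exists_integral_norm_dir (E := E) (fun _ => 1) g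
  have hf := exists_integral_norm_dir (E := E) f (fun _ => 1)
  have h1 := exists_integral_norm_dir (E := E) (fun _ => 1) (fun _ => 1)
  simp only [mul_one, one_mul, integral_const, probReal_univ, smul_eq_mul] at h hg hf h1
  change ∫ z, g ‖z‖ * f (dir z) ∂(stdGaussian E) =
    (∫ z, g ‖z‖ ∂(stdGaussian E)) * ∫ z, f (dir z) ∂(stdGaussian E)
  rw [h, hg, hf]
  linear_combination ((∫ u : Metric.sphere (0 : E) 1, f u ∂(volume : Measure E).toSphere) *
    ∫ r : Set.Ioi (0 : ℝ), (gaussNorm E)⁻¹ * (Real.exp (-(1 / 2) * (r : ℝ) ^ 2) * g r)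
          ∂(Measure.volumeIoiPow (Module.finrank ℝ E - 1))) * h1

/-- Expectations of functions of the norm and of the direction factor. -/
lemma integral_norm_mul_dir [Nontrivial E] {f : E → ℝ} {g : ℝ → ℝ} (hf : Measurable f)
    (hg : Measurable g) :
    ∫ z, g ‖z‖ * f (dir z) ∂(stdGaussian E) =
      (∫ z, g ‖z‖ ∂(stdGaussian E)) * ∫ z, f (dir z) ∂(stdGaussian E) :=
  indepFun_norm_dir.integral_fun_comp_mul_comp measurable_norm.aemeasurable
    measurable_dir.aemeasurable hg.aestronglyMeasurable hf.aestronglyMeasurable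

lemma integrable_norm_mul_dir [Nontrivial E] {f : E → ℝ} {g : ℝ → ℝ} (hf : Measurable f)
    (hg : Measurable g) (hfi : Integrable (fun z => f (dir z)) (stdGaussian E))
    (hgi : Integrable (fun z : E => g ‖z‖) (stdGaussian E)) :
    Integrable (fun z : E => g ‖z‖ * f (dir z)) (stdGaussian E) :=
  (indepFun_norm_dir.comp hg hf).integrable_mul hgi hfi

/-! ### Moments of the norm -/

lemma integrable_norm_rpow [Nontrivial E] {s : ℝ} (hs : 0 < Module.finrank ℝ E + s) :
    Integrable (fun z : E => ‖z‖ ^ s) (stdGaussian E) := by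
  have hn : 0 < Module.finrank ℝ E := Module.finrank_pos
  rw [integrable_stdGaussian_iff]
  refine (integrable_fun_norm_addHaar (volume : Measure E)
    (f := fun y => Real.exp (-(1 / 2) * y ^ 2) • y ^ s)).2 ?_
  refine (integrableOn_rpow_mul_exp_neg_mul_sq (b := 1 / 2) (by norm_num)
    (s := Module.finrank ℝ E - 1 + s) (by linarith)).congr_fun (fun y hy => ?_) measurableSet_Ioi
  have hy : 0 < y := hy
  simp only [smul_eq_mul]
  rw [Real.rpow_add hy, ← Nat.cast_pred hn, Real.rpow_natCast]
  ring

/-- The radial integral is a Gamma integral. The constant `K` is independent of `s`, and is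
determined afterwards from the case `s = 0`. -/
lemma exists_integral_norm_rpow (E : Type*) [NormedAddCommGroup E] [InnerProductSpace ℝ E]
    [FiniteDimensional ℝ E] [MeasurableSpace E] [BorelSpace E] [Nontrivial E] :
    ∃ K : ℝ, ∀ s : ℝ, 0 < Module.finrank ℝ E + s → ∫ z : E, ‖z‖ ^ s ∂(stdGaussian E) =
      K * ((2 : ℝ) ^ (s / 2) * Real.Gamma ((Module.finrank ℝ E + s) / 2)) := by
  have hn : 0 < Module.finrank ℝ E := Module.finrank_pos
  refine ⟨(gaussNorm E)⁻¹ * (Module.finrank ℝ E * volume.real (Metric.ball (0 : E) 1)) *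
    ((1 / 2 : ℝ) ^ (-(Module.finrank ℝ E : ℝ) / 2) * (1 / 2)), fun s hs => ?_⟩
  rw [integral_stdGaussian, integral_fun_norm_addHaar (volume : Measure E)
    (fun y => Real.exp (-(1 / 2) * y ^ 2) • y ^ s)]
  have : ∫ y in Set.Ioi (0 : ℝ), y ^ (Module.finrank ℝ E - 1) •
      (Real.exp (-(1 / 2) * y ^ 2) • y ^ s) =
      ∫ y in Set.Ioi (0 : ℝ), y ^ ((Module.finrank ℝ E : ℝ) - 1 + s) *
        Real.exp (-(1 / 2) * y ^ (2 : ℝ)) := by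
    refine setIntegral_congr_fun measurableSet_Ioi fun y hy => ?_
    have hy : 0 < y := hy
    simp only [smul_eq_mul, Real.rpow_two]
    rw [Real.rpow_add hy, ← Nat.cast_pred hn, Real.rpow_natCast]
    ring
  rw [this, integral_rpow_mul_exp_neg_mul_rpow (by norm_num) (by linarith) (by norm_num)]
  have e1 : ((Module.finrank ℝ E : ℝ) - 1 + s + 1) = Module.finrank ℝ E + s := by ring
  have e2 : (1 / 2 : ℝ) ^ (-((Module.finrank ℝ E : ℝ) + s) / 2) =
      (1 / 2 : ℝ) ^ (-(Module.finrank ℝ E : ℝ) / 2) * 2 ^ (s / 2) := by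
    rw [neg_add, add_div, Real.rpow_add (by norm_num), neg_div 2 s,
      Real.rpow_neg (by norm_num) (s / 2), one_div, Real.inv_rpow (by norm_num) (s / 2), inv_inv]
  rw [e1, e2]
  simp only [nsmul_eq_mul, smul_eq_mul]
  ring

lemma integral_norm_rpow [Nontrivial E] {s : ℝ} (hs : 0 < Module.finrank ℝ E + s) :
    ∫ z : E, ‖z‖ ^ s ∂(stdGaussian E) =
      2 ^ (s / 2) * Real.Gamma ((Module.finrank ℝ E + s) / 2) /
        Real.Gamma ((Module.finrank ℝ E : ℝ) / 2) := by
  have hn : 0 < (Module.finrank ℝ E : ℝ) := by exact_mod_cast Module.finrank_pos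
  obtain ⟨K, hK⟩ := exists_integral_norm_rpow E
  have h0 := hK 0 (by linarith)
  have hG : 0 < Real.Gamma ((Module.finrank ℝ E : ℝ) / 2) := Real.Gamma_pos_of_pos (by positivity)
  simp at h0
  rw [hK s hs, eq_div_iff hG.ne']
  linear_combination (-(2 ^ (s / 2) * Real.Gamma ((Module.finrank ℝ E + s) / 2))) * h0

lemma integral_norm_rpow_add_two [Nontrivial E] {s : ℝ} (hs : 0 < Module.finrank ℝ E + s) :
    ∫ z : E, ‖z‖ ^ (s + 2) ∂(stdGaussian E) =
      (Module.finrank ℝ E + s) * ∫ z : E, ‖z‖ ^ s ∂(stdGaussian E) := by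
  rw [integral_norm_rpow hs, integral_norm_rpow (by linarith)]
  have e : ((Module.finrank ℝ E : ℝ) + (s + 2)) / 2 = (Module.finrank ℝ E + s) / 2 + 1 := by ring
  rw [e, Real.Gamma_add_one (by positivity), add_div s, Real.rpow_add (by norm_num)]
  simp
  ring

end StdGaussian

/-! ### The Gegenbauer weight -/

section Weight

/-- A function with a left limit at `1` that is integrable against `(1 - x)⁻¹` vanishes there. -/
lemma eq_zero_of_tendsto_of_integrableOn {F : ℝ → ℝ} {L : ℝ}
    (hF : Tendsto F (𝓝[<] 1) (𝓝 L))
    (hint : IntegrableOn (fun x => F x / (1 - x ^ 2)) (Set.Ioo (-1) 1)) : L = 0 := by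
  by_contra hL
  have hpos : 0 < |L| / 2 := by positivity
  have h1 : ∀ᶠ x in 𝓝[<] (1 : ℝ), |L| / 2 < |F x| :=
    hF.abs.eventually (lt_mem_nhds (by linarith [abs_pos.2 hL]))
  obtain ⟨c, hc, hcF⟩ := (mem_nhdsLT_iff_exists_Ioo_subset' (show (0 : ℝ) < 1 by norm_num)).1
    (h1.and (Ioo_mem_nhdsLT (show (0 : ℝ) < 1 by norm_num)))
  set d := max c 0 with hd
  have hd1 : d < 1 := max_lt hc one_pos
  have hint' : IntegrableOn (fun x => F x / (1 - x ^ 2)) (Set.Ioo d 1) :=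
    hint.mono_set (Set.Ioo_subset_Ioo (by linarith [le_max_right c 0]) le_rfl)
  -- On `(d, 1)` one has `1 - x² ≤ 2 (1 - x)` and `|F| > |L| / 2`, so a multiple of `F / (1 - x²)`
  -- dominates `1 / (1 - x)`, which is not integrable.
  have hinv : IntegrableOn (fun x : ℝ => (x - 1)⁻¹) (Set.Ioo d 1) := by
    refine Integrable.mono' (hint'.norm.const_mul (2 * (|L| / 2)⁻¹))
      (by fun_prop) ?_
    refine (ae_restrict_iff' measurableSet_Ioo).2 (ae_of_all _ fun x hx => ?_)
    obtain ⟨hx1, hx0, hx1'⟩ := hcF ⟨(le_max_left c 0).trans_lt hx.1, hx.2⟩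
    have e1 : (0 : ℝ) < 1 - x := by linarith
    have e2 : (0 : ℝ) < 1 - x ^ 2 := by nlinarith
    rw [norm_inv, Real.norm_eq_abs, Real.norm_eq_abs, abs_div, abs_of_pos e2, abs_sub_comm,
      abs_of_pos e1, inv_eq_one_div, mul_div_assoc', div_le_div_iff₀ e1 e2, one_mul]
    have : 1 ≤ (|L| / 2)⁻¹ * |F x| := by
      rw [inv_mul_eq_div, le_div_iff₀ hpos]; linarith
    nlinarith
  have := (intervalIntegrable_iff_integrableOn_Ioo_of_le hd1.le).2 hinv
  rcases intervalIntegrable_sub_inv_iff.1 this with h | h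
  · exact hd1.ne h
  · exact h (by rw [Set.uIcc_of_le hd1.le]; exact Set.right_mem_Icc.2 hd1.le)

variable {B : ℕ}

lemma one_sub_sq_pos {x : ℝ} (hx : x ∈ Set.Ioo (-1 : ℝ) 1) : 0 < 1 - x ^ 2 := by
  nlinarith [hx.1, hx.2]

lemma hasDerivAt_weight {x : ℝ} (hx : x ∈ Set.Ioo (-1 : ℝ) 1) (s : ℝ) :
    HasDerivAt (fun x : ℝ => (1 - x ^ 2) ^ s) (-(2 * s) * x * (1 - x ^ 2) ^ (s - 1)) x := by
  have h1 : HasDerivAt (fun x : ℝ => 1 - x ^ 2) (-(2 * x)) x := by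
    simpa using (hasDerivAt_pow 2 x).const_sub 1
  convert h1.rpow_const (p := s) (Or.inl (one_sub_sq_pos hx).ne') using 1
  ring

/-- Integration by parts against the Gegenbauer weight: the boundary terms vanish. -/
lemma integral_deriv_mul_weight (hB : 4 ≤ B) {ψ : ℝ → ℝ}
    (hac : ∀ r, 0 < r → r < 1 → AbsolutelyContinuousOnInterval ψ (-r) r)
    (hd : IntegrableOn (fun x => deriv ψ x * (1 - x ^ 2) ^ (((B : ℝ) - 3) / 2)) (Set.Ioo (-1) 1))
    (hi : IntegrableOn (fun x => ψ x * (1 - x ^ 2) ^ (((B : ℝ) - 4) / 2)) (Set.Ioo (-1) 1)) :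
    ∫ x in Set.Ioo (-1) 1, deriv ψ x * (1 - x ^ 2) ^ (((B : ℝ) - 2) / 2) =
      ((B : ℝ) - 2) * ∫ x in Set.Ioo (-1) 1, x * ψ x * (1 - x ^ 2) ^ (((B : ℝ) - 4) / 2) := by
  have hB' : (4 : ℝ) ≤ B := by exact_mod_cast hB
  set g : ℝ → ℝ := fun x => (1 - x ^ 2) ^ (((B : ℝ) - 2) / 2) with hg
  have hgd : ∀ x ∈ Set.Ioo (-1 : ℝ) 1, HasDerivAt g
      (-((B : ℝ) - 2) * x * (1 - x ^ 2) ^ (((B : ℝ) - 4) / 2)) x := fun x hx => by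
    convert hasDerivAt_weight hx (((B : ℝ) - 2) / 2) using 1
    rw [show ((B : ℝ) - 2) / 2 - 1 = ((B : ℝ) - 4) / 2 by ring]
    ring
  have hI1 : IntegrableOn (fun x => deriv ψ x * g x) (Set.Ioo (-1) 1) := by
    have : IntegrableOn (fun x => (deriv ψ x * (1 - x ^ 2) ^ (((B : ℝ) - 3) / 2)) *
        (1 - x ^ 2) ^ (1 / 2 : ℝ)) (Set.Ioo (-1) 1) := by
      refine Integrable.mul_bdd (c := 1) hd (Measurable.aestronglyMeasurable (by fun_prop)) ?_
      refine (ae_restrict_iff' measurableSet_Ioo).2 (ae_of_all _ fun x hx => ?_)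
      have := one_sub_sq_pos hx
      rw [Real.norm_of_nonneg (by positivity)]
      exact Real.rpow_le_one this.le (by nlinarith [sq_nonneg x]) (by norm_num)
    refine this.congr_fun (fun x hx => ?_) measurableSet_Ioo
    simp only [hg]
    rw [mul_assoc, ← Real.rpow_add (one_sub_sq_pos hx)]
    congr 2; ring
  have hI2 : IntegrableOn (fun x => x * ψ x * (1 - x ^ 2) ^ (((B : ℝ) - 4) / 2))
      (Set.Ioo (-1) 1) := by
    have : IntegrableOn (fun x => x * (ψ x * (1 - x ^ 2) ^ (((B : ℝ) - 4) / 2)))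
        (Set.Ioo (-1) 1) := by
      refine Integrable.bdd_mul (c := 1) hi (by fun_prop) ?_
      refine (ae_restrict_iff' measurableSet_Ioo).2 (ae_of_all _ fun x hx => ?_)
      rw [Real.norm_eq_abs, abs_le]
      exact ⟨hx.1.le, hx.2.le⟩
    simpa only [mul_assoc] using this
  set h : ℝ → ℝ := fun x => deriv ψ x * g x -
    ((B : ℝ) - 2) * (x * ψ x * (1 - x ^ 2) ^ (((B : ℝ) - 4) / 2)) with hh
  have hI : IntegrableOn h (Set.Ioo (-1) 1) := hI1.sub (hI2.const_mul _)
  have hIi : IntervalIntegrable h volume (-1) 1 :=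
    (intervalIntegrable_iff_integrableOn_Ioo_of_le (by norm_num)).2 hI
  have hP := intervalIntegral.continuousOn_primitive_interval' hIi
    (a := 0) (by rw [Set.uIcc_of_le (by norm_num)]; constructor <;> norm_num)
  rw [Set.uIcc_of_le (by norm_num)] at hP
  set F : ℝ → ℝ := fun x => ψ x * g x with hF
  -- Absolute continuity is available only away from the endpoints. Since `h` is the derivative of
  -- `F` almost everywhere and is integrable up to the endpoints, `F` has limits there.
  have hFP : ∀ b ∈ Set.Ioo (-1 : ℝ) 1, F b = F 0 + ∫ x in (0 : ℝ)..b, h x := by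
    intro b hb
    obtain ⟨r, hr0, hr1, hbr⟩ : ∃ r : ℝ, 0 < r ∧ r < 1 ∧ |b| ≤ r :=
      ⟨(|b| + 1) / 2, by positivity, by linarith [abs_lt.2 hb], by linarith [abs_lt.2 hb]⟩
    have hsub : Set.uIcc 0 b ⊆ Set.uIcc (-r) r := by
      rw [Set.uIcc_of_le (by linarith : -r ≤ r)]
      refine Set.uIcc_subset_Icc ⟨by linarith, hr0.le⟩ (abs_le.1 hbr)
    have hsub' : Set.uIcc 0 b ⊆ Set.Ioo (-1) 1 := hsub.trans (by
      rw [Set.uIcc_of_le (by linarith : -r ≤ r)]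
      exact fun x hx => ⟨by linarith [hx.1], by linarith [hx.2]⟩)
    have hgac : AbsolutelyContinuousOnInterval g 0 b := by
      apply ContDiffOn.absolutelyContinuousOnInterval
      intro x hx
      refine ContDiffAt.contDiffWithinAt ?_
      refine ContDiffAt.rpow_const_of_ne (by fun_prop) (one_sub_sq_pos (hsub' hx)).ne'
    have := (((hac r hr0 hr1).mono hsub).integral_deriv_mul_eq_sub hgac)
    have e : ∫ x in (0 : ℝ)..b, deriv ψ x * g x + ψ x * deriv g x = ∫ x in (0 : ℝ)..b, h x := by
      refine intervalIntegral.integral_congr fun x hx => ?_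
      simp only [hh]
      rw [(hgd x (hsub' hx)).deriv]
      ring
    rw [← e, this]
    simp only [hF]
    ring
  -- `F / (1 - x²)` is `ψ` times the Gegenbauer weight. Its integrability forces both limits of `F`
  -- to be zero.
  have hFint : IntegrableOn (fun x => F x / (1 - x ^ 2)) (Set.Ioo (-1) 1) := by
    refine hi.congr_fun (fun x hx => ?_) measurableSet_Ioo
    have hx' := one_sub_sq_pos hx
    simp only [hF, hg]
    rw [eq_div_iff hx'.ne', mul_assoc, ← Real.rpow_add_one hx'.ne']
    congr 2; ring
  have h1 : F 0 + ∫ x in (0 : ℝ)..1, h x = 0 := by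
    refine eq_zero_of_tendsto_of_integrableOn ?_ hFint
    have h2 : Tendsto (fun b => F 0 + ∫ x in (0 : ℝ)..b, h x) (𝓝[Set.Ioo (-1) 1] 1)
        (𝓝 (F 0 + ∫ x in (0 : ℝ)..1, h x)) :=
      (((hP 1 (by constructor <;> norm_num)).mono Set.Ioo_subset_Icc_self).tendsto).const_add _
    rw [nhdsWithin_Ioo_eq_nhdsLT (by norm_num)] at h2
    refine h2.congr' ?_
    filter_upwards [Ioo_mem_nhdsLT (show (-1 : ℝ) < 1 by norm_num)] with x hx
    exact (hFP x hx).symm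
  have h2 : F 0 + ∫ x in (0 : ℝ)..(-1), h x = 0 := by
    refine eq_zero_of_tendsto_of_integrableOn (F := fun x => F (-x)) ?_ ?_
    · have h2 : Tendsto (fun b => F 0 + ∫ x in (0 : ℝ)..b, h x) (𝓝[Set.Ioo (-1) 1] (-1))
          (𝓝 (F 0 + ∫ x in (0 : ℝ)..(-1), h x)) :=
        (((hP (-1) (by constructor <;> norm_num)).mono
          Set.Ioo_subset_Icc_self).tendsto).const_add _
      rw [nhdsWithin_Ioo_eq_nhdsGT (by norm_num)] at h2
      have h3 : Tendsto F (𝓝[>] (-1)) (𝓝 (F 0 + ∫ x in (0 : ℝ)..(-1), h x)) := by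
        refine h2.congr' ?_
        filter_upwards [Ioo_mem_nhdsGT (show (-1 : ℝ) < 1 by norm_num)] with x hx
        exact (hFP x hx).symm
      exact h3.comp tendsto_neg_nhdsLT
    · have := ((Measure.measurePreserving_neg (volume : Measure ℝ)).integrableOn_comp_preimage
        (MeasurableEquiv.neg ℝ).measurableEmbedding).2 hFint
      simpa [Function.comp_def] using this
  have h3 : ∫ x in (-1 : ℝ)..1, h x = 0 := by
    rw [← intervalIntegral.integral_add_adjacent_intervals (b := 0)
      (hIi.mono_set (Set.uIcc_subset_uIcc Set.left_mem_uIcc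
        (by rw [Set.uIcc_of_le (by norm_num)]; constructor <;> norm_num)))
      (hIi.mono_set (Set.uIcc_subset_uIcc
        (by rw [Set.uIcc_of_le (by norm_num)]; constructor <;> norm_num) Set.right_mem_uIcc)),
      intervalIntegral.integral_symm 0 (-1)]
    linarith
  rw [intervalIntegral.integral_of_le (by norm_num), integral_Ioc_eq_integral_Ioo, hh,
    integral_sub hI1 (hI2.const_mul _), integral_const_mul] at h3
  linarith

/-! ### The Gegenbauer weight as a finite measure, and its normalization. -/

lemma gegMeasure_density_measurable (B : ℕ) :
    Measurable fun x : ℝ => ENNReal.ofReal ((1 - x ^ 2) ^ (((B : ℝ) - 4) / 2)) := by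
  fun_prop

lemma integral_gegMeasure (B : ℕ) (f : ℝ → ℝ) :
    ∫ x, f x ∂(gegMeasure B) =
      ∫ x in Set.Ioo (-1) 1, f x * (1 - x ^ 2) ^ (((B : ℝ) - 4) / 2) := by
  rw [gegMeasure, integral_withDensity_eq_integral_toReal_smul
    (gegMeasure_density_measurable B) (by simp)]
  refine setIntegral_congr_fun measurableSet_Ioo fun x hx => ?_
  have := one_sub_sq_pos hx
  simp only [smul_eq_mul]
  rw [ENNReal.toReal_ofReal (by positivity), mul_comm]

lemma integrable_gegMeasure_iff (B : ℕ) (f : ℝ → ℝ) :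
    Integrable f (gegMeasure B) ↔
      IntegrableOn (fun x => f x * (1 - x ^ 2) ^ (((B : ℝ) - 4) / 2)) (Set.Ioo (-1) 1) := by
  rw [gegMeasure, integrable_withDensity_iff_integrable_smul'
    (gegMeasure_density_measurable B) (by simp)]
  refine integrable_congr ?_
  refine (ae_restrict_iff' measurableSet_Ioo).2 (ae_of_all _ fun x hx => ?_)
  have := one_sub_sq_pos hx
  simp only [smul_eq_mul]
  rw [ENNReal.toReal_ofReal (by positivity), mul_comm]

lemma isFiniteMeasure_gegMeasure (hB : 4 ≤ B) : IsFiniteMeasure (gegMeasure B) := by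
  have hB' : (4 : ℝ) ≤ B := by exact_mod_cast hB
  have : Integrable (fun _ : ℝ => (1 : ℝ)) (gegMeasure B) := by
    rw [integrable_gegMeasure_iff]
    refine Integrable.bdd_mul (c := 1) ?_ (by fun_prop) (by simp)
    refine Integrable.mono' (g := fun _ => 1) (integrableOn_const (by simp))
      (Measurable.aestronglyMeasurable (by fun_prop)) ?_
    refine (ae_restrict_iff' measurableSet_Ioo).2 (ae_of_all _ fun x hx => ?_)
    have := one_sub_sq_pos hx
    rw [Real.norm_of_nonneg (by positivity)]
    exact Real.rpow_le_one this.le (by nlinarith [sq_nonneg x]) (by linarith)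
  exact (integrable_const_iff_isFiniteMeasure one_ne_zero).1 this

lemma ae_gegMeasure_iff (B : ℕ) {p : ℝ → Prop} :
    (∀ᵐ x ∂(gegMeasure B), p x) ↔ ∀ᵐ x ∂(volume : Measure ℝ), x ∈ Set.Ioo (-1) 1 → p x := by
  rw [gegMeasure, ae_withDensity_iff (gegMeasure_density_measurable B),
    ae_restrict_iff' measurableSet_Ioo]
  refine eventually_congr (ae_of_all _ fun x => ?_)
  refine imp_congr_right fun hx => ?_
  have := one_sub_sq_pos hx
  have h : ENNReal.ofReal ((1 - x ^ 2) ^ (((B : ℝ) - 4) / 2)) ≠ 0 := by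
    rw [Ne, ENNReal.ofReal_eq_zero, not_le]
    positivity
  simp [h]

lemma gegMeasure_ne_zero (B : ℕ) : gegMeasure B ≠ 0 := by
  intro h
  have h1 : ∀ᵐ x ∂(gegMeasure B), False := by rw [h]; simp
  rw [ae_gegMeasure_iff, ae_iff] at h1
  have h2 : (volume : Measure ℝ) (Set.Ioo (-1) 1) = 0 := by
    convert h1 using 2
    ext x
    simp
  rw [Real.volume_Ioo] at h2
  norm_num at h2

/-- The normalized Gegenbauer weight. -/
def gegProb (B : ℕ) : Measure ℝ := (gegMeasure B Set.univ)⁻¹ • gegMeasure B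

lemma gegMeasure_univ_ne_zero (B : ℕ) : gegMeasure B Set.univ ≠ 0 := by
  rw [Ne, Measure.measure_univ_eq_zero]
  exact gegMeasure_ne_zero B

lemma isProbabilityMeasure_gegProb (hB : 4 ≤ B) : IsProbabilityMeasure (gegProb B) := by
  have := isFiniteMeasure_gegMeasure hB
  constructor
  rw [gegProb, Measure.smul_apply, smul_eq_mul,
    ENNReal.inv_mul_cancel (gegMeasure_univ_ne_zero B) (measure_ne_top _ _)]

lemma ae_gegProb_iff (hB : 4 ≤ B) {p : ℝ → Prop} :
    (∀ᵐ x ∂(gegProb B), p x) ↔ ∀ᵐ x ∂(gegMeasure B), p x := by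
  have := isFiniteMeasure_gegMeasure hB
  rw [gegProb, Measure.ae_ennreal_smul_measure_eq (ENNReal.inv_ne_zero.2 (measure_ne_top _ _))]

lemma integrable_gegProb_iff (hB : 4 ≤ B) {f : ℝ → ℝ} :
    Integrable f (gegProb B) ↔ Integrable f (gegMeasure B) := by
  have := isFiniteMeasure_gegMeasure hB
  exact integrable_smul_measure (ENNReal.inv_ne_zero.2 (measure_ne_top _ _))
    (ENNReal.inv_ne_top.2 (gegMeasure_univ_ne_zero B))

lemma memLp_gegProb {f : ℝ → ℝ} (hf : MemLp f 2 (gegMeasure B)) : MemLp f 2 (gegProb B) :=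
  hf.smul_measure (ENNReal.inv_ne_top.2 (gegMeasure_univ_ne_zero B))

lemma integral_gegProb (f : ℝ → ℝ) :
    ∫ x, f x ∂(gegProb B) =
      ((gegMeasure B Set.univ)⁻¹).toReal * ∫ x, f x ∂(gegMeasure B) := by
  rw [gegProb, integral_smul_measure, smul_eq_mul]

lemma ae_mem_Ioo_gegProb (hB : 4 ≤ B) : ∀ᵐ x ∂(gegProb B), x ∈ Set.Ioo (-1 : ℝ) 1 := by
  rw [ae_gegProb_iff hB, ae_gegMeasure_iff]
  exact ae_of_all _ fun x hx => hx

lemma integrable_eval_gegProb (hB : 4 ≤ B) (p : ℝ[X]) :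
    Integrable (fun x => p.eval x) (gegProb B) := by
  have := isProbabilityMeasure_gegProb hB
  obtain ⟨K, hK⟩ := isCompact_Icc.exists_bound_of_continuousOn (s := Set.Icc (-1 : ℝ) 1)
    (f := fun x => p.eval x) p.continuous.continuousOn
  refine Integrable.mono' (integrable_const K) (by fun_prop) ?_
  filter_upwards [ae_mem_Ioo_gegProb hB] with x hx using hK x (Set.Ioo_subset_Icc_self hx)

/-- Integration of polynomials against the normalized Gegenbauer weight. -/
def gegFun (hB : 4 ≤ B) : ℝ[X] →ₗ[ℝ] ℝ where
  toFun p := ∫ x, p.eval x ∂(gegProb B)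
  map_add' p q := by
    simp only [Polynomial.eval_add]
    exact integral_add (integrable_eval_gegProb hB p) (integrable_eval_gegProb hB q)
  map_smul' c p := by
    simp only [Polynomial.eval_smul, smul_eq_mul, RingHom.id_apply]
    exact integral_const_mul _ _

lemma gegFun_apply (hB : 4 ≤ B) (p : ℝ[X]) : gegFun hB p = ∫ x, p.eval x ∂(gegProb B) := rfl

/-- Integration by parts for expectations under the normalized weight. -/
lemma integral_gegProb_deriv (hB : 4 ≤ B) {ψ : ℝ → ℝ}
    (hac : ∀ r, 0 < r → r < 1 → AbsolutelyContinuousOnInterval ψ (-r) r)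
    (hd : IntegrableOn (fun x => deriv ψ x * (1 - x ^ 2) ^ (((B : ℝ) - 3) / 2)) (Set.Ioo (-1) 1))
    (hi : Integrable ψ (gegMeasure B)) :
    ∫ x, deriv ψ x * (1 - x ^ 2) ∂(gegProb B) = ((B : ℝ) - 2) * ∫ x, x * ψ x ∂(gegProb B) := by
  have h := integral_deriv_mul_weight hB hac hd ((integrable_gegMeasure_iff B ψ).1 hi)
  rw [integral_gegProb, integral_gegProb, integral_gegMeasure, integral_gegMeasure,
    mul_left_comm, ← h]
  congr 1
  refine setIntegral_congr_fun measurableSet_Ioo fun x hx => ?_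
  have := one_sub_sq_pos hx
  rw [mul_assoc, mul_comm (1 - x ^ 2), ← Real.rpow_add_one this.ne']
  congr 2; ring

/-- Integration by parts with `ψ` a polynomial; for `α = (B - 3) / 2` the constant `2α + 1` is `B -
2`. -/
lemma isGegenbauerFunctional_gegFun (hB : 4 ≤ B) :
    IsGegenbauerFunctional (((B : ℝ) - 3) / 2) (gegFun hB) where
  map_one := by
    have := isProbabilityMeasure_gegProb hB
    simp [gegFun_apply]
  map_eq_zero p := by
    have hB' : (4 : ℝ) ≤ B := by exact_mod_cast hB
    have hp : Integrable (fun x => p.eval x) (gegMeasure B) :=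
      (integrable_gegProb_iff hB).1 (integrable_eval_gegProb hB p)
    have h := integral_gegProb_deriv hB (ψ := fun x => p.eval x)
      (fun r _ _ => ContDiffOn.absolutelyContinuousOnInterval
        (by simpa using (Polynomial.contDiff_aeval (𝕜 := ℝ) p 1).contDiffOn))
      (by
        obtain ⟨K, hK⟩ := isCompact_Icc.exists_bound_of_continuousOn (s := Set.Icc (-1 : ℝ) 1)
          (f := fun x => p.derivative.eval x) p.derivative.continuous.continuousOn
        refine Integrable.mono' (g := fun _ => K) (integrableOn_const (by simp))
          (Measurable.aestronglyMeasurable (by simp only [Polynomial.deriv]; fun_prop)) ?_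
        refine (ae_restrict_iff' measurableSet_Ioo).2 (ae_of_all _ fun x hx => ?_)
        have := one_sub_sq_pos hx
        have h1 := hK x (Set.Ioo_subset_Icc_self hx)
        rw [Polynomial.deriv, norm_mul, Real.norm_of_nonneg (r := (1 - x ^ 2) ^ _) (by positivity)]
        have h2 : (1 - x ^ 2) ^ (((B : ℝ) - 3) / 2) ≤ 1 :=
          Real.rpow_le_one this.le (by nlinarith [sq_nonneg x]) (by linarith)
        nlinarith [norm_nonneg (p.derivative.eval x),
          Real.rpow_nonneg this.le (((B : ℝ) - 3) / 2)])
      hp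
    have e1 := integrable_eval_gegProb hB ((1 - Polynomial.X ^ 2) * Polynomial.derivative p)
    have e2 := integrable_eval_gegProb hB
      (Polynomial.C (2 * (((B : ℝ) - 3) / 2) + 1) * Polynomial.X * p)
    rw [map_sub, sub_eq_zero, gegFun_apply, gegFun_apply]
    simp only [Polynomial.deriv] at h
    simp only [Polynomial.eval_mul, Polynomial.eval_sub, Polynomial.eval_pow, Polynomial.eval_X,
      Polynomial.eval_one, Polynomial.eval_C, mul_assoc]
    rw [integral_const_mul, show 2 * (((B : ℝ) - 3) / 2) + 1 = (B : ℝ) - 2 by ring, ← h]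
    congr 1 with x
    ring

/-- A polynomial whose square has mean zero vanishes almost everywhere on `(-1, 1)`, hence at
infinitely many points. -/
lemma gegFun_mul_self_eq_zero (hB : 4 ≤ B) (r : ℝ[X]) (h : gegFun hB (r * r) = 0) : r = 0 := by
  rw [gegFun_apply, integral_eq_zero_iff_of_nonneg
    (fun x => by simpa using mul_self_nonneg (r.eval x)) (integrable_eval_gegProb hB _)] at h
  have h1 := (ae_gegMeasure_iff B).1 ((ae_gegProb_iff hB).1 h)
  refine Polynomial.eq_zero_of_infinite_isRoot r fun hfin => ?_
  have h2 : Set.Ioo (-1 : ℝ) 1 ⊆ {x | ¬ (x ∈ Set.Ioo (-1 : ℝ) 1 → (r * r).eval x = 0)} ∪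
      {x | r.IsRoot x} := fun x hx => by
    by_cases hr : r.IsRoot x
    · exact Or.inr hr
    · refine Or.inl fun h3 => hr ?_
      simpa using h3 hx
  have h3 := (measure_mono h2).trans (measure_union_le (μ := (volume : Measure ℝ)) _ _)
  have h4 : (volume : Measure ℝ) {x | ¬ (x ∈ Set.Ioo (-1 : ℝ) 1 → (r * r).eval x = 0)} = 0 := h1
  rw [h4, hfin.measure_zero, Real.volume_Ioo] at h3
  norm_num at h3

/-- Finite measures carried by `[-1, 1]` are determined by their moments. -/
lemma ext_of_integral_pow {μ ν : Measure ℝ} [IsFiniteMeasure μ] [IsFiniteMeasure ν]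
    (hμ : ∀ᵐ x ∂μ, x ∈ Set.Icc (-1 : ℝ) 1) (hν : ∀ᵐ x ∂ν, x ∈ Set.Icc (-1 : ℝ) 1)
    (h : ∀ m : ℕ, ∫ x, x ^ m ∂μ = ∫ x, x ^ m ∂ν) : μ = ν := by
  have hint : ∀ (κ : Measure ℝ) [IsFiniteMeasure κ], (∀ᵐ x ∂κ, x ∈ Set.Icc (-1 : ℝ) 1) →
      ∀ f : ℝ → ℝ, Continuous f → Integrable f κ := by
    intro κ _ hκ f hf
    obtain ⟨K, hK⟩ := isCompact_Icc.exists_bound_of_continuousOn (s := Set.Icc (-1 : ℝ) 1)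
      hf.continuousOn
    refine Integrable.mono' (integrable_const K) hf.aestronglyMeasurable ?_
    filter_upwards [hκ] with x hx using hK x hx
  have hpoly : ∀ p : ℝ[X], ∫ x, p.eval x ∂μ = ∫ x, p.eval x ∂ν := by
    intro p
    simp_rw [Polynomial.eval_eq_sum_range]
    rw [integral_finsetSum _ fun i _ => hint μ hμ _ (by fun_prop),
      integral_finsetSum _ fun i _ => hint ν hν _ (by fun_prop)]
    refine Finset.sum_congr rfl fun i _ => ?_
    rw [integral_const_mul, integral_const_mul, h]
  refine ext_of_forall_integral_eq_of_IsFiniteMeasure fun f => ?_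
  refine eq_of_forall_dist_le fun ε hε => ?_
  set K := μ.real Set.univ + ν.real Set.univ + 1 with hK
  have hKpos : 0 < K := by positivity
  -- Weierstrass approximation; dividing `ε` by the sum of both masses plus `1` keeps the two errors
  -- together below `ε`.
  obtain ⟨p, hp⟩ := exists_polynomial_near_of_continuousOn (-1) 1 f f.continuous.continuousOn
    (ε / K) (by positivity)
  have hb : ∀ (κ : Measure ℝ) [IsFiniteMeasure κ], (∀ᵐ x ∂κ, x ∈ Set.Icc (-1 : ℝ) 1) →
      |∫ x, f x ∂κ - ∫ x, p.eval x ∂κ| ≤ ε / K * κ.real Set.univ := by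
    intro κ _ hκ
    rw [← integral_sub (hint κ hκ _ f.continuous) (hint κ hκ _ p.continuous), ← Real.norm_eq_abs]
    refine norm_integral_le_of_norm_le_const ?_
    filter_upwards [hκ] with x hx
    rw [Real.norm_eq_abs, abs_sub_comm]
    exact (hp x hx).le
  have h1 := hb μ hμ
  have h2 := hb ν hν
  rw [hpoly p] at h1
  rw [Real.dist_eq]
  have h3 : ε / K * μ.real Set.univ + ε / K * ν.real Set.univ ≤ ε := by
    rw [← mul_add, div_mul_eq_mul_div, div_le_iff₀ hKpos]
    nlinarith
  rw [abs_sub_comm] at h2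
  linarith [abs_sub_le (∫ x, f x ∂μ) (∫ x, p.eval x ∂ν) (∫ x, f x ∂ν)]

end Weight

/-! ### Moments of the uniform direction -/

section Sphere

open scoped RealInnerProductSpace

set_option linter.unusedSectionVars false

lemma stdGaussian_real : stdGaussian ℝ = gaussianReal 0 1 := by
  apply Measure.ext_of_charFun
  ext t
  rw [charFun_stdGaussian, charFun_gaussianReal]
  congr 1
  rw [← Complex.ofReal_pow, Real.norm_eq_abs, sq_abs]
  push_cast
  simp
  ring

/-- The moments of the standard real Gaussian. -/
def gaussMoment (i : ℕ) : ℝ := ∫ x, x ^ i ∂(gaussianReal 0 1)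

lemma gaussMoment_odd (i : ℕ) : gaussMoment (2 * i + 1) = 0 := by
  have h : ∫ x, x ^ (2 * i + 1) ∂(gaussianReal 0 1) =
      ∫ x, (-x) ^ (2 * i + 1) ∂(gaussianReal 0 1) := by
    conv_lhs => rw [show gaussianReal 0 1 = (gaussianReal 0 1).map (fun x => -x) by
      rw [gaussianReal_map_neg]; simp]
    rw [integral_map (by fun_prop) (by fun_prop)]
  simp only [Odd.neg_pow (⟨i, rfl⟩ : Odd (2 * i + 1)), integral_neg] at h
  rw [gaussMoment]
  linarith

/-- The recursion for moments of the norm, in the one-dimensional space `ℝ`. -/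
lemma gaussMoment_even_add_two (i : ℕ) :
    gaussMoment (2 * i + 2) = (2 * i + 1) * gaussMoment (2 * i) := by
  have h := integral_norm_rpow_add_two (E := ℝ) (s := 2 * i) (by simp; positivity)
  rw [stdGaussian_real] at h
  have e1 : ∀ x : ℝ, ‖x‖ ^ ((2 : ℝ) * i + 2) = x ^ (2 * i + 2) := fun x => by
    rw [show ((2 : ℝ) * i + 2) = ((2 * i + 2 : ℕ) : ℝ) by push_cast; ring, Real.rpow_natCast,
      Real.norm_eq_abs, Even.pow_abs ⟨i + 1, by ring⟩]
  have e2 : ∀ x : ℝ, ‖x‖ ^ ((2 : ℝ) * i) = x ^ (2 * i) := fun x => by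
    rw [show ((2 : ℝ) * i) = ((2 * i : ℕ) : ℝ) by push_cast; ring, Real.rpow_natCast,
      Real.norm_eq_abs, Even.pow_abs ⟨i, by ring⟩]
  simp only [e1, e2, Module.finrank_self, Nat.cast_one] at h
  rw [gaussMoment, gaussMoment, h]
  ring

lemma gaussMoment_add_two (i : ℕ) : gaussMoment (i + 2) = (i + 1) * gaussMoment i := by
  obtain ⟨j, rfl | rfl⟩ := i.even_or_odd'
  · rw [gaussMoment_even_add_two]; push_cast; ring
  · rw [show 2 * j + 1 + 2 = 2 * (j + 1) + 1 by ring, gaussMoment_odd, gaussMoment_odd, mul_zero]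

variable {E : Type*} [NormedAddCommGroup E] [InnerProductSpace ℝ E] [FiniteDimensional ℝ E]
  [MeasurableSpace E] [BorelSpace E]

/-- The map `T` with `T t = ∑ t i • v i` is an isometry, so its adjoint, which reads off the
coordinates along `v`, preserves standard Gaussians. -/
lemma stdGaussian_map_inner {ι : Type*} [Fintype ι] {v : ι → E} (hv : Orthonormal ℝ v) :
    (stdGaussian E).map (fun z i => ⟪v i, z⟫) = Measure.pi fun _ : ι => gaussianReal 0 1 := by
  classical
  let T : EuclideanSpace ℝ ι →L[ℝ] E :=
    ∑ i, (EuclideanSpace.proj i : EuclideanSpace ℝ ι →L[ℝ] ℝ).smulRight (v i)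
  have hT : ∀ t, T t = ∑ i, t i • v i := fun t => by simp [T]
  have hn : ∀ t, ‖T t‖ = ‖t‖ := fun t => by
    rw [← sq_eq_sq₀ (norm_nonneg _) (norm_nonneg _), ← real_inner_self_eq_norm_sq, hT,
      hv.inner_sum, EuclideanSpace.real_norm_sq_eq]
    simp [sq]
  have h := stdGaussian_map_of_norm_adjoint T.adjoint (fun t => by
    rw [ContinuousLinearMap.adjoint_adjoint, hn])
  have hA : ∀ z i, T.adjoint z i = ⟪v i, z⟫ := fun z i => by
    have h1 := ContinuousLinearMap.adjoint_inner_right T (EuclideanSpace.single i (1 : ℝ)) z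
    rw [hT] at h1
    simpa [EuclideanSpace.inner_single_left] using h1
  have h2 := congrArg (Measure.map (fun x : EuclideanSpace ℝ ι => WithLp.ofLp x)) h
  rw [← map_pi_eq_stdGaussian, Measure.map_map (by fun_prop) (by fun_prop),
    Measure.map_map (by fun_prop) (by fun_prop)] at h2
  convert h2 using 1
  · congr 1
    ext z i
    exact (hA z i).symm
  · exact (Measure.map_id).symm

lemma integral_prod_inner_pow {ι : Type*} [Fintype ι] {v : ι → E} (hv : Orthonormal ℝ v)
    (k : ι → ℕ) :
    ∫ z, ∏ i, ⟪v i, z⟫ ^ k i ∂(stdGaussian E) = ∏ i, gaussMoment (k i) := by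
  have h : ∫ z, ∏ i, ⟪v i, z⟫ ^ k i ∂(stdGaussian E) =
      ∫ x, ∏ i, x i ^ k i ∂((stdGaussian E).map (fun z i => ⟪v i, z⟫)) := by
    rw [integral_map (by fun_prop)
      (Finset.measurable_prod _ (by fun_prop)).aestronglyMeasurable]
  rw [h, stdGaussian_map_inner hv,
    integral_fintype_prod_eq_prod (f := fun i x => x ^ k i)]
  rfl

lemma orthonormal_pair {e w : E} (he : ‖e‖ = 1) (hw : ‖w‖ = 1) (hew : ⟪e, w⟫ = 0) :
    Orthonormal ℝ ![e, w] := by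
  constructor
  · intro i; fin_cases i <;> simp [he, hw]
  · intro i j hij
    fin_cases i <;> fin_cases j <;> simp_all [real_inner_comm]

/-- Mixed moments of two orthonormal coordinates of the direction of a Gaussian vector. -/
def dirMoment (e w : E) (i j : ℕ) : ℝ := ∫ z, ⟪e, dir z⟫ ^ i * ⟪w, dir z⟫ ^ j ∂(stdGaussian E)

variable {e w : E}

lemma inner_dir (e z : E) : ⟪e, z⟫ = ‖z‖ * ⟪e, dir z⟫ := by
  rw [← real_inner_smul_right, norm_smul_dir]

lemma abs_inner_dir_le (he : ‖e‖ = 1) (z : E) : |⟪e, dir z⟫| ≤ 1 := by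
  refine (abs_real_inner_le_norm _ _).trans ?_
  rw [he, one_mul]
  exact norm_dir_le z

lemma measurable_inner_dir (e : E) : Measurable fun z : E => ⟪e, dir z⟫ :=
  measurable_dir.const_inner

lemma integral_norm_pow_add_two [Nontrivial E] (k : ℕ) :
    ∫ z : E, ‖z‖ ^ (k + 2) ∂(stdGaussian E) =
      (Module.finrank ℝ E + k) * ∫ z : E, ‖z‖ ^ k ∂(stdGaussian E) := by
  have hn : 0 < (Module.finrank ℝ E : ℝ) := by exact_mod_cast Module.finrank_pos
  have h := integral_norm_rpow_add_two (E := E) (s := k) (by positivity)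
  have e : ((k : ℝ) + 2) = ((k + 2 : ℕ) : ℝ) := by push_cast; ring
  simpa only [e, Real.rpow_natCast] using h

lemma integral_norm_pow_pos [Nontrivial E] (k : ℕ) :
    0 < ∫ z : E, ‖z‖ ^ k ∂(stdGaussian E) := by
  have hn : 0 < (Module.finrank ℝ E : ℝ) := by exact_mod_cast Module.finrank_pos
  have h := integral_norm_rpow (E := E) (s := k) (by positivity)
  simp only [Real.rpow_natCast] at h
  rw [h]
  have h1 : 0 < Real.Gamma ((Module.finrank ℝ E + (k : ℝ)) / 2) :=
    Real.Gamma_pos_of_pos (by positivity)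
  have h2 : 0 < Real.Gamma ((Module.finrank ℝ E : ℝ) / 2) := Real.Gamma_pos_of_pos (by positivity)
  positivity

/-- By homogeneity a Gaussian monomial is `‖z‖ ^ (i + j)` times the monomial in the direction, and
the two are independent. Spherical moments thus follow from Gaussian ones. -/
lemma norm_pow_mul_dirMoment [Nontrivial E] (he : ‖e‖ = 1) (hw : ‖w‖ = 1) (hew : ⟪e, w⟫ = 0)
    (i j : ℕ) :
    (∫ z : E, ‖z‖ ^ (i + j) ∂(stdGaussian E)) * dirMoment e w i j =
      gaussMoment i * gaussMoment j := by
  have h := integral_prod_inner_pow (orthonormal_pair he hw hew) ![i, j]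
  simp only [Fin.prod_univ_two, Matrix.cons_val_zero, Matrix.cons_val_one] at h
  rw [← h, dirMoment, ← integral_norm_mul_dir (g := fun r => r ^ (i + j))
    (f := fun u => ⟪e, u⟫ ^ i * ⟪w, u⟫ ^ j) (by fun_prop) (by fun_prop)]
  congr 1 with z
  rw [inner_dir e z, inner_dir w z]
  ring

lemma norm_pow_mul_dirMoment_left [Nontrivial E] (he : ‖e‖ = 1) (i : ℕ) :
    (∫ z : E, ‖z‖ ^ i ∂(stdGaussian E)) * ∫ z, ⟪e, dir z⟫ ^ i ∂(stdGaussian E) =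
      gaussMoment i := by
  have hv : Orthonormal ℝ (fun _ : Unit => e) := ⟨fun _ => he, fun i j hij => (hij rfl).elim⟩
  have h := integral_prod_inner_pow hv (fun _ => i)
  simp only [Finset.univ_unique, Finset.prod_singleton] at h
  rw [← h, ← integral_norm_mul_dir (g := fun r => r ^ i)
    (f := fun u => ⟪e, u⟫ ^ i) (by fun_prop) (by fun_prop)]
  congr 1 with z
  rw [inner_dir e z]
  ring

/-- The law of a coordinate of the direction of a Gaussian vector is the normalized Gegenbauer
weight. -/
lemma map_inner_dir {B : ℕ} (hB : 4 ≤ B) (hn : Module.finrank ℝ E + 1 = B) (he : ‖e‖ = 1) :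
    (stdGaussian E).map (fun z => ⟪e, dir z⟫) = gegProb B := by
  have hfin : 0 < Module.finrank ℝ E := by omega
  have : Nontrivial E := Module.nontrivial_of_finrank_pos hfin
  have := isProbabilityMeasure_gegProb hB
  have hm := measurable_inner_dir e
  have : IsProbabilityMeasure ((stdGaussian E).map (fun z => ⟪e, dir z⟫)) :=
    Measure.isProbabilityMeasure_map hm.aemeasurable
  refine ext_of_integral_pow ?_ ?_ fun m => ?_
  · refine (ae_map_iff (p := fun x => x ∈ Set.Icc (-1 : ℝ) 1) hm.aemeasurable
      measurableSet_Icc).2 ?_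
    exact ae_of_all _ fun z => abs_le.1 (abs_inner_dir_le he z)
  · filter_upwards [ae_mem_Ioo_gegProb hB] with x hx using Set.Ioo_subset_Icc_self hx
  · rw [integral_map hm.aemeasurable (by fun_prop)]
    have hnB : (B : ℝ) = Module.finrank ℝ E + 1 := by rw [← hn]; push_cast; rfl
    have hpos : (0 : ℝ) < Module.finrank ℝ E := by exact_mod_cast hfin
    have S : ∀ i : ℕ, (∫ z : E, ‖z‖ ^ i ∂(stdGaussian E)) *
        ∫ z, ⟪e, dir z⟫ ^ i ∂(stdGaussian E) = gaussMoment i := norm_pow_mul_dirMoment_left he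
    -- Both laws satisfy one two-step recursion for moments: here it comes from the Gaussian
    -- moments, in `recG` from integration by parts. They agree at `0` and `1`, and moments
    -- determine a law on `[-1, 1]`.
    have recS : ∀ i : ℕ, ((Module.finrank ℝ E : ℝ) + i) *
        ∫ z, ⟪e, dir z⟫ ^ (i + 2) ∂(stdGaussian E) =
          (i + 1) * ∫ z, ⟪e, dir z⟫ ^ i ∂(stdGaussian E) := fun i => by
      have h1 := S (i + 2)
      rw [integral_norm_pow_add_two, gaussMoment_add_two, ← S i] at h1
      apply mul_left_cancel₀ (integral_norm_pow_pos (E := E) i).ne'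
      linear_combination h1
    have G := isGegenbauerFunctional_gegFun hB
    have recG : ∀ i : ℕ, ((Module.finrank ℝ E : ℝ) + i) * ∫ x, x ^ (i + 2) ∂(gegProb B) =
        (i + 1) * ∫ x, x ^ i ∂(gegProb B) := fun i => by
      have h1 := G.map_eq_zero (Polynomial.X ^ (i + 1))
      have h2 : ((1 - Polynomial.X ^ 2) * Polynomial.derivative (Polynomial.X ^ (i + 1)) -
          Polynomial.C (2 * (((B : ℝ) - 3) / 2) + 1) * Polynomial.X * Polynomial.X ^ (i + 1)) =
          Polynomial.C ((i : ℝ) + 1) * (Polynomial.X ^ i : ℝ[X]) -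
            Polynomial.C ((Module.finrank ℝ E : ℝ) + i) * Polynomial.X ^ (i + 2) := by
        rw [hnB, Polynomial.derivative_X_pow,
          show 2 * (((Module.finrank ℝ E : ℝ) + 1 - 3) / 2) + 1 = Module.finrank ℝ E - 1 by ring]
        simp only [Nat.add_sub_cancel, map_add, map_sub, Polynomial.C_1, map_natCast]
        push_cast
        ring
      rw [h2, map_sub, IsGegenbauerFunctional.map_C_mul, IsGegenbauerFunctional.map_C_mul,
        gegFun_apply, gegFun_apply] at h1
      simp only [Polynomial.eval_pow, Polynomial.eval_X] at h1
      linarith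
    induction m using Nat.strong_induction_on with
    | _ m ih =>
      match m with
      | 0 => simp
      | 1 =>
        have h1 := S 1
        rw [show (1 : ℕ) = 2 * 0 + 1 by norm_num, gaussMoment_odd] at h1
        have h2 := (mul_eq_zero.1 h1).resolve_left (integral_norm_pow_pos _).ne'
        have h3 := G.map_eq_zero 1
        simp only [Polynomial.derivative_one, mul_zero, mul_one, zero_sub, map_neg,
          neg_eq_zero] at h3
        rw [IsGegenbauerFunctional.map_C_mul, gegFun_apply] at h3
        have hne : 2 * (((B : ℝ) - 3) / 2) + 1 ≠ 0 := by
          have : (4 : ℝ) ≤ B := by exact_mod_cast hB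
          linarith
        have h4 := (mul_eq_zero.1 h3).resolve_left hne
        simp only [Polynomial.eval_X] at h4
        simp only [mul_zero, zero_add] at h2
        rw [h2]
        simpa using h4.symm
      | m + 2 =>
        have hp : ((Module.finrank ℝ E : ℝ) + m) ≠ 0 := by positivity
        apply mul_left_cancel₀ hp
        rw [recS, recG, ih m (by omega)]

lemma memLp_comp_inner_dir {B : ℕ} (hB : 4 ≤ B) (hn : Module.finrank ℝ E + 1 = B) (he : ‖e‖ = 1)
    {f : ℝ → ℝ} (hf : MemLp f 2 (gegProb B)) :
    MemLp (fun z => f ⟪e, dir z⟫) 2 (stdGaussian E) := by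
  rw [← map_inner_dir hB hn he] at hf
  exact hf.comp_of_map (measurable_inner_dir e).aemeasurable

lemma integral_comp_inner_dir {B : ℕ} (hB : 4 ≤ B) (hn : Module.finrank ℝ E + 1 = B)
    (he : ‖e‖ = 1) {f : ℝ → ℝ} (hf : AEStronglyMeasurable f (gegProb B)) :
    ∫ z, f ⟪e, dir z⟫ ∂(stdGaussian E) = ∫ x, f x ∂(gegProb B) := by
  rw [← map_inner_dir hB hn he] at hf ⊢
  rw [integral_map (measurable_inner_dir e).aemeasurable hf]

lemma dirMoment_add_two_left [Nontrivial E] (he : ‖e‖ = 1) (hw : ‖w‖ = 1) (hew : ⟪e, w⟫ = 0)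
    (i j : ℕ) : ((Module.finrank ℝ E : ℝ) + (i + j)) * dirMoment e w (i + 2) j =
      (i + 1) * dirMoment e w i j := by
  have h1 := norm_pow_mul_dirMoment he hw hew (i + 2) j
  rw [show i + 2 + j = (i + j) + 2 by ring, integral_norm_pow_add_two, gaussMoment_add_two,
    mul_assoc ((i : ℝ) + 1), ← norm_pow_mul_dirMoment he hw hew i j] at h1
  apply mul_left_cancel₀ (integral_norm_pow_pos (E := E) (i + j)).ne'
  push_cast at h1
  linear_combination h1

lemma dirMoment_add_two_right [Nontrivial E] (he : ‖e‖ = 1) (hw : ‖w‖ = 1) (hew : ⟪e, w⟫ = 0)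
    (i j : ℕ) : ((Module.finrank ℝ E : ℝ) + (i + j)) * dirMoment e w i (j + 2) =
      (j + 1) * dirMoment e w i j := by
  have h1 := norm_pow_mul_dirMoment he hw hew i (j + 2)
  rw [show i + (j + 2) = (i + j) + 2 by ring, integral_norm_pow_add_two, gaussMoment_add_two,
    mul_left_comm (gaussMoment i), ← norm_pow_mul_dirMoment he hw hew i j] at h1
  apply mul_left_cancel₀ (integral_norm_pow_pos (E := E) (i + j)).ne'
  push_cast at h1
  linear_combination h1

lemma dirMoment_odd_right [Nontrivial E] (he : ‖e‖ = 1) (hw : ‖w‖ = 1) (hew : ⟪e, w⟫ = 0)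
    (i j : ℕ) : dirMoment e w i (2 * j + 1) = 0 := by
  have h1 := norm_pow_mul_dirMoment he hw hew i (2 * j + 1)
  rw [gaussMoment_odd, mul_zero] at h1
  exact (mul_eq_zero.1 h1).resolve_left (integral_norm_pow_pos _).ne'

end Sphere

/-! ### Two correlated coordinates of the direction -/

section TwoPoint

open scoped RealInnerProductSpace

set_option linter.unusedSectionVars false

variable {E : Type*} [NormedAddCommGroup E] [InnerProductSpace ℝ E] [FiniteDimensional ℝ E]
  [MeasurableSpace E] [BorelSpace E]

lemma integrable_eval_inner_dir {e : E} (he : ‖e‖ = 1) (p : ℝ[X]) :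
    Integrable (fun z => p.eval ⟪e, dir z⟫) (stdGaussian E) := by
  obtain ⟨K, hK⟩ := isCompact_Icc.exists_bound_of_continuousOn (s := Set.Icc (-1 : ℝ) 1)
    (f := fun x => p.eval x) p.continuous.continuousOn
  exact Integrable.mono' (integrable_const K)
    (p.continuous.measurable.comp (measurable_inner_dir e)).aestronglyMeasurable
    (ae_of_all _ fun z => hK _ (abs_le.1 (abs_inner_dir_le he z)))

lemma integrable_eval_mul_eval {e e' : E} (he : ‖e‖ = 1) (he' : ‖e'‖ = 1) (p q : ℝ[X]) :
    Integrable (fun z => p.eval ⟪e, dir z⟫ * q.eval ⟪e', dir z⟫) (stdGaussian E) := by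
  obtain ⟨K, hK⟩ := isCompact_Icc.exists_bound_of_continuousOn (s := Set.Icc (-1 : ℝ) 1)
    (f := fun x => p.eval x) p.continuous.continuousOn
  exact (integrable_eval_inner_dir he' q).bdd_mul (c := K)
    (p.continuous.measurable.comp (measurable_inner_dir e)).aestronglyMeasurable
    (ae_of_all _ fun z => hK _ (abs_le.1 (abs_inner_dir_le he z)))

lemma integrable_pow_mul_pow {e e' : E} (he : ‖e‖ = 1) (he' : ‖e'‖ = 1) (i j : ℕ) :
    Integrable (fun z => ⟪e, dir z⟫ ^ i * ⟪e', dir z⟫ ^ j) (stdGaussian E) := by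
  simpa using integrable_eval_mul_eval he he' (Polynomial.X ^ i) (Polynomial.X ^ j)

lemma integral_stdGaussian_comp (R : E ≃ₗᵢ[ℝ] E) (f : E → ℝ) :
    ∫ z, f (R z) ∂(stdGaussian E) = ∫ z, f z ∂(stdGaussian E) := by
  conv_rhs => rw [← stdGaussian_map R]
  exact (R.toHomeomorph.measurableEmbedding.integral_map f).symm

/-- Exchangeability of two unit vectors under the standard Gaussian. -/
lemma integral_swap_dir {e e' : E} (he : ‖e‖ = 1) (he' : ‖e'‖ = 1) (f : ℝ → ℝ → ℝ) :
    ∫ z, f ⟪e, dir z⟫ ⟪e', dir z⟫ ∂(stdGaussian E) =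
      ∫ z, f ⟪e', dir z⟫ ⟪e, dir z⟫ ∂(stdGaussian E) := by
  -- The reflection that exchanges the unit vectors `e` and `e'`.
  set R := Submodule.reflection (ℝ ∙ (e - e'))ᗮ with hR
  have h1 : R e = e' := Submodule.reflection_sub (by rw [he, he'])
  have h2 : R e' = e := by rw [← h1, hR, Submodule.reflection_reflection]
  have hd : ∀ z, dir (R z) = R (dir z) := fun z => by
    rw [dir, dir, LinearIsometryEquiv.norm_map, map_smul]
  have hRR : ∀ x, R (R x) = x := fun x => by rw [hR, Submodule.reflection_reflection]
  have h3 : ∀ z, f ⟪e, dir (R z)⟫ ⟪e', dir (R z)⟫ = f ⟪e', dir z⟫ ⟪e, dir z⟫ := fun z => by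
    rw [hd, ← R.inner_map_map e', h2, ← R.inner_map_map e, h1, hRR]
  simp_rw [← h3]
  exact (integral_stdGaussian_comp R (fun z => f ⟪e, dir z⟫ ⟪e', dir z⟫)).symm

/-- The ratio between `E[f(⟪e, u⟫) ⟪w, u⟫^{2j}]` and `E[f(⟪e, u⟫) (1 - ⟪e, u⟫²)^j]`. -/
def evenRatio (n j : ℕ) : ℝ := ∏ l ∈ Finset.range j, (2 * (l : ℝ) + 1) / (2 * l + n - 1)

variable {B : ℕ} {e w : E}

/-- Given `⟪e, u⟫ = x`, the coordinate `⟪w, u⟫` is `√(1 - x²)` times a coordinate of a uniform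
direction in one dimension less, with `2j`-th moment `evenRatio n j`. No conditioning is needed:
combining the recursions that raise `i` and `j` by two reproduces this formula. -/
lemma dirMoment_even (hB : 4 ≤ B) (hn : Module.finrank ℝ E + 1 = B)
    (he : ‖e‖ = 1) (hw : ‖w‖ = 1) (hew : ⟪e, w⟫ = 0) (i j : ℕ) :
    dirMoment e w i (2 * j) = evenRatio (Module.finrank ℝ E) j *
      gegFun hB (Polynomial.X ^ i * (1 - Polynomial.X ^ 2) ^ j) := by
  have hfin : 3 ≤ Module.finrank ℝ E := by omega
  have hfin' : (3 : ℝ) ≤ Module.finrank ℝ E := by exact_mod_cast hfin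
  have : Nontrivial E := Module.nontrivial_of_finrank_pos (R := ℝ) (by omega)
  induction j generalizing i with
  | zero =>
    simp only [dirMoment, evenRatio, mul_zero, pow_zero, mul_one, Finset.range_zero,
      Finset.prod_empty, one_mul, gegFun_apply, Polynomial.eval_pow, Polynomial.eval_X]
    exact integral_comp_inner_dir hB hn he (f := fun x => x ^ i) (by fun_prop)
  | succ j ih =>
    have h1 := dirMoment_add_two_left he hw hew i (2 * j)
    have h2 := dirMoment_add_two_right he hw hew i (2 * j)
    push_cast at h1 h2
    have hp : (0 : ℝ) < Module.finrank ℝ E + (i + 2 * j) := by positivity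
    have hq : (0 : ℝ) < 2 * j + Module.finrank ℝ E - 1 := by
      have : (0 : ℝ) ≤ j := by positivity
      linarith
    have h3 : (2 * (j : ℝ) + Module.finrank ℝ E - 1) * dirMoment e w i (2 * (j + 1)) =
        (2 * j + 1) * (dirMoment e w i (2 * j) - dirMoment e w (i + 2) (2 * j)) := by
      apply mul_left_cancel₀ hp.ne'
      rw [show 2 * (j + 1) = 2 * j + 2 by ring]
      linear_combination (2 * (j : ℝ) + Module.finrank ℝ E - 1) * h2 + (2 * (j : ℝ) + 1) * h1
    have h4 : (Polynomial.X ^ i * (1 - Polynomial.X ^ 2) ^ (j + 1) : ℝ[X]) =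
        Polynomial.X ^ i * (1 - Polynomial.X ^ 2) ^ j -
          Polynomial.X ^ (i + 2) * (1 - Polynomial.X ^ 2) ^ j := by ring
    rw [ih, ih, ← mul_sub, ← map_sub, ← h4] at h3
    rw [evenRatio, Finset.prod_range_succ, ← evenRatio]
    apply mul_left_cancel₀ hq.ne'
    rw [h3]
    field_simp

/-- The polynomial `T(X^m)` with `E[⟪e', u⟫^m | ⟪e, u⟫ = x] = T(X^m)(x)`, where `⟪e, e'⟫ = ρ`. -/
def condMonomial (n : ℕ) (ρ : ℝ) (m : ℕ) : ℝ[X] :=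
  ∑ a ∈ Finset.range (m + 1),
    Polynomial.C (if Even a then (m.choose a : ℝ) * ρ ^ (m - a) * √(1 - ρ ^ 2) ^ a *
      evenRatio n (a / 2) else 0) *
      (Polynomial.X ^ (m - a) * (1 - Polynomial.X ^ 2) ^ (a / 2))

/-- The conditional expectation of `p(⟪e', u⟫)` as a polynomial in `⟪e, u⟫`. -/
def condPoly (n : ℕ) (ρ : ℝ) (p : ℝ[X]) : ℝ[X] :=
  ∑ m ∈ Finset.range (p.natDegree + 1), Polynomial.C (p.coeff m) * condMonomial n ρ m

lemma degree_condMonomial_le (n : ℕ) (ρ : ℝ) (m : ℕ) : (condMonomial n ρ m).degree ≤ m := by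
  rw [condMonomial]
  refine (Polynomial.degree_sum_le _ _).trans (Finset.sup_le fun a ha => ?_)
  refine (degree_const_mul_le _ _).trans (Polynomial.degree_le_of_natDegree_le ?_)
  have h1 : (1 - Polynomial.X ^ 2 : ℝ[X]).natDegree ≤ 2 := by
    refine (Polynomial.natDegree_sub_le _ _).trans ?_
    simp
  refine Polynomial.natDegree_mul_le.trans ?_
  have h2 := Polynomial.natDegree_pow_le_of_le (a / 2) h1
  rw [Polynomial.natDegree_X_pow]
  have := Finset.mem_range.1 ha
  omega

lemma degree_condPoly_le (n : ℕ) (ρ : ℝ) (p : ℝ[X]) : (condPoly n ρ p).degree ≤ p.degree := by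
  by_cases hp : p = 0
  · simp [condPoly, hp]
  rw [Polynomial.degree_eq_natDegree hp, condPoly]
  refine (Polynomial.degree_sum_le _ _).trans (Finset.sup_le fun m hm => ?_)
  refine (degree_const_mul_le _ _).trans ((degree_condMonomial_le n ρ m).trans ?_)
  exact_mod_cast Nat.lt_succ_iff.1 (Finset.mem_range.1 hm)

/-- At `1` all terms with a positive power of `1 - X²` vanish, which leaves `ρ ^ m` for each
monomial. -/
lemma eval_one_condPoly (n : ℕ) (ρ : ℝ) (p : ℝ[X]) :
    (condPoly n ρ p).eval 1 = p.eval ρ := by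
  have h : ∀ m, (condMonomial n ρ m).eval 1 = ρ ^ m := fun m => by
    rw [condMonomial, Polynomial.eval_finsetSum, Finset.sum_eq_single 0]
    · simp [evenRatio]
    · intro a _ ha
      by_cases h2 : Even a
      · have : a / 2 ≠ 0 := by
          obtain ⟨b, rfl⟩ := h2
          omega
        simp [this]
      · simp [h2]
    · simp
  rw [condPoly, Polynomial.eval_finsetSum, Polynomial.eval_eq_sum_range]
  refine Finset.sum_congr rfl fun m _ => ?_
  rw [Polynomial.eval_mul, h, Polynomial.eval_C]

/-- Expand the power of `e' = ρ e + σ w` with `w ⊥ e`. Odd powers of `⟪w, u⟫` have mean zero, and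
even ones turn into powers of `1 - ⟪e, u⟫²`. -/
lemma integral_pow_mul_pow (hB : 4 ≤ B) (hn : Module.finrank ℝ E + 1 = B) {e e' : E} {ρ : ℝ}
    (he : ‖e‖ = 1) (he' : ‖e'‖ = 1) (hρ : ⟪e, e'⟫ = ρ) (hρ1 : ρ ^ 2 < 1) (m i : ℕ) :
    ∫ z, ⟪e', dir z⟫ ^ m * ⟪e, dir z⟫ ^ i ∂(stdGaussian E) =
      gegFun hB (condMonomial (Module.finrank ℝ E) ρ m * Polynomial.X ^ i) := by
  have : Nontrivial E := Module.nontrivial_of_finrank_pos (R := ℝ) (by omega)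
  set σ := √(1 - ρ ^ 2) with hσ
  have hσ0 : 0 < σ := Real.sqrt_pos.2 (by linarith)
  have hσ2 : σ ^ 2 = 1 - ρ ^ 2 := Real.sq_sqrt (by linarith)
  -- The normalized part of `e'` orthogonal to `e`; it exists because `ρ² < 1`.
  set w := σ⁻¹ • (e' - ρ • e) with hw
  have hee : ⟪e, e⟫ = (1 : ℝ) := by rw [real_inner_self_eq_norm_sq, he]; norm_num
  have hee' : ⟪e', e'⟫ = (1 : ℝ) := by rw [real_inner_self_eq_norm_sq, he']; norm_num
  have hew : ⟪e, w⟫ = 0 := by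
    rw [hw, real_inner_smul_right, inner_sub_right, real_inner_smul_right, hee, hρ]
    ring
  have hw1 : ‖w‖ = 1 := by
    rw [← sq_eq_sq₀ (norm_nonneg _) zero_le_one, ← real_inner_self_eq_norm_sq, hw,
      real_inner_smul_left, real_inner_smul_right, inner_sub_left, inner_sub_right,
      inner_sub_right, real_inner_smul_left, real_inner_smul_right, real_inner_smul_left,
      real_inner_smul_right, hee, hee', real_inner_comm, hρ]
    have : σ⁻¹ * (σ⁻¹ * (1 - ρ * ρ - (ρ * ρ - ρ * (ρ * 1)))) = σ⁻¹ * σ⁻¹ * σ ^ 2 := by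
      rw [hσ2]; ring
    rw [this]
    field_simp
  have he'w : ∀ z, ⟪e', dir z⟫ = σ * ⟪w, dir z⟫ + ρ * ⟪e, dir z⟫ := fun z => by
    rw [hw, real_inner_smul_left, inner_sub_left, real_inner_smul_left]
    field_simp
    ring
  have hexp : ∀ z, ⟪e', dir z⟫ ^ m * ⟪e, dir z⟫ ^ i = ∑ a ∈ Finset.range (m + 1),
      ((m.choose a : ℝ) * ρ ^ (m - a) * σ ^ a) *
        (⟪e, dir z⟫ ^ (m - a + i) * ⟪w, dir z⟫ ^ a) := fun z => by
    rw [he'w, add_pow, Finset.sum_mul]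
    refine Finset.sum_congr rfl fun a _ => ?_
    rw [mul_pow, mul_pow, pow_add]
    ring
  simp_rw [hexp]
  rw [integral_finsetSum _ fun a _ => (integrable_pow_mul_pow he hw1 _ _).const_mul _,
    condMonomial, Finset.sum_mul, map_sum]
  refine Finset.sum_congr rfl fun a _ => ?_
  rw [integral_const_mul, mul_assoc (Polynomial.C _), IsGegenbauerFunctional.map_C_mul]
  change _ * dirMoment e w (m - a + i) a = _
  obtain ⟨b, rfl | rfl⟩ := a.even_or_odd'
  · rw [if_pos ⟨b, by ring⟩, dirMoment_even hB hn he hw1 hew, Nat.mul_div_cancel_left _ two_pos,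
      pow_add, mul_assoc _ (evenRatio _ _)]
    congr 3
    ring
  · rw [dirMoment_odd_right he hw1 hew, if_neg (by simp), mul_zero, zero_mul]

lemma integral_eval_mul_eval (hB : 4 ≤ B) (hn : Module.finrank ℝ E + 1 = B) {e e' : E} {ρ : ℝ}
    (he : ‖e‖ = 1) (he' : ‖e'‖ = 1) (hρ : ⟪e, e'⟫ = ρ) (hρ1 : ρ ^ 2 < 1) (p f : ℝ[X]) :
    ∫ z, p.eval ⟪e', dir z⟫ * f.eval ⟪e, dir z⟫ ∂(stdGaussian E) =
      gegFun hB (condPoly (Module.finrank ℝ E) ρ p * f) := by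
  have h1 : ∀ z, p.eval ⟪e', dir z⟫ * f.eval ⟪e, dir z⟫ =
      ∑ m ∈ Finset.range (p.natDegree + 1), ∑ i ∈ Finset.range (f.natDegree + 1),
        (p.coeff m * f.coeff i) * (⟪e', dir z⟫ ^ m * ⟪e, dir z⟫ ^ i) := fun z => by
    rw [Polynomial.eval_eq_sum_range, Polynomial.eval_eq_sum_range, Finset.sum_mul_sum]
    refine Finset.sum_congr rfl fun m _ => Finset.sum_congr rfl fun i _ => ?_
    ring
  simp_rw [h1]
  rw [integral_finsetSum _ fun m _ => integrable_finsetSum _ fun i _ =>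
    (integrable_pow_mul_pow he' he _ _).const_mul _]
  conv_rhs => rw [f.as_sum_range_C_mul_X_pow, condPoly, Finset.sum_mul, map_sum]
  refine Finset.sum_congr rfl fun m _ => ?_
  rw [integral_finsetSum _ fun i _ => (integrable_pow_mul_pow he' he _ _).const_mul _,
    Finset.mul_sum, map_sum]
  refine Finset.sum_congr rfl fun i _ => ?_
  rw [integral_const_mul, integral_pow_mul_pow hB hn he he' hρ hρ1,
    ← IsGegenbauerFunctional.map_C_mul, Polynomial.C_mul]
  congr 1
  ring

/-- Correlations of Gegenbauer polynomials of two coordinates of the direction. -/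
lemma integral_geg_mul_geg (hB : 4 ≤ B) (hn : Module.finrank ℝ E + 1 = B) {e e' : E} {ρ : ℝ}
    (he : ‖e‖ = 1) (he' : ‖e'‖ = 1) (hρ : ⟪e, e'⟫ = ρ) (hρ1 : ρ ^ 2 < 1) (l m : ℕ) :
    ∫ z, geg B l ⟪e, dir z⟫ * geg B m ⟪e', dir z⟫ ∂(stdGaussian E) =
      if l = m then gegC B m * geg B m ρ else 0 := by
  have hB' : (4 : ℝ) ≤ B := by exact_mod_cast hB
  have hα : (0 : ℝ) < ((B : ℝ) - 3) / 2 := by linarith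
  have h := (isGegenbauerFunctional_gegFun hB).twoPoint hα (gegFun_mul_self_eq_zero hB)
    (β := fun p q => ∫ z, p.eval ⟪e', dir z⟫ * q.eval ⟪e, dir z⟫ ∂(stdGaussian E))
    (T := condPoly (Module.finrank ℝ E) ρ) (ρ := ρ)
    (fun p q => by
      rw [integral_swap_dir he' he (fun x y => p.eval x * q.eval y)]
      simp_rw [mul_comm])
    (integral_eval_mul_eval hB hn he he' hρ hρ1) (degree_condPoly_le _ _) (eval_one_condPoly _ _)
    m l
  simp_rw [geg, mul_comm (Polynomial.eval (⟪e, dir _⟫) _)]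
  rw [h]
  by_cases hlm : l = m
  · subst hlm
    simp only [if_true, gegC]
    congr 1
    have hl : (0 : ℝ) ≤ l := by positivity
    have h1 : (B : ℝ) - 3 + 2 * l ≠ 0 := by linarith
    have h2 : (l : ℝ) + ((B : ℝ) - 3) / 2 ≠ 0 := by linarith
    rw [div_eq_div_iff h2 h1]
    ring
  · rw [if_neg (Ne.symm hlm), if_neg hlm]

end TwoPoint

/-! ### The rate of the identity -/

section IdRate

/-- `(2 / n) (Γ((n + 1) / 2) / Γ(n / 2))²`, the squared mean norm of a standard Gaussian vector
in dimension `n`, divided by `n`. -/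
def chiRatio (n : ℕ) : ℝ :=
  2 / n * (Real.Gamma (((n : ℝ) + 1) / 2) / Real.Gamma ((n : ℝ) / 2)) ^ 2

lemma chiRatio_pos {n : ℕ} (hn : 0 < n) : 0 < chiRatio n := by
  have hn' : (0 : ℝ) < n := by exact_mod_cast hn
  have h1 : 0 < Real.Gamma (((n : ℝ) + 1) / 2) := Real.Gamma_pos_of_pos (by positivity)
  have h2 : 0 < Real.Gamma ((n : ℝ) / 2) := Real.Gamma_pos_of_pos (by positivity)
  rw [chiRatio]
  positivity

/-- The Gamma quotients telescope through `Γ(n/2 + 1) = (n/2) Γ(n/2)`. -/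
lemma chiRatio_mul_succ {n : ℕ} (hn : 0 < n) :
    chiRatio n * chiRatio (n + 1) = n / (n + 1) := by
  have hn' : (0 : ℝ) < n := by exact_mod_cast hn
  have h1 : Real.Gamma (((n : ℝ) + 1) / 2) ≠ 0 := (Real.Gamma_pos_of_pos (by positivity)).ne'
  have h2 : Real.Gamma ((n : ℝ) / 2) ≠ 0 := (Real.Gamma_pos_of_pos (by positivity)).ne'
  rw [chiRatio, chiRatio]
  push_cast
  rw [show ((n : ℝ) + 1 + 1) / 2 = n / 2 + 1 by ring, Real.Gamma_add_one (by positivity)]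
  field_simp

lemma idRate_eq_chiRatio {B : ℕ} (hB : 2 ≤ B) : idRate B = chiRatio (B - 1) := by
  have hB' : (2 : ℝ) ≤ B := by exact_mod_cast hB
  have hpos : (0 : ℝ) < (B - 1) / 2 := by linarith
  have h1 : Real.Gamma ((B : ℝ) / 2) ≠ 0 := (Real.Gamma_pos_of_pos (by positivity)).ne'
  have h2 : Real.Gamma (((B : ℝ) - 1) / 2) ≠ 0 := (Real.Gamma_pos_of_pos hpos).ne'
  rw [idRate, chiRatio, poch, Nat.cast_sub (by omega), Nat.cast_one,
    show (B : ℝ) / 2 + 1 / 2 = (B - 1) / 2 + 1 by ring, Real.Gamma_add_one hpos.ne',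
    sub_add_cancel, zpow_neg]
  have h3 : (B : ℝ) - 1 ≠ 0 := by linarith
  rw [show ((2 : ℤ)) = ((2 : ℕ) : ℤ) by rfl, zpow_natCast]
  field_simp

/-- Log-convexity of `Γ` at `(n + 1) / 2`, the midpoint of `n / 2` and `n / 2 + 1`. -/
lemma chiRatio_le_one {n : ℕ} (hn : 0 < n) : chiRatio n ≤ 1 := by
  have hn' : (0 : ℝ) < n := by exact_mod_cast hn
  have h1 : 0 < Real.Gamma (((n : ℝ) + 1) / 2) := Real.Gamma_pos_of_pos (by positivity)
  have h2 : 0 < Real.Gamma ((n : ℝ) / 2) := Real.Gamma_pos_of_pos (by positivity)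
  have h := Real.Gamma_mul_add_mul_le_rpow_Gamma_mul_rpow_Gamma (s := (n : ℝ) / 2)
    (t := (n : ℝ) / 2 + 1) (a := 1 / 2) (b := 1 / 2) (by positivity) (by positivity)
    (by norm_num) (by norm_num) (by norm_num)
  rw [show 1 / 2 * ((n : ℝ) / 2) + 1 / 2 * ((n : ℝ) / 2 + 1) = ((n : ℝ) + 1) / 2 by ring,
    Real.Gamma_add_one (by positivity), ← Real.sqrt_eq_rpow, ← Real.sqrt_eq_rpow,
    ← Real.sqrt_mul h2.le] at h
  have h3 := pow_le_pow_left₀ h1.le h 2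
  rw [Real.sq_sqrt (by positivity)] at h3
  rw [chiRatio, div_pow, ← mul_div_assoc, div_le_one (by positivity), div_mul_eq_mul_div,
    div_le_iff₀ hn']
  nlinarith

lemma chiRatio_add_two {n : ℕ} (hn : 0 < n) :
    chiRatio (n + 2) * (n * (n + 2)) = chiRatio n * (n + 1) ^ 2 := by
  have hn' : (0 : ℝ) < n := by exact_mod_cast hn
  have h1 := chiRatio_mul_succ hn
  have h2 := chiRatio_mul_succ (Nat.succ_pos n)
  have h3 := chiRatio_pos (Nat.succ_pos n)
  push_cast at h2
  apply mul_left_cancel₀ h3.ne'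
  have h4 : chiRatio n.succ * (chiRatio n * ((n : ℝ) + 1) ^ 2) =
      (chiRatio n * chiRatio (n + 1)) * ((n : ℝ) + 1) ^ 2 := by
    rw [Nat.succ_eq_add_one]; ring
  have h5 : chiRatio n.succ * (chiRatio (n + 2) * (n * (n + 2))) =
      (chiRatio n.succ * chiRatio (n.succ + 1)) * (n * (n + 2)) := by
    rw [Nat.succ_eq_add_one, show n + 1 + 1 = n + 2 by rfl]; ring
  rw [h4, h5, h1, h2]
  field_simp
  ring

/-- Two steps multiply `chiRatio` by `(n + 1)² / (n (n + 2)) > 1`, so the value `1` at `n` would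
push `chiRatio (n + 2)` above `1`. -/
lemma chiRatio_lt_one {n : ℕ} (hn : 0 < n) : chiRatio n < 1 := by
  have hn' : (0 : ℝ) < n := by exact_mod_cast hn
  have h1 := chiRatio_add_two hn
  have h2 := chiRatio_le_one (n := n + 2) (by omega)
  have h3 := chiRatio_pos hn
  by_contra h
  have h4 : chiRatio (n + 2) * (n * (n + 2)) ≤ 1 * (n * (n + 2)) := by gcongr
  have h5 : 1 * ((n : ℝ) + 1) ^ 2 ≤ chiRatio n * (n + 1) ^ 2 := by
    have := not_lt.1 h
    gcongr
  nlinarith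

/-- The product relation turns the upper bound for `chiRatio (n + 1)` into a lower bound for
`chiRatio n`; both together squeeze the limit. -/
lemma div_lt_chiRatio {n : ℕ} (hn : 0 < n) : (n : ℝ) / (n + 1) < chiRatio n := by
  have h1 := chiRatio_mul_succ hn
  have h2 := chiRatio_lt_one (Nat.succ_pos n)
  have h3 := chiRatio_pos hn
  rw [← h1]
  nlinarith

lemma tendsto_chiRatio : Tendsto chiRatio atTop (𝓝 1) := by
  refine tendsto_of_tendsto_of_tendsto_of_le_of_le'
    (tendsto_natCast_div_add_atTop (1 : ℝ))
    tendsto_const_nhds ?_ ?_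
  · filter_upwards [eventually_gt_atTop 0] with n hn using (div_lt_chiRatio hn).le
  · filter_upwards [eventually_gt_atTop 0] with n hn using (chiRatio_lt_one hn).le

/-- The two-step formula reduces the claim to `k (k + 2)³ < (k + 1)³ (k + 3)`, whose sides differ by
`2k + 3`. -/
lemma chiRatio_ratio_lt {k : ℕ} (hk0 : 0 < k) :
    chiRatio (k + 3) / chiRatio (k + 2) < chiRatio (k + 1) / chiRatio k := by
  have hk' : (0 : ℝ) < k := by exact_mod_cast hk0
  have e1 := chiRatio_add_two hk0
  have e2 := chiRatio_add_two (n := k + 1) (by omega)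
  have p0 := chiRatio_pos hk0
  have p1 := chiRatio_pos (n := k + 1) (by omega)
  have p2 := chiRatio_pos (n := k + 2) (by omega)
  rw [show k + 1 + 2 = k + 3 by ring] at e2
  push_cast at e2
  generalize chiRatio (k + 3) = c3 at *
  generalize chiRatio (k + 2) = c2 at *
  generalize chiRatio (k + 1) = c1 at *
  generalize chiRatio k = c0 at *
  have h1 : c2 = c0 * (k + 1) ^ 2 / (k * (k + 2)) := by
    rw [eq_div_iff (by positivity), e1]
  have h2 : c3 = c1 * (k + 2) ^ 2 / ((k + 1) * (k + 3)) := by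
    rw [eq_div_iff (by positivity)]
    linear_combination e2
  rw [div_lt_div_iff₀ p2 p0, h1, h2, div_mul_eq_mul_div, ← mul_div_assoc,
    div_lt_div_iff₀ (by positivity) (by positivity)]
  have h5 : ((k : ℝ) + 2) ^ 2 * (k * (k + 2)) < (k + 1) ^ 2 * ((k + 1) * (k + 3)) := by
    nlinarith [hk']
  have h6 : 0 < c1 * c0 := by positivity
  have h7 := mul_lt_mul_of_pos_left h5 h6
  linarith

/-- A positive sequence with limit `1` whose consecutive ratios decrease along every second index
is strictly increasing. -/
lemma lt_succ_of_ratio_lt {f : ℕ → ℝ} (hlim : Tendsto f atTop (𝓝 1)) {n : ℕ} (hn : 0 < n)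
    (hpos : 0 < f n)
    (h : ∀ k, 0 < k → f (k + 3) / f (k + 2) < f (k + 1) / f k) : f n < f (n + 1) := by
  have h1 : Tendsto (fun m : ℕ => n + 2 * m) atTop atTop :=
    tendsto_atTop_mono (fun m => by simp only [id]; omega) tendsto_id
  have h2 : Tendsto (fun m : ℕ => n + 2 * m + 1) atTop atTop :=
    tendsto_atTop_mono (fun m => by simp only [id]; omega) tendsto_id
  have h3 := (hlim.comp h2).div (hlim.comp h1) one_ne_zero
  rw [div_one] at h3
  -- Strictly decreasing with limit `1`, so every term exceeds `1`, in particular the one at `m =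
  -- 0`.
  have hanti : StrictAnti fun m : ℕ => f (n + 2 * m + 1) / f (n + 2 * m) :=
    strictAnti_nat_of_succ_lt fun m => h (n + 2 * m) (by omega)
  have h4 := hanti.antitone.le_of_tendsto h3 1
  have h5 := hanti one_pos
  have h6 := h4.trans_lt h5
  simp only [mul_zero, add_zero] at h6
  rwa [one_lt_div hpos] at h6

lemma chiRatio_lt_succ {n : ℕ} (hn : 0 < n) : chiRatio n < chiRatio (n + 1) :=
  lt_succ_of_ratio_lt tendsto_chiRatio hn (chiRatio_pos hn) fun _ hk => chiRatio_ratio_lt hk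

lemma strictMonoOn_idRate : StrictMonoOn idRate (Set.Ici 4) := by
  have h : StrictMono fun m : ℕ => chiRatio (m + 1) :=
    strictMono_nat_of_lt_succ fun m => chiRatio_lt_succ (Nat.succ_pos m)
  intro a ha b hb hab
  have ha : 4 ≤ a := ha
  have hb : 4 ≤ b := hb
  rw [idRate_eq_chiRatio (by omega), idRate_eq_chiRatio (by omega)]
  have := h (show a - 2 < b - 2 by omega)
  simpa only [show a - 2 + 1 = a - 1 by omega, show b - 2 + 1 = b - 1 by omega] using this

lemma idRate_lt_one {B : ℕ} (hB : 4 ≤ B) : idRate B < 1 := by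
  rw [idRate_eq_chiRatio (by omega)]
  exact chiRatio_lt_one (by omega)

lemma tendsto_idRate : Tendsto idRate atTop (𝓝 1) := by
  refine (tendsto_chiRatio.comp (tendsto_sub_atTop_nat 1)).congr' ?_
  filter_upwards [eventually_ge_atTop 2] with B hB
  exact (idRate_eq_chiRatio hB).symm

end IdRate

/-! ### First moments against a function of one coordinate of the direction -/

section FirstMoment

open scoped RealInnerProductSpace

set_option linter.unusedSectionVars false

variable {E : Type*} [NormedAddCommGroup E] [InnerProductSpace ℝ E] [FiniteDimensional ℝ E]
  [MeasurableSpace E] [BorelSpace E] {B : ℕ}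

/-- The reflection in the hyperplane orthogonal to `v` fixes `e` and changes the sign of the
integrand. -/
lemma integral_mul_inner_dir_of_inner_eq_zero {e v : E} (hev : ⟪e, v⟫ = 0) (f : ℝ → ℝ) :
    ∫ z, f ⟪e, dir z⟫ * ⟪v, dir z⟫ ∂(stdGaussian E) = 0 := by
  set R := Submodule.reflection (ℝ ∙ v)ᗮ with hR
  have h1 : R v = -v := Submodule.reflection_orthogonalComplement_singleton_eq_neg v
  have h2 : R e = e := by
    rw [hR, Submodule.reflection_eq_self_iff, Submodule.mem_orthogonal_singleton_iff_inner_left]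
    exact hev
  have hd : ∀ z, dir (R z) = R (dir z) := fun z => by
    rw [dir, dir, LinearIsometryEquiv.norm_map, map_smul]
  have h := integral_stdGaussian_comp R fun z => f ⟪e, dir z⟫ * ⟪v, dir z⟫
  have h3 : ∀ z, f ⟪e, dir (R z)⟫ * ⟪v, dir (R z)⟫ = -(f ⟪e, dir z⟫ * ⟪v, dir z⟫) := fun z => by
    have e1 : ⟪e, R (dir z)⟫ = ⟪e, dir z⟫ := by
      conv_lhs => rw [← h2, LinearIsometryEquiv.inner_map_map]
    have e2 : ⟪v, R (dir z)⟫ = -⟪v, dir z⟫ := by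
      have : v = R (-v) := by rw [map_neg, h1, neg_neg]
      conv_lhs => rw [this, LinearIsometryEquiv.inner_map_map, inner_neg_left]
    rw [hd, e1, e2, mul_neg]
  simp_rw [h3] at h
  rw [integral_neg] at h
  linarith

lemma integrable_mul_inner_dir {f : E → ℝ} (hf : Integrable f (stdGaussian E)) (v : E) :
    Integrable (fun z => f z * ⟪v, dir z⟫) (stdGaussian E) :=
  hf.mul_bdd (c := ‖v‖) (measurable_inner_dir v).aestronglyMeasurable
    (ae_of_all _ fun z => (norm_inner_le_norm _ _).trans (by
      have := norm_dir_le z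
      nlinarith [norm_nonneg v]))

lemma integrable_gegProb_of_memLp (hB : 4 ≤ B) {ψ : ℝ → ℝ} (hψ : MemLp ψ 2 (gegProb B)) :
    Integrable ψ (gegProb B) :=
  have := isProbabilityMeasure_gegProb hB
  hψ.integrable one_le_two

lemma integrable_comp_inner_dir (hB : 4 ≤ B) (hn : Module.finrank ℝ E + 1 = B) {e : E}
    (he : ‖e‖ = 1) {ψ : ℝ → ℝ} (hψ : Integrable ψ (gegProb B)) :
    Integrable (fun z => ψ ⟪e, dir z⟫) (stdGaussian E) := by
  rw [← map_inner_dir hB hn he] at hψ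
  exact hψ.comp_aemeasurable (measurable_inner_dir e).aemeasurable

/-- The first moment `E[x ψ(x)]` under the normalized Gegenbauer weight. -/
def firstMoment (B : ℕ) (ψ : ℝ → ℝ) : ℝ := ∫ x, x * ψ x ∂(gegProb B)

/-- Only the component of `v` along `e` contributes; the orthogonal one averages to zero by
reflection. -/
lemma integral_mul_inner_dir (hB : 4 ≤ B) (hn : Module.finrank ℝ E + 1 = B) {e : E}
    (he : ‖e‖ = 1) {ψ : ℝ → ℝ} (hψ : Integrable ψ (gegProb B)) (v : E) :
    ∫ z, ψ ⟪e, dir z⟫ * ⟪v, dir z⟫ ∂(stdGaussian E) = ⟪e, v⟫ * firstMoment B ψ := by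
  have hi := integrable_comp_inner_dir hB hn he hψ
  have h1 : ⟪e, v - ⟪e, v⟫ • e⟫ = 0 := by
    rw [inner_sub_right, real_inner_smul_right, real_inner_self_eq_norm_sq, he]; ring
  have h2 : ∀ z, ψ ⟪e, dir z⟫ * ⟪v, dir z⟫ =
      ⟪e, v⟫ * (ψ ⟪e, dir z⟫ * ⟪e, dir z⟫) +
        ψ ⟪e, dir z⟫ * ⟪v - ⟪e, v⟫ • e, dir z⟫ := fun z => by
    rw [inner_sub_left, real_inner_smul_left]; ring
  simp_rw [h2]
  rw [integral_add ((integrable_mul_inner_dir hi e).const_mul _) (integrable_mul_inner_dir hi _),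
    integral_const_mul, integral_mul_inner_dir_of_inner_eq_zero h1, add_zero, firstMoment]
  congr 1
  rw [← integral_comp_inner_dir hB hn he (f := fun x => x * ψ x)
    (aestronglyMeasurable_id.mul hψ.aestronglyMeasurable)]
  congr 1 with z
  ring

/-- The mean norm of a standard Gaussian vector. -/
def meanNorm (E : Type*) [NormedAddCommGroup E] [InnerProductSpace ℝ E] [FiniteDimensional ℝ E]
    [MeasurableSpace E] [BorelSpace E] : ℝ := ∫ z : E, ‖z‖ ∂(stdGaussian E)

lemma meanNorm_sq (hB : 4 ≤ B) (hn : Module.finrank ℝ E + 1 = B) :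
    meanNorm E ^ 2 = ((B : ℝ) - 1) * idRate B := by
  have : Nontrivial E := Module.nontrivial_of_finrank_pos (R := ℝ) (by omega)
  have hn' : (0 : ℝ) < Module.finrank ℝ E := by exact_mod_cast Module.finrank_pos
  have h := integral_norm_rpow (E := E) (s := 1) (by positivity)
  simp only [Real.rpow_one] at h
  have hB1 : B - 1 = Module.finrank ℝ E := by omega
  rw [meanNorm, h, idRate_eq_chiRatio (by omega), chiRatio, hB1, ← hn]
  push_cast
  rw [div_pow, mul_pow, ← Real.sqrt_eq_rpow, Real.sq_sqrt (by norm_num)]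
  field_simp
  ring

/-- The moment recursion at exponent `-1`. The factor `B - 2` is the one produced by integration by
parts, so the `‖z‖⁻¹` in the gradient of a direction becomes the mean norm of the forward
computation. -/
lemma meanNorm_eq_inv (hB : 4 ≤ B) (hn : Module.finrank ℝ E + 1 = B) :
    meanNorm E = ((B : ℝ) - 2) * ∫ z : E, ‖z‖⁻¹ ∂(stdGaussian E) := by
  have : Nontrivial E := Module.nontrivial_of_finrank_pos (R := ℝ) (by omega)
  have hn' : (3 : ℝ) ≤ Module.finrank ℝ E := by
    have : 3 ≤ Module.finrank ℝ E := by omega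
    exact_mod_cast this
  have h := integral_norm_rpow_add_two (E := E) (s := -1) (by linarith)
  rw [show (-1 : ℝ) + 2 = 1 by norm_num] at h
  simp only [Real.rpow_one, Real.rpow_neg_one] at h
  rw [meanNorm, h, ← hn]
  push_cast
  ring

lemma integrable_norm_inv (hB : 4 ≤ B) (hn : Module.finrank ℝ E + 1 = B) :
    Integrable (fun z : E => ‖z‖⁻¹) (stdGaussian E) := by
  have : Nontrivial E := Module.nontrivial_of_finrank_pos (R := ℝ) (by omega)
  have hn' : (3 : ℝ) ≤ Module.finrank ℝ E := by
    have : 3 ≤ Module.finrank ℝ E := by omega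
    exact_mod_cast this
  simpa only [Real.rpow_neg_one] using integrable_norm_rpow (E := E) (s := -1) (by linarith)

lemma integral_mul_inner (hB : 4 ≤ B) (hn : Module.finrank ℝ E + 1 = B) {e : E}
    (he : ‖e‖ = 1) {ψ : ℝ → ℝ} (hm : Measurable ψ) (hψ : Integrable ψ (gegProb B)) (v : E) :
    ∫ z, ψ ⟪e, dir z⟫ * ⟪v, z⟫ ∂(stdGaussian E) = meanNorm E * (⟪e, v⟫ * firstMoment B ψ) := by
  have : Nontrivial E := Module.nontrivial_of_finrank_pos (R := ℝ) (by omega)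
  rw [← integral_mul_inner_dir hB hn he hψ, meanNorm,
    ← integral_norm_mul_dir (g := fun r => r) (f := fun u => ψ ⟪e, u⟫ * ⟪v, u⟫)
      (by fun_prop) measurable_id]
  congr 1 with z
  rw [inner_dir v z]
  ring

/-- The mean gradient of `ψ(⟪e, z / ‖z‖⟫)`. -/
lemma integral_gradient (hB : 4 ≤ B) (hn : Module.finrank ℝ E + 1 = B) {e : E}
    (he : ‖e‖ = 1) {ψ : ℝ → ℝ}
    (hac : ∀ r, 0 < r → r < 1 → AbsolutelyContinuousOnInterval ψ (-r) r)
    (hd : IntegrableOn (fun x => deriv ψ x * (1 - x ^ 2) ^ (((B : ℝ) - 3) / 2)) (Set.Ioo (-1) 1))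
    (hi : Integrable ψ (gegProb B)) (v : E) :
    Integrable (fun z => ‖z‖⁻¹ * (deriv ψ ⟪e, dir z⟫ * (⟪e, v⟫ - ⟪e, dir z⟫ * ⟪v, dir z⟫)))
      (stdGaussian E) ∧
    ∫ z, ‖z‖⁻¹ * (deriv ψ ⟪e, dir z⟫ * (⟪e, v⟫ - ⟪e, dir z⟫ * ⟪v, dir z⟫)) ∂(stdGaussian E) =
      meanNorm E * (⟪e, v⟫ * firstMoment B ψ) := by
  have : Nontrivial E := Module.nontrivial_of_finrank_pos (R := ℝ) (by omega)
  have hmd : Measurable (deriv ψ) := measurable_deriv ψ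
  set v' := v - ⟪e, v⟫ • e with hv'
  have h1 : ⟪e, v'⟫ = 0 := by
    rw [hv', inner_sub_right, real_inner_smul_right, real_inner_self_eq_norm_sq, he]; ring
  -- Cauchy–Schwarz against the part of the direction orthogonal to `e`, whose squared length is at
  -- most `1 - ⟪e, dir z⟫²`.
  have hsq : ∀ z, ⟪v', dir z⟫ ^ 2 ≤ ‖v'‖ ^ 2 * (1 - ⟪e, dir z⟫ ^ 2) := fun z => by
    set u := dir z
    have h2 : ⟪v', u⟫ = ⟪v', u - ⟪e, u⟫ • e⟫ := by
      rw [inner_sub_right, real_inner_smul_right, real_inner_comm e v', h1]; ring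
    have h3 : ‖u - ⟪e, u⟫ • e‖ ^ 2 = ‖u‖ ^ 2 - ⟪e, u⟫ ^ 2 := by
      rw [← real_inner_self_eq_norm_sq, inner_sub_left, inner_sub_right, inner_sub_right,
        real_inner_smul_left, real_inner_smul_right, real_inner_smul_left,
        real_inner_smul_right, real_inner_self_eq_norm_sq, real_inner_self_eq_norm_sq, he,
        real_inner_comm e u]
      ring
    have h4 := abs_real_inner_le_norm v' (u - ⟪e, u⟫ • e)
    have h5 : ‖u‖ ^ 2 ≤ 1 := by
      have := norm_dir_le z
      have h0 := norm_nonneg u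
      nlinarith
    rw [h2, ← sq_abs]
    calc _ ≤ (‖v'‖ * ‖u - ⟪e, u⟫ • e‖) ^ 2 := by gcongr
      _ = ‖v'‖ ^ 2 * (‖u‖ ^ 2 - ⟪e, u⟫ ^ 2) := by rw [mul_pow, h3]
      _ ≤ _ := by gcongr
  -- integrability of `ψ' √(1 - t²)`
  have hroot : Integrable (fun x => deriv ψ x * √(1 - x ^ 2)) (gegProb B) := by
    rw [integrable_gegProb_iff hB, integrable_gegMeasure_iff]
    refine hd.congr_fun (fun x hx => ?_) measurableSet_Ioo
    have := one_sub_sq_pos hx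
    simp only
    rw [mul_assoc, Real.sqrt_eq_rpow, ← Real.rpow_add this]
    congr 2; ring
  have hrootE := integrable_comp_inner_dir hB hn he hroot
  have hI1 : Integrable (fun z => deriv ψ ⟪e, dir z⟫ * (1 - ⟪e, dir z⟫ ^ 2)) (stdGaussian E) := by
    refine hrootE.mono (by
      have := measurable_inner_dir e
      exact Measurable.aestronglyMeasurable (by fun_prop)) (ae_of_all _ fun z => ?_)
    have hle := abs_le.1 (abs_inner_dir_le he z)
    have h0 : 0 ≤ 1 - ⟪e, dir z⟫ ^ 2 := by nlinarith
    rw [norm_mul, norm_mul]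
    gcongr
    rw [Real.norm_of_nonneg h0, Real.norm_of_nonneg (Real.sqrt_nonneg _)]
    refine Real.le_sqrt_of_sq_le ?_
    nlinarith [sq_nonneg ⟪e, dir z⟫]
  -- The term along `v'` has mean zero by reflection but must be integrable. The bound `hsq`
  -- supplies a factor `√(1 - x²)`, and `ψ' √(1 - x²)` against the weight is exactly what the
  -- exponent `(B - 3) / 2` controls.
  have hI2 : Integrable (fun z => (deriv ψ ⟪e, dir z⟫ * ⟪e, dir z⟫) * ⟪v', dir z⟫)
      (stdGaussian E) := by
    refine (hrootE.norm.const_mul ‖v'‖).mono (by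
      have := measurable_inner_dir e
      have := measurable_inner_dir v'
      exact Measurable.aestronglyMeasurable (by fun_prop)) (ae_of_all _ fun z => ?_)
    have hle := abs_inner_dir_le he z
    have h0 : 0 ≤ 1 - ⟪e, dir z⟫ ^ 2 := by nlinarith [abs_le.1 hle]
    have h2 : |⟪v', dir z⟫| ≤ ‖v'‖ * √(1 - ⟪e, dir z⟫ ^ 2) := by
      refine abs_le_of_sq_le_sq ?_ (by positivity)
      rw [mul_pow, Real.sq_sqrt h0]
      exact hsq z
    simp only [norm_mul, Real.norm_eq_abs, abs_norm, abs_abs]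
    rw [abs_of_nonneg (Real.sqrt_nonneg _)]
    calc |deriv ψ ⟪e, dir z⟫| * |⟪e, dir z⟫| * |⟪v', dir z⟫|
        ≤ |deriv ψ ⟪e, dir z⟫| * 1 * (‖v'‖ * √(1 - ⟪e, dir z⟫ ^ 2)) := by gcongr
      _ = ‖v'‖ * (|deriv ψ ⟪e, dir z⟫| * √(1 - ⟪e, dir z⟫ ^ 2)) := by ring
  have hsplit : ∀ z, deriv ψ ⟪e, dir z⟫ * (⟪e, v⟫ - ⟪e, dir z⟫ * ⟪v, dir z⟫) =
      ⟪e, v⟫ * (deriv ψ ⟪e, dir z⟫ * (1 - ⟪e, dir z⟫ ^ 2)) -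
        (deriv ψ ⟪e, dir z⟫ * ⟪e, dir z⟫) * ⟪v', dir z⟫ := fun z => by
    rw [hv', inner_sub_left, real_inner_smul_left]; ring
  have hI : Integrable (fun z => deriv ψ ⟪e, dir z⟫ * (⟪e, v⟫ - ⟪e, dir z⟫ * ⟪v, dir z⟫))
      (stdGaussian E) := by
    simp_rw [hsplit]
    exact (hI1.const_mul _).sub hI2
  have hfm : Measurable fun u : E => deriv ψ ⟪e, u⟫ * (⟪e, v⟫ - ⟪e, u⟫ * ⟪v, u⟫) := by fun_prop
  refine ⟨integrable_norm_mul_dir (g := fun r => r⁻¹) hfm measurable_inv hI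
    (integrable_norm_inv hB hn), ?_⟩
  rw [integral_norm_mul_dir (g := fun r => r⁻¹) hfm measurable_inv]
  simp_rw [hsplit]
  rw [integral_sub (hI1.const_mul _) hI2, integral_const_mul,
    integral_mul_inner_dir_of_inner_eq_zero h1 (fun x => deriv ψ x * x), sub_zero,
    integral_comp_inner_dir hB hn he (f := fun x => deriv ψ x * (1 - x ^ 2))
      (Measurable.aestronglyMeasurable (by fun_prop)),
    integral_gegProb_deriv hB hac hd ((integrable_gegProb_iff hB).1 hi), meanNorm_eq_inv hB hn,
    firstMoment]
  ring

end FirstMoment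

/-! ### The hyperplane of centered batches -/

section Hyperplane

open scoped RealInnerProductSpace

/-- A single batch as a Euclidean vector. -/
abbrev Batch (B : ℕ) := EuclideanSpace ℝ (Fin B)

/-- The constant batch. -/
def ones (B : ℕ) : Batch B := WithLp.toLp 2 fun _ => 1

/-- The centered batches. -/
abbrev Hyp (B : ℕ) : Submodule ℝ (Batch B) := (ℝ ∙ ones B)ᗮ

variable {B : ℕ}

lemma inner_ones (x : Batch B) : ⟪ones B, x⟫ = ∑ p, x p := by
  simp [ones, PiLp.inner_apply]

lemma mem_hyp_iff {x : Batch B} : x ∈ Hyp B ↔ ∑ p, x p = 0 := by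
  rw [Submodule.mem_orthogonal_singleton_iff_inner_right, inner_ones]

lemma finrank_hyp (hB : 4 ≤ B) : Module.finrank ℝ (Hyp B) + 1 = B := by
  have h1 : ones B ≠ 0 := fun h => by
    have := congrArg (fun x : Batch B => x ⟨0, by omega⟩) h
    simp [ones] at this
  have h2 : Fact (Module.finrank ℝ (Batch B) = (B - 1) + 1) := ⟨by simp; omega⟩
  rw [Submodule.finrank_orthogonal_span_singleton (n := B - 1) h1]
  omega

lemma sum_sub_avg (hB : 4 ≤ B) (x : Fin B → ℝ) : ∑ p, (x p - avg x) = 0 := by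
  have hB' : (B : ℝ) ≠ 0 := by
    have : 0 < B := by omega
    exact_mod_cast this.ne'
  rw [Finset.sum_sub_distrib, avg]
  simp
  field_simp
  simp

lemma avg_add (x y : Fin B → ℝ) : avg (x + y) = avg x + avg y := by
  simp [avg, Finset.sum_add_distrib, add_div]

lemma avg_smul (c : ℝ) (x : Fin B → ℝ) : avg (c • x) = c * avg x := by
  simp [avg, ← Finset.mul_sum, mul_div_assoc]

/-- Centering of a batch. -/
def centerBatch (hB : 4 ≤ B) : Batch B →L[ℝ] Hyp B :=
  LinearMap.toContinuousLinearMap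
    { toFun := fun x => ⟨WithLp.toLp 2 fun p => x p - avg x, mem_hyp_iff.2 (sum_sub_avg hB x)⟩
      map_add' := fun x y => by
        ext p
        simp [avg_add]
        ring
      map_smul' := fun c x => by
        ext p
        simp [avg_smul]
        ring }

lemma centerBatch_apply (hB : 4 ≤ B) (x : Batch B) (p : Fin B) :
    (centerBatch hB x : Batch B) p = x p - avg x := rfl

/-- Centering is the orthogonal projection, so it is invisible to centred vectors. -/
lemma inner_centerBatch (hB : 4 ≤ B) (x : Batch B) (z : Hyp B) :
    ⟪centerBatch hB x, z⟫ = ⟪x, (z : Batch B)⟫ := by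
  have hz := mem_hyp_iff.1 z.2
  rw [Submodule.coe_inner, PiLp.inner_apply, PiLp.inner_apply]
  simp only [centerBatch_apply, RCLike.inner_apply, conj_trivial, mul_sub,
    Finset.sum_sub_distrib]
  rw [← Finset.sum_mul, hz, zero_mul, sub_zero]

lemma centerBatch_coe (hB : 4 ≤ B) (z : Hyp B) : centerBatch hB (z : Batch B) = z := by
  refine ext_inner_right ℝ fun w => ?_
  rw [inner_centerBatch, Submodule.coe_inner]

/-- The centered `p`-th coordinate vector. -/
def coordVec (hB : 4 ≤ B) (p : Fin B) : Hyp B := centerBatch hB (EuclideanSpace.single p 1)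

lemma inner_coordVec (hB : 4 ≤ B) (p : Fin B) (z : Hyp B) :
    ⟪coordVec hB p, z⟫ = (z : Batch B) p := by
  rw [coordVec, inner_centerBatch, EuclideanSpace.inner_single_left]
  simp

lemma centering_apply (p q : Fin B) :
    centering B p q = (if p = q then 1 else 0) - (B : ℝ)⁻¹ := by
  simp [centering, Matrix.one_apply]

lemma inner_coordVec_coordVec (hB : 4 ≤ B) (p q : Fin B) :
    ⟪coordVec hB p, coordVec hB q⟫ = centering B p q := by
  rw [inner_coordVec, coordVec, centerBatch_apply, centering_apply, avg]
  simp [Finset.sum_ite_eq', div_eq_mul_inv, PiLp.single_apply]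

/-- The length of a centered coordinate vector. -/
def coordNorm (B : ℕ) : ℝ := √(((B : ℝ) - 1) / B)

lemma coordNorm_sq (hB : 4 ≤ B) : coordNorm B ^ 2 = ((B : ℝ) - 1) / B := by
  have hB' : (4 : ℝ) ≤ B := by exact_mod_cast hB
  exact Real.sq_sqrt (div_nonneg (by linarith) (by linarith))

/-- The normalized centered coordinate vectors: the vertices of a regular simplex. -/
def unitVec (hB : 4 ≤ B) (p : Fin B) : Hyp B := (coordNorm B)⁻¹ • coordVec hB p

lemma inner_unitVec_coordVec (hB : 4 ≤ B) (p q : Fin B) :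
    ⟪unitVec hB p, coordVec hB q⟫ = (coordNorm B)⁻¹ * centering B p q := by
  rw [unitVec, real_inner_smul_left, inner_coordVec_coordVec]

/-- The source of the argument `-1 / (B - 1)` in the series: it is the cosine between two vertices
of the regular simplex. -/
lemma inner_unitVec_unitVec (hB : 4 ≤ B) (p q : Fin B) :
    ⟪unitVec hB p, unitVec hB q⟫ = if p = q then 1 else -1 / ((B : ℝ) - 1) := by
  have hB' : (4 : ℝ) ≤ B := by exact_mod_cast hB
  have h0 : (B : ℝ) ≠ 0 := by linarith
  have h1 : (B : ℝ) - 1 ≠ 0 := by linarith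
  rw [unitVec, unitVec, real_inner_smul_left, real_inner_smul_right, inner_coordVec_coordVec,
    ← mul_assoc, ← mul_inv, ← sq, coordNorm_sq hB, centering_apply]
  split_ifs <;> field_simp
  ring

lemma norm_unitVec (hB : 4 ≤ B) (p : Fin B) : ‖unitVec hB p‖ = 1 := by
  rw [← sq_eq_sq₀ (norm_nonneg _) zero_le_one, ← real_inner_self_eq_norm_sq,
    inner_unitVec_unitVec, if_pos rfl]
  norm_num

lemma norm_centerBatch_sq (hB : 4 ≤ B) (x : Batch B) :
    ‖centerBatch hB x‖ ^ 2 = ∑ q, (x q - avg x) ^ 2 := by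
  rw [Submodule.coe_norm, EuclideanSpace.real_norm_sq_eq]
  rfl

/-- Batch normalization depends on the direction of the centered batch only. -/
lemma batchNorm_eq (hB : 4 ≤ B) (φ : ℝ → ℝ) (x : Batch B) (p : Fin B) :
    batchNorm φ x p = rescale B φ ⟪unitVec hB p, dir (centerBatch hB x)⟫ := by
  have hB' : (4 : ℝ) ≤ B := by exact_mod_cast hB
  rw [batchNorm, rescale]
  congr 1
  rw [← norm_centerBatch_sq hB, dir, real_inner_smul_right, unitVec, real_inner_smul_left,
    inner_coordVec, centerBatch_apply, Real.sqrt_div (sq_nonneg _), Real.sqrt_sq (norm_nonneg _),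
    coordNorm, Real.sqrt_div (by linarith)]
  have h1 : √((B : ℝ) - 1) ≠ 0 := (Real.sqrt_pos.2 (by linarith)).ne'
  have h2 : √(B : ℝ) ≠ 0 := (Real.sqrt_pos.2 (by linarith)).ne'
  -- For a constant batch both sides are `φ 0`, by the conventions for division and inverse at zero.
  by_cases h : ‖centerBatch hB x‖ = 0
  · simp [h]
  · field_simp

end Hyperplane

/-! ### Second moments of a normalized batch -/

section PairMean

open scoped RealInnerProductSpace

variable {B : ℕ}

/-- The second moments `E[ψ(t_p) χ(t_q)]` of the normalized coordinates `t_p` of a centered batch,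
normalized to `t_p ∈ [-1, 1]`. -/
def pairMean (hB : 4 ≤ B) (ψ χ : ℝ → ℝ) (p q : Fin B) : ℝ :=
  ∫ z : Hyp B, ψ ⟪unitVec hB p, dir z⟫ * χ ⟪unitVec hB q, dir z⟫ ∂(stdGaussian (Hyp B))

lemma memLp_coord (hB : 4 ≤ B) {ψ : ℝ → ℝ} (hψ : MemLp ψ 2 (gegProb B)) (p : Fin B) :
    MemLp (fun z : Hyp B => ψ ⟪unitVec hB p, dir z⟫) 2 (stdGaussian (Hyp B)) :=
  memLp_comp_inner_dir hB (finrank_hyp hB) (norm_unitVec hB p) hψ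

lemma integrable_coord_mul_coord (hB : 4 ≤ B) {ψ χ : ℝ → ℝ} (hψ : MemLp ψ 2 (gegProb B))
    (hχ : MemLp χ 2 (gegProb B)) (p q : Fin B) :
    Integrable (fun z : Hyp B => ψ ⟪unitVec hB p, dir z⟫ * χ ⟪unitVec hB q, dir z⟫)
      (stdGaussian (Hyp B)) :=
  (memLp_coord hB hψ p).integrable_mul (memLp_coord hB hχ q)

lemma pairMean_self (hB : 4 ≤ B) {ψ χ : ℝ → ℝ} (hψ : MemLp ψ 2 (gegProb B))
    (hχ : MemLp χ 2 (gegProb B)) (p : Fin B) :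
    pairMean hB ψ χ p p = ∫ x, ψ x * χ x ∂(gegProb B) :=
  integral_comp_inner_dir hB (finrank_hyp hB) (norm_unitVec hB p)
    (f := fun x => ψ x * χ x) (hψ.aestronglyMeasurable.mul hχ.aestronglyMeasurable)

lemma memLp_id_gegProb (hB : 4 ≤ B) : MemLp (fun x : ℝ => x) 2 (gegProb B) := by
  have := isProbabilityMeasure_gegProb hB
  refine MemLp.of_bound (by fun_prop) 1 ?_
  filter_upwards [ae_mem_Ioo_gegProb hB] with x hx
  exact abs_le.2 ⟨hx.1.le, hx.2.le⟩

lemma pairMean_id_right (hB : 4 ≤ B) {ψ : ℝ → ℝ} (hψ : MemLp ψ 2 (gegProb B)) (p q : Fin B) :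
    pairMean hB ψ (fun x => x) p q =
      (if p = q then 1 else -1 / ((B : ℝ) - 1)) * firstMoment B ψ := by
  rw [← inner_unitVec_unitVec hB]
  exact integral_mul_inner_dir hB (finrank_hyp hB) (norm_unitVec hB p)
    (integrable_gegProb_of_memLp hB hψ) _

/-- Apply the vanishing relation of the weight to `X`: it reads `1 = (B - 1) E[x²]`. -/
lemma firstMoment_id (hB : 4 ≤ B) : firstMoment B (fun x => x) = 1 / ((B : ℝ) - 1) := by
  have hB' : (4 : ℝ) ≤ B := by exact_mod_cast hB
  have h := (isGegenbauerFunctional_gegFun hB).map_eq_zero Polynomial.X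
  have h2 : ((1 - Polynomial.X ^ 2) * Polynomial.derivative (Polynomial.X : ℝ[X]) -
      Polynomial.C (2 * (((B : ℝ) - 3) / 2) + 1) * Polynomial.X * Polynomial.X) =
      1 - Polynomial.C ((B : ℝ) - 1) * (Polynomial.X * Polynomial.X) := by
    have h3 : Polynomial.C (2 * (((B : ℝ) - 3) / 2) + 1) = Polynomial.C ((B : ℝ) - 1) - 1 := by
      rw [← Polynomial.C_1, ← Polynomial.C_sub]
      congr 1; ring
    rw [Polynomial.derivative_X, h3]
    ring
  rw [h2, map_sub, (isGegenbauerFunctional_gegFun hB).map_one,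
    IsGegenbauerFunctional.map_C_mul, gegFun_apply] at h
  simp only [Polynomial.eval_mul, Polynomial.eval_X] at h
  rw [firstMoment, eq_div_iff (by linarith)]
  linarith

/-- The gap between the variance and the covariance of two normalized coordinates dominates the
squared first moment; there is equality for linear functions. -/
lemma firstMoment_sq_le (hB : 4 ≤ B) {ψ : ℝ → ℝ} (hψ : MemLp ψ 2 (gegProb B)) {p q : Fin B}
    (hpq : p ≠ q) :
    B * firstMoment B ψ ^ 2 ≤ pairMean hB ψ ψ p p - pairMean hB ψ ψ p q := by
  have hB' : (4 : ℝ) ≤ B := by exact_mod_cast hB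
  have hid := memLp_id_gegProb hB
  set m := firstMoment B ψ with hm
  -- Since `E[x²] = 1 / (B - 1)`, the subtracted term is the `L²` projection of `ψ` onto linear
  -- functions.
  set χ : ℝ → ℝ := fun x => ψ x - (m * (B - 1)) * x with hχdef
  have hχ : MemLp χ 2 (gegProb B) := hψ.sub (hid.const_mul _)
  have h1 : pairMean hB χ χ q q = pairMean hB χ χ p p := by
    rw [pairMean_self hB hχ hχ, pairMean_self hB hχ hχ]
  -- The gap is half the mean of `(χ(t_p) - χ(t_q))²`, as `t_p` and `t_q` have the same law.
  have h0 : 0 ≤ pairMean hB χ χ p p - pairMean hB χ χ p q := by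
    have h2 : 0 ≤ ∫ z : Hyp B, (χ ⟪unitVec hB p, dir z⟫ - χ ⟪unitVec hB q, dir z⟫) ^ 2
        ∂(stdGaussian (Hyp B)) := integral_nonneg fun z => sq_nonneg _
    have h3 : ∀ z : Hyp B, (χ ⟪unitVec hB p, dir z⟫ - χ ⟪unitVec hB q, dir z⟫) ^ 2 =
        χ ⟪unitVec hB p, dir z⟫ * χ ⟪unitVec hB p, dir z⟫ -
          2 * (χ ⟪unitVec hB p, dir z⟫ * χ ⟪unitVec hB q, dir z⟫) +
          χ ⟪unitVec hB q, dir z⟫ * χ ⟪unitVec hB q, dir z⟫ := fun z => by ring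
    have i1 := integrable_coord_mul_coord hB hχ hχ p p
    have i2 := (integrable_coord_mul_coord hB hχ hχ p q).const_mul 2
    simp_rw [h3] at h2
    rw [integral_add (by exact i1.sub i2) (integrable_coord_mul_coord hB hχ hχ q q),
      integral_sub i1 i2, integral_const_mul] at h2
    change 0 ≤ pairMean hB χ χ p p - 2 * pairMean hB χ χ p q + pairMean hB χ χ q q at h2
    rw [h1] at h2
    linarith
  have hexp : ∀ r s : Fin B, pairMean hB χ χ r s = pairMean hB ψ ψ r s -
      (m * (B - 1)) * pairMean hB ψ (fun x => x) r s -
      (m * (B - 1)) * pairMean hB ψ (fun x => x) s r +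
      (m * (B - 1)) ^ 2 * pairMean hB (fun x => x) (fun x => x) r s := fun r s => by
    have h3 : ∀ z : Hyp B, χ ⟪unitVec hB r, dir z⟫ * χ ⟪unitVec hB s, dir z⟫ =
        ψ ⟪unitVec hB r, dir z⟫ * ψ ⟪unitVec hB s, dir z⟫ -
        (m * (B - 1)) * (ψ ⟪unitVec hB r, dir z⟫ * ⟪unitVec hB s, dir z⟫) -
        (m * (B - 1)) * (ψ ⟪unitVec hB s, dir z⟫ * ⟪unitVec hB r, dir z⟫) +
        (m * (B - 1)) ^ 2 * (⟪unitVec hB r, dir z⟫ * ⟪unitVec hB s, dir z⟫) := fun z => by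
      simp only [hχdef]; ring
    have i1 := integrable_coord_mul_coord hB hψ hψ r s
    have i2 := (integrable_coord_mul_coord hB hψ hid r s).const_mul (m * (B - 1))
    have i3 := (integrable_coord_mul_coord hB hψ hid s r).const_mul (m * (B - 1))
    have i4 := (integrable_coord_mul_coord hB hid hid r s).const_mul ((m * (B - 1)) ^ 2)
    rw [pairMean]
    simp_rw [h3]
    rw [integral_add (by exact (i1.sub i2).sub i3) i4, integral_sub (by exact i1.sub i2) i3, integral_sub i1 i2,
      integral_const_mul, integral_const_mul, integral_const_mul]
    rfl
  rw [hexp, hexp, pairMean_id_right hB hψ, pairMean_id_right hB hψ, pairMean_id_right hB hψ,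
    pairMean_id_right hB hid, pairMean_id_right hB hid, firstMoment_id hB, if_pos rfl,
    if_neg hpq, if_neg hpq.symm, ← hm] at h0
  have hne : (B : ℝ) - 1 ≠ 0 := by linarith
  have h4 : pairMean hB ψ ψ p p - m * (B - 1) * (1 * m) - m * (B - 1) * (1 * m) +
      (m * (B - 1)) ^ 2 * (1 * (1 / (B - 1))) - (pairMean hB ψ ψ p q -
      m * (B - 1) * (-1 / (B - 1) * m) - m * (B - 1) * (-1 / (B - 1) * m) +
      (m * (B - 1)) ^ 2 * (-1 / (B - 1) * (1 / (B - 1)))) =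
      pairMean hB ψ ψ p p - pairMean hB ψ ψ p q - B * m ^ 2 := by
    field_simp
    ring
  rw [h4] at h0
  linarith

/-! ### Gegenbauer expansions -/

lemma memLp_geg (hB : 4 ≤ B) (l : ℕ) : MemLp (geg B l) 2 (gegProb B) := by
  have := isProbabilityMeasure_gegProb hB
  obtain ⟨K, hK⟩ := isCompact_Icc.exists_bound_of_continuousOn (s := Set.Icc (-1 : ℝ) 1)
    (f := geg B l) (Polynomial.continuous _).continuousOn
  refine MemLp.of_bound (Polynomial.continuous _).aestronglyMeasurable K ?_
  filter_upwards [ae_mem_Ioo_gegProb hB] with x hx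
  exact hK x (Set.Ioo_subset_Icc_self hx)

lemma gegC_pos (hB : 4 ≤ B) (l : ℕ) : 0 < gegC B l := by
  have hB' : (4 : ℝ) ≤ B := by exact_mod_cast hB
  have hl : (0 : ℝ) ≤ l := by positivity
  exact div_pos (by linarith) (by linarith)

/-- The case `ρ = 1`, treated apart because the two-point formula is proved for `ρ² < 1`. -/
lemma integral_geg_mul_geg_self (hB : 4 ≤ B) (l m : ℕ) :
    ∫ x, geg B l x * geg B m x ∂(gegProb B) = if l = m then gegC B m * geg B m 1 else 0 := by
  have hB' : (4 : ℝ) ≤ B := by exact_mod_cast hB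
  have hα : (0 : ℝ) < ((B : ℝ) - 3) / 2 := by linarith
  have G := isGegenbauerFunctional_gegFun hB
  have h1 : ∀ l m, ∫ x, geg B l x * geg B m x ∂(gegProb B) =
      gegFun hB (gegenbauer (((B : ℝ) - 3) / 2) l * gegenbauer (((B : ℝ) - 3) / 2) m) := by
    intro l m
    rw [gegFun_apply]
    simp only [Polynomial.eval_mul, geg]
  have h2 : ∀ l m, l < m → ∫ x, geg B l x * geg B m x ∂(gegProb B) = 0 := by
    intro l m hlm
    rw [h1, G.map_mul_gegenbauer hα
      ((degree_gegenbauer_le l).trans_lt (by exact_mod_cast hlm))]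
  split_ifs with h
  · subst h
    have h3 := G.map_gegenbauer_mul_self hα l
    have hl : (0 : ℝ) ≤ l := by positivity
    have h4 : (B : ℝ) - 3 + 2 * l ≠ 0 := by linarith
    rw [← h1] at h3
    rw [gegC, div_mul_eq_mul_div, eq_div_iff h4]
    simp only [geg] at h3 ⊢
    linarith
  · rcases lt_or_gt_of_ne h with h | h
    · exact h2 l m h
    · simp_rw [mul_comm (geg B l _)]
      exact h2 m l h

lemma pairMean_geg (hB : 4 ≤ B) (p q : Fin B) (l m : ℕ) :
    pairMean hB (geg B l) (geg B m) p q =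
      if l = m then gegC B m * geg B m (if p = q then 1 else -1 / ((B : ℝ) - 1)) else 0 := by
  have hB' : (4 : ℝ) ≤ B := by exact_mod_cast hB
  by_cases hpq : p = q
  · subst hpq
    rw [pairMean_self hB (memLp_geg hB l) (memLp_geg hB m), integral_geg_mul_geg_self hB,
      if_pos rfl]
  · rw [pairMean, integral_geg_mul_geg hB (finrank_hyp hB) (norm_unitVec hB p) (norm_unitVec hB q)
      (inner_unitVec_unitVec hB p q)]
    rw [if_neg hpq, div_pow, div_lt_one (by nlinarith)]
    nlinarith

/-- The partial sums of a Gegenbauer expansion. -/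
def gegSum (B : ℕ) (a : ℕ → ℝ) (N : ℕ) (x : ℝ) : ℝ :=
  ∑ l ∈ Finset.range N, a l * (gegC B l)⁻¹ * geg B l x

lemma memLp_gegSum (hB : 4 ≤ B) (a : ℕ → ℝ) (N : ℕ) : MemLp (gegSum B a N) 2 (gegProb B) :=
  memLp_finsetSum _ fun l _ => (memLp_geg hB l).const_mul _

lemma pairMean_gegSum_geg (hB : 4 ≤ B) (a : ℕ → ℝ) (p q : Fin B) (N m : ℕ) :
    pairMean hB (gegSum B a N) (geg B m) p q =
      if m < N then a m * geg B m (if p = q then 1 else -1 / ((B : ℝ) - 1)) else 0 := by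
  have h : ∀ z : Hyp B, gegSum B a N ⟪unitVec hB p, dir z⟫ * geg B m ⟪unitVec hB q, dir z⟫ =
      ∑ l ∈ Finset.range N, a l * (gegC B l)⁻¹ *
        (geg B l ⟪unitVec hB p, dir z⟫ * geg B m ⟪unitVec hB q, dir z⟫) := fun z => by
    rw [gegSum, Finset.sum_mul]
    exact Finset.sum_congr rfl fun l _ => by ring
  rw [pairMean]
  simp_rw [h]
  rw [integral_finsetSum _ fun l _ =>
    (integrable_coord_mul_coord hB (memLp_geg hB l) (memLp_geg hB m) p q).const_mul _]
  have h2 : ∀ l ∈ Finset.range N, ∫ z : Hyp B, a l * (gegC B l)⁻¹ *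
      (geg B l ⟪unitVec hB p, dir z⟫ * geg B m ⟪unitVec hB q, dir z⟫) ∂(stdGaussian (Hyp B)) =
      if l = m then a m * geg B m (if p = q then 1 else -1 / ((B : ℝ) - 1)) else 0 := by
    intro l _
    rw [integral_const_mul]
    change _ * pairMean hB (geg B l) (geg B m) p q = _
    rw [pairMean_geg]
    by_cases hl : l = m
    · subst hl
      rw [if_pos rfl, if_pos rfl, ← mul_assoc, mul_assoc (a l), inv_mul_cancel₀ (gegC_pos hB l).ne',
        mul_one]
    · rw [if_neg hl, if_neg hl, mul_zero]
  rw [Finset.sum_congr rfl h2, Finset.sum_ite_eq']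
  simp

lemma pairMean_gegSum (hB : 4 ≤ B) (a : ℕ → ℝ) (p q : Fin B) (N : ℕ) :
    pairMean hB (gegSum B a N) (gegSum B a N) p q = ∑ l ∈ Finset.range N,
      a l ^ 2 * (gegC B l)⁻¹ * geg B l (if p = q then 1 else -1 / ((B : ℝ) - 1)) := by
  have h : ∀ z : Hyp B, gegSum B a N ⟪unitVec hB p, dir z⟫ * gegSum B a N ⟪unitVec hB q, dir z⟫ =
      ∑ l ∈ Finset.range N, a l * (gegC B l)⁻¹ *
        (gegSum B a N ⟪unitVec hB p, dir z⟫ * geg B l ⟪unitVec hB q, dir z⟫) := fun z => by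
    conv_lhs => rw [gegSum.eq_def B a N ⟪unitVec hB q, dir z⟫, Finset.mul_sum]
    exact Finset.sum_congr rfl fun l _ => by ring
  rw [pairMean]
  simp_rw [h]
  rw [integral_finsetSum _ fun l _ =>
    (integrable_coord_mul_coord hB (memLp_gegSum hB a N) (memLp_geg hB l) p q).const_mul _]
  refine Finset.sum_congr rfl fun l hl => ?_
  rw [integral_const_mul]
  change _ * pairMean hB (gegSum B a N) (geg B l) p q = _
  rw [pairMean_gegSum_geg, if_pos (Finset.mem_range.1 hl)]
  ring

/-- Each coordinate `t_p` has law `gegProb B`, so `ψ ↦ ψ(t_p)` is an isometry of `L²` spaces, and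
`pairMean` is an inner product of two such images. -/
lemma tendsto_pairMean (hB : 4 ≤ B) {ψ χ : ℝ → ℝ} {ψs χs : ℕ → ℝ → ℝ}
    (hψ : MemLp ψ 2 (gegProb B)) (hχ : MemLp χ 2 (gegProb B))
    (hψs : ∀ N, MemLp (ψs N) 2 (gegProb B)) (hχs : ∀ N, MemLp (χs N) 2 (gegProb B))
    (h1 : Tendsto (fun N => eLpNorm (ψ - ψs N) 2 (gegProb B)) atTop (𝓝 0))
    (h2 : Tendsto (fun N => eLpNorm (χ - χs N) 2 (gegProb B)) atTop (𝓝 0)) (p q : Fin B) :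
    Tendsto (fun N => pairMean hB (ψs N) (χs N) p q) atTop (𝓝 (pairMean hB ψ χ p q)) := by
  have hfin := finrank_hyp hB
  have key : ∀ {ψ χ : ℝ → ℝ} (hψ : MemLp ψ 2 (gegProb B)) (hχ : MemLp χ 2 (gegProb B)),
      pairMean hB ψ χ p q = inner ℝ (memLp_coord hB hχ q).toLp (memLp_coord hB hψ p).toLp := by
    intro ψ χ hψ hχ
    rw [L2.inner_def, pairMean]
    refine integral_congr_ae ?_
    filter_upwards [(memLp_coord hB hψ p).coeFn_toLp, (memLp_coord hB hχ q).coeFn_toLp]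
      with z hz1 hz2
    rw [hz1, hz2]
    simp
  have lim : ∀ {ψ : ℝ → ℝ} {ψs : ℕ → ℝ → ℝ} (hψ : MemLp ψ 2 (gegProb B))
      (hψs : ∀ N, MemLp (ψs N) 2 (gegProb B))
      (_ : Tendsto (fun N => eLpNorm (ψ - ψs N) 2 (gegProb B)) atTop (𝓝 0)) (p : Fin B),
      Tendsto (fun N => (memLp_coord hB (hψs N) p).toLp) atTop (𝓝 (memLp_coord hB hψ p).toLp) := by
    intro ψ ψs hψ hψs h p
    rw [Lp.tendsto_Lp_iff_tendsto_eLpNorm'']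
    refine h.congr fun N => ?_
    rw [eLpNorm_sub_comm, ← map_inner_dir hB hfin (norm_unitVec hB p), eLpNorm_map_measure]
    · rfl
    · rw [map_inner_dir hB hfin (norm_unitVec hB p)]
      exact ((hψs N).sub hψ).aestronglyMeasurable
    · exact (measurable_inner_dir _).aemeasurable
  rw [key hψ hχ]
  simp_rw [fun N => key (hψs N) (hχs N)]
  exact (lim hχ hχs h2 q).inner (lim hψ hψs h1 p)

lemma tendsto_eLpNorm_gegProb {φ : ℝ → ℝ} {a : ℕ → ℝ} (h : HasGegenbauerExpansion B φ a) :
    Tendsto (fun N => eLpNorm (rescale B φ - gegSum B a N) 2 (gegProb B)) atTop (𝓝 0) := by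
  have h1 : ∀ N, eLpNorm (rescale B φ - gegSum B a N) 2 (gegProb B) =
      ((gegMeasure B Set.univ)⁻¹ ^ (1 / (2 : ENNReal)).toReal) • eLpNorm
      (fun x => rescale B φ x - ∑ l ∈ Finset.range N, a l * (gegC B l)⁻¹ * geg B l x)
      2 (gegMeasure B) := fun N => by
    rw [gegProb, eLpNorm_smul_measure_of_ne_top (by norm_num)]
    rfl
  simp_rw [h1]
  have h2 : (gegMeasure B Set.univ)⁻¹ ^ (1 / (2 : ENNReal)).toReal ≠ ⊤ :=
    ENNReal.rpow_ne_top_of_nonneg (by positivity)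
      (ENNReal.inv_ne_top.2 (gegMeasure_univ_ne_zero B))
  simpa using ENNReal.Tendsto.const_mul h (Or.inr h2)

/-- The Gegenbauer series of the gap between variance and covariance, and of the first moment. -/
lemma hasSum_gegTerm (hB : 4 ≤ B) {φ : ℝ → ℝ} (hφ : MemLp (rescale B φ) 2 (gegProb B))
    {a : ℕ → ℝ} (h : HasGegenbauerExpansion B φ a) {p q : Fin B} (hpq : p ≠ q) :
    HasSum (gegTerm B a) (pairMean hB (rescale B φ) (rescale B φ) p p -
      pairMean hB (rescale B φ) (rescale B φ) p q) := by
  -- The gap bound for `ψ = C_l` gives `C_l(1) ≥ C_l(-1/(B-1))`. With nonnegative terms, convergence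
  -- of the partial sums is summability.
  have hnn : ∀ l, 0 ≤ gegTerm B a l := fun l => by
    have h1 := firstMoment_sq_le hB (memLp_geg hB l) hpq
    rw [pairMean_geg, pairMean_geg, if_pos rfl, if_pos rfl, if_pos rfl, if_neg hpq,
      ← mul_sub] at h1
    have h2 : 0 ≤ gegC B l * (geg B l 1 - geg B l (-1 / ((B : ℝ) - 1))) :=
      le_trans (by positivity) h1
    have h3 := gegC_pos hB l
    have h4 := nonneg_of_mul_nonneg_right h2 h3
    rw [gegTerm]
    positivity
  rw [hasSum_iff_tendsto_nat_of_nonneg hnn]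
  have hl := tendsto_eLpNorm_gegProb h
  have h1 := (tendsto_pairMean hB hφ hφ (memLp_gegSum hB a) (memLp_gegSum hB a) hl hl p p).sub
    (tendsto_pairMean hB hφ hφ (memLp_gegSum hB a) (memLp_gegSum hB a) hl hl p q)
  refine h1.congr fun N => ?_
  rw [pairMean_gegSum, pairMean_gegSum, if_pos rfl, if_neg hpq, ← Finset.sum_sub_distrib]
  refine Finset.sum_congr rfl fun l _ => ?_
  rw [gegTerm]
  ring

lemma geg_one (B : ℕ) (x : ℝ) : geg B 1 x = ((B : ℝ) - 3) * x := by
  rw [geg, gegenbauer_one]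
  simp
  left
  ring

/-- Pair the expansion with `C_1 = (B - 3) x`: by orthogonality all partial sums with at least two
terms give `a 1 * (B - 3)`. -/
lemma firstMoment_eq_coeff (hB : 4 ≤ B) {φ : ℝ → ℝ} (hφ : MemLp (rescale B φ) 2 (gegProb B))
    {a : ℕ → ℝ} (h : HasGegenbauerExpansion B φ a) : firstMoment B (rescale B φ) = a 1 := by
  have hB' : (4 : ℝ) ≤ B := by exact_mod_cast hB
  have h3 : (B : ℝ) - 3 ≠ 0 := by linarith
  set p : Fin B := ⟨0, by omega⟩
  have hl := tendsto_eLpNorm_gegProb h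
  have h0 : Tendsto (fun _ : ℕ => eLpNorm (geg B 1 - geg B 1) 2 (gegProb B)) atTop (𝓝 0) := by
    simp
  have h1 := tendsto_pairMean hB hφ (memLp_geg hB 1) (memLp_gegSum hB a)
    (fun _ => memLp_geg hB 1) hl h0 p p
  have h2 : Tendsto (fun N => pairMean hB (gegSum B a N) (geg B 1) p p) atTop
      (𝓝 (a 1 * ((B : ℝ) - 3))) := by
    refine tendsto_const_nhds.congr' ?_
    filter_upwards [eventually_ge_atTop 2] with N hN
    rw [pairMean_gegSum_geg, if_pos (by omega), if_pos rfl, geg_one, mul_one]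
  have h4 := tendsto_nhds_unique h1 h2
  rw [pairMean_self hB hφ (memLp_geg hB 1)] at h4
  simp_rw [geg_one] at h4
  have h5 : ∫ x, rescale B φ x * (((B : ℝ) - 3) * x) ∂(gegProb B) =
      ((B : ℝ) - 3) * firstMoment B (rescale B φ) := by
    rw [firstMoment, ← integral_const_mul]
    congr 1 with x
    ring
  rw [h5, mul_comm] at h4
  exact mul_right_cancel₀ h3 h4

end PairMean

/-! ### Gaussian measures and their densities -/

section Density

set_option maxSynthPendingDepth 3
set_option linter.unusedSectionVars false

open scoped RealInnerProductSpace MatrixOrder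

variable {W : Type*} [NormedAddCommGroup W] [InnerProductSpace ℝ W] [FiniteDimensional ℝ W]
  [MeasurableSpace W] [BorelSpace W]

/-- The square root of the matrix of `C` in an orthonormal basis. -/
lemma exists_adjoint_comp_eq {C : W →L[ℝ] W} (hC : C.IsPositive) :
    ∃ R : W →L[ℝ] W, R.adjoint ∘L R = C := by
  let b := stdOrthonormalBasis ℝ W
  have h1 : (LinearMap.toMatrixOrthonormal b (C : W →ₗ[ℝ] W)).PosSemidef :=
    (LinearMap.posSemidef_toMatrix_iff b).2 hC.toLinearMap
  set R := (LinearMap.toMatrixOrthonormal b).symm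
    (CFC.sqrt (LinearMap.toMatrixOrthonormal b (C : W →ₗ[ℝ] W))) with hR
  have hs := CFC.sqrt_mul_sqrt_self _ h1.nonneg
  have hsa : star (CFC.sqrt (LinearMap.toMatrixOrthonormal b (C : W →ₗ[ℝ] W))) = _ :=
    (CFC.sqrt_nonneg (LinearMap.toMatrixOrthonormal b (C : W →ₗ[ℝ] W))).isSelfAdjoint
  have h2 : star R * R = (C : W →ₗ[ℝ] W) := by
    rw [hR, ← map_star, ← map_mul, hsa, hs, StarAlgEquiv.symm_apply_apply]
  refine ⟨LinearMap.toContinuousLinearMap R, ?_⟩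
  ext x
  refine ext_inner_right ℝ fun y => ?_
  have h3 := congrArg (fun T : W →ₗ[ℝ] W => ⟪T x, y⟫) h2
  simp only [LinearMap.star_eq_adjoint, Module.End.mul_apply, LinearMap.adjoint_inner_left] at h3
  rw [ContinuousLinearMap.comp_apply, ContinuousLinearMap.adjoint_inner_left]
  exact h3

/-- The integral of `f` against the Gaussian kernel with precision operator `Q`. -/
def gaussInt (f : W → ℝ) (Q : W →L[ℝ] W) : ℝ := ∫ y, Real.exp (-(1 / 2) * ⟪y, Q y⟫) * f y

/-- Integrals against a nondegenerate Gaussian measure with covariance operator `C`. -/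
lemma integral_eq_gaussInt_div {μ : Measure W} [IsProbabilityMeasure μ] {C : W →L[ℝ] W}
    (hC : C.IsPositive) (hu : IsUnit C)
    (hμ : ∀ t, charFun μ t = Complex.exp (-(⟪t, C t⟫ : ℝ) / 2)) (f : W → ℝ) :
    ∫ y, f y ∂μ = gaussInt f (Ring.inverse C) / gaussInt (fun _ => 1) (Ring.inverse C) := by
  obtain ⟨R, hR⟩ := exists_adjoint_comp_eq hC
  set A := R.adjoint with hA
  have hAR : A.adjoint = R := R.adjoint_adjoint
  have hlaw : (stdGaussian W).map A = μ := by
    have : IsProbabilityMeasure ((stdGaussian W).map A) :=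
      Measure.isProbabilityMeasure_map (by fun_prop)
    apply Measure.ext_of_charFun
    ext t
    rw [charFun_map_continuousLinearMap, charFun_stdGaussian, hμ, hAR, ← hR,
      ContinuousLinearMap.comp_apply, hA, ContinuousLinearMap.adjoint_inner_right,
      real_inner_self_eq_norm_sq]
    push_cast; rfl
  obtain ⟨D, hD1, hD2⟩ : ∃ D : W →L[ℝ] W, D * C = 1 ∧ C * D = 1 :=
    ⟨_, Ring.inverse_mul_cancel _ hu, Ring.mul_inverse_cancel _ hu⟩
  have hQ : Ring.inverse C = D := by
    rw [← mul_one (Ring.inverse C), ← hD2, ← mul_assoc, Ring.inverse_mul_cancel _ hu, one_mul]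
  have hinj : Function.Injective A := by
    have h1 : (A : W →ₗ[ℝ] W) ∘ₗ (R ∘L D : W →L[ℝ] W) = LinearMap.id := by
      ext w
      have := congrArg (fun T : W →L[ℝ] W => T w) hD2
      rw [← hR] at this
      exact this
    have h2 : Function.Surjective A := fun w =>
      ⟨R (D w), congrArg (fun T : W →ₗ[ℝ] W => T w) h1⟩
    exact (LinearMap.injective_iff_surjective (f := (A : W →ₗ[ℝ] W))).2 h2
  have hdet : LinearMap.det (A : W →ₗ[ℝ] W) ≠ 0 := by
    rw [Ne, LinearMap.det_eq_zero_iff_ker_ne_bot, not_not]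
    exact LinearMap.ker_eq_bot.2 hinj
  have hemb : MeasurableEmbedding A :=
    (LinearEquiv.ofInjectiveEndo (A : W →ₗ[ℝ] W) hinj).toContinuousLinearEquiv.toHomeomorph.measurableEmbedding
  have hq : ∀ z, ‖z‖ ^ 2 = ⟪A z, D (A z)⟫ := fun z => by
    have h1 : A (R (D (A z))) = A z := by
      have := congrArg (fun T : W →L[ℝ] W => T (A z)) hD2
      rw [← hR] at this
      exact this
    rw [ContinuousLinearMap.adjoint_inner_left, hinj h1, real_inner_self_eq_norm_sq]
  -- Change of variables along `A`. The determinant is never computed: it cancels against the case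
  -- `g = 1`.
  have key : ∀ g : W → ℝ, ∫ y, g y ∂μ = (gaussNorm W)⁻¹ *
      (|(LinearMap.det (A : W →ₗ[ℝ] W))⁻¹| * gaussInt g D) := fun g => by
    rw [← hlaw, hemb.integral_map, integral_stdGaussian, smul_eq_mul]
    congr 1
    have h1 : ∀ z, Real.exp (-(1 / 2) * ‖z‖ ^ 2) • g (A z) =
        (fun y => Real.exp (-(1 / 2) * ⟪y, D y⟫) * g y) (A z) := fun z => by
      rw [hq z]; rfl
    rw [funext h1, ← hemb.integral_map (μ := volume) (fun y => Real.exp (-(1 / 2) * ⟪y, D y⟫) * g y), show (volume : Measure W).map A =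
      ENNReal.ofReal |(LinearMap.det (A : W →ₗ[ℝ] W))⁻¹| • volume from
        Measure.map_linearMap_addHaar_eq_smul_addHaar _ hdet, integral_smul_measure,
      ENNReal.toReal_ofReal (abs_nonneg _)]
    rfl
  have h1 := key fun _ => 1
  rw [integral_const, probReal_univ, one_smul] at h1
  rw [hQ, key f]
  have hne : gaussInt (fun _ => 1) D ≠ 0 := fun h => by
    rw [h] at h1; simp at h1
  rw [eq_div_iff hne]
  linear_combination -(gaussInt f D) * h1

/-- The evaluation `Q ↦ ⟪y, Q y⟫` of quadratic forms. -/
def evalQuad (y : W) : (W →L[ℝ] W) →L[ℝ] ℝ :=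
  (innerSL ℝ y) ∘L (ContinuousLinearMap.apply ℝ W y)

lemma evalQuad_apply (y : W) (Q : W →L[ℝ] W) : evalQuad y Q = ⟪y, Q y⟫ := rfl

lemma norm_evalQuad_le (y : W) : ‖evalQuad y‖ ≤ ‖y‖ ^ 2 := by
  refine ContinuousLinearMap.opNorm_le_bound _ (sq_nonneg _) fun Q => ?_
  rw [evalQuad_apply]
  calc ‖⟪y, Q y⟫‖ ≤ ‖y‖ * ‖Q y‖ := norm_inner_le_norm _ _
    _ ≤ ‖y‖ * (‖Q‖ * ‖y‖) := by gcongr; exact Q.le_opNorm y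
    _ = ‖y‖ ^ 2 * ‖Q‖ := by ring

lemma continuous_evalQuad : Continuous (evalQuad : W → (W →L[ℝ] W) →L[ℝ] ℝ) := by
  unfold evalQuad
  exact (innerSL ℝ).continuous.clm_comp (ContinuousLinearMap.apply ℝ W).continuous

/-- A dilation leaves `f` unchanged and alters only the variance, so integrability for one isotropic
Gaussian gives it for all. -/
lemma integrable_exp_mul_of_homogeneous {f : W → ℝ} (hf : Integrable f (stdGaussian W))
    (hh : ∀ a : ℝ, 0 < a → ∀ y, f (a • y) = f y) {c : ℝ} (hc : 0 < c) :
    Integrable fun y => Real.exp (-c * ‖y‖ ^ 2) * f y := by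
  have h1 := integrable_stdGaussian_iff.1 hf
  have h2 := (integrable_comp_smul_iff (μ := (volume : Measure W)) _
    (Real.sqrt_pos.2 (by positivity : 0 < 2 * c)).ne').2 h1
  refine h2.congr (ae_of_all _ fun y => ?_)
  simp only
  rw [hh _ (Real.sqrt_pos.2 (by positivity)), norm_smul, mul_pow, Real.norm_eq_abs, sq_abs,
    Real.sq_sqrt (by positivity), smul_eq_mul]
  congr 2
  ring

/-- Differentiation under the integral sign, near a positive multiple of the identity. -/
lemma hasFDerivAt_gaussInt {f : W → ℝ} (hm : Measurable f)
    (hf : ∀ c : ℝ, 0 < c → Integrable fun y => Real.exp (-c * ‖y‖ ^ 2) * f y) {c : ℝ}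
    (hc : 0 < c) :
    ∃ L : (W →L[ℝ] W) →L[ℝ] ℝ, HasFDerivAt (gaussInt f) L (c • (1 : W →L[ℝ] W)) ∧
      ∀ H, L H = -(1 / 2) * gaussInt (fun y => f y * ⟪y, H y⟫) (c • 1) := by
  set F : (W →L[ℝ] W) → W → ℝ := fun Q y => Real.exp (-(1 / 2) * ⟪y, Q y⟫) * f y
  set F' : (W →L[ℝ] W) → W → (W →L[ℝ] W) →L[ℝ] ℝ :=
    fun Q y => (-(1 / 2) * F Q y) • evalQuad y with hF'
  have hmeas : ∀ Q, Measurable (F Q) := fun Q => by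
    have : Continuous fun y => Real.exp (-(1 / 2) * ⟪y, Q y⟫) := by fun_prop
    exact this.measurable.mul hm
  have hone : ∀ y : W, ⟪y, (c • (1 : W →L[ℝ] W)) y⟫ = c * ‖y‖ ^ 2 := fun y => by
    rw [smul_apply, one_apply_eq_self, real_inner_smul_right,
      real_inner_self_eq_norm_sq]
  -- The radius `c / 2` keeps the quadratic form above half of `c ‖y‖²` throughout the ball.
  have hlow : ∀ Q ∈ Metric.ball (c • (1 : W →L[ℝ] W)) (c / 2), ∀ y,
      c / 2 * ‖y‖ ^ 2 ≤ ⟪y, Q y⟫ := fun Q hQ y => by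
    have h1 : |⟪y, (Q - c • 1) y⟫| ≤ ‖y‖ ^ 2 * ‖Q - c • 1‖ := by
      rw [← evalQuad_apply]
      exact ((evalQuad y).le_opNorm _).trans (by gcongr; exact norm_evalQuad_le y)
    rw [sub_apply, inner_sub_right, hone] at h1
    rw [mem_ball_iff_norm] at hQ
    nlinarith [abs_le.1 h1, sq_nonneg ‖y‖]
  -- The kernel is at most `exp(-(c/4) ‖y‖²)`. One half of this exponent absorbs the factor `‖y‖²`
  -- from the derivative; the other half makes `f` integrable.
  have hbound : ∀ y : W, ∀ Q ∈ Metric.ball (c • (1 : W →L[ℝ] W)) (c / 2),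
      ‖F' Q y‖ ≤ (4 / c) * ‖Real.exp (-(c / 8) * ‖y‖ ^ 2) * f y‖ := fun y Q hQ => by
    rw [hF']
    simp only [F, norm_smul, norm_mul, Real.norm_eq_abs, Real.abs_exp]
    have h1 : |(-(1 / 2) : ℝ)| = 1 / 2 := by norm_num
    have h2 : c / 8 * ‖y‖ ^ 2 ≤ Real.exp (c / 8 * ‖y‖ ^ 2) :=
      (by linarith [Real.add_one_le_exp (c / 8 * ‖y‖ ^ 2)])
    have h3 : Real.exp (-(1 / 2) * ⟪y, Q y⟫) ≤
        Real.exp (-(c / 8) * ‖y‖ ^ 2) * Real.exp (-(c / 8 * ‖y‖ ^ 2)) := by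
      rw [← Real.exp_add]
      gcongr
      linarith [hlow Q hQ y]
    have h4 : ‖y‖ ^ 2 * Real.exp (-(c / 8 * ‖y‖ ^ 2)) ≤ 8 / c := by
      rw [Real.exp_neg, ← div_eq_mul_inv, div_le_div_iff₀ (Real.exp_pos _) hc]
      linarith
    rw [h1]
    calc 1 / 2 * (Real.exp (-(1 / 2) * ⟪y, Q y⟫) * |f y|) * ‖evalQuad y‖
        ≤ 1 / 2 * ((Real.exp (-(c / 8) * ‖y‖ ^ 2) * Real.exp (-(c / 8 * ‖y‖ ^ 2))) * |f y|) *
            ‖y‖ ^ 2 := by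
          gcongr
          exact norm_evalQuad_le y
      _ = 1 / 2 * (Real.exp (-(c / 8) * ‖y‖ ^ 2) * |f y|) *
            (‖y‖ ^ 2 * Real.exp (-(c / 8 * ‖y‖ ^ 2))) := by ring
      _ ≤ 1 / 2 * (Real.exp (-(c / 8) * ‖y‖ ^ 2) * |f y|) * (8 / c) := by gcongr
      _ = _ := by ring
  have hbi : Integrable fun y : W => (4 / c) * ‖Real.exp (-(c / 8) * ‖y‖ ^ 2) * f y‖ :=
    (hf _ (by positivity)).norm.const_mul _
  have hF'm : AEStronglyMeasurable (F' (c • 1)) (volume : Measure W) :=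
    ((hmeas _).const_mul _).aestronglyMeasurable.smul
      continuous_evalQuad.aestronglyMeasurable
  have hF'i : Integrable (F' (c • 1)) (volume : Measure W) :=
    hbi.mono' hF'm (ae_of_all _ fun y => hbound y _ (Metric.mem_ball_self (by positivity)))
  have hder := hasFDerivAt_integral_of_dominated_of_fderiv_le (𝕜 := ℝ)
    (μ := (volume : Measure W)) (F := F) (F' := F') (x₀ := c • 1)
    (Metric.ball_mem_nhds _ (by positivity : 0 < c / 2))
    (Eventually.of_forall fun Q => (hmeas Q).aestronglyMeasurable)
    (by
      have := hf (c / 2) (by positivity)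
      refine this.congr (ae_of_all _ fun y => ?_)
      simp only [F, hone]
      congr 2; ring) hF'm (ae_of_all _ hbound) hbi
    (ae_of_all _ fun y Q _ => by
      have h1 : HasFDerivAt (fun Q : W →L[ℝ] W => -(1 / 2) * ⟪y, Q y⟫)
          ((-(1 / 2) : ℝ) • evalQuad y) Q := (evalQuad y).hasFDerivAt.const_mul _
      have h2 := (h1.exp).mul_const (f y)
      have h3 : F' Q y = f y • Real.exp (-(1 / 2) * ⟪y, Q y⟫) • (-(1 / 2) : ℝ) • evalQuad y := by
        simp only [hF', F, smul_smul]
        ring_nf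
      rw [h3]
      exact h2)
  refine ⟨_, hder, fun H => ?_⟩
  rw [ContinuousLinearMap.integral_apply hF'i, gaussInt, ← integral_const_mul]
  congr 1 with y
  simp only [hF', F, smul_apply, evalQuad_apply, smul_eq_mul]
  ring

lemma gaussInt_smul_one {v : ℝ} (hv : 0 < v) (g : W → ℝ) :
    gaussInt g (v⁻¹ • 1) = √v ^ Module.finrank ℝ W * gaussNorm W *
      ∫ z, g (√v • z) ∂(stdGaussian W) := by
  have hs := Real.sqrt_pos.2 hv
  have h := Measure.integral_comp_smul_of_nonneg (volume : Measure W)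
    (fun y => Real.exp (-(1 / 2) * ⟪y, (v⁻¹ • (1 : W →L[ℝ] W)) y⟫) * g y) (√v) (hR := hs.le)
  rw [integral_stdGaussian, smul_eq_mul, mul_assoc, mul_inv_cancel_left₀ gaussNorm_pos.ne',
    gaussInt]
  have h1 : ∀ z : W, Real.exp (-(1 / 2) * ‖z‖ ^ 2) • g (√v • z) =
      Real.exp (-(1 / 2) * ⟪√v • z, (v⁻¹ • (1 : W →L[ℝ] W)) (√v • z)⟫) * g (√v • z) := fun z => by
    rw [smul_apply, one_apply_eq_self, real_inner_smul_right,
      real_inner_self_eq_norm_sq, norm_smul, mul_pow, Real.norm_eq_abs, sq_abs,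
      Real.sq_sqrt hv.le, inv_mul_cancel_left₀ hv.ne', smul_eq_mul]
  simp_rw [h1]
  rw [h, smul_eq_mul, mul_inv_cancel_left₀ (by positivity)]

/-- The derivative, in the covariance operator and at a multiple of the identity, of the mean of
a positively homogeneous function under a centered Gaussian. -/
lemma hasFDerivAt_gaussInt_div {f : W → ℝ} (hm : Measurable f)
    (hf : Integrable f (stdGaussian W)) (hh : ∀ a : ℝ, 0 < a → ∀ y, f (a • y) = f y)
    {v : ℝ} (hv : 0 < v) :
    ∃ L : (W →L[ℝ] W) →L[ℝ] ℝ,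
      HasFDerivAt (fun C : W →L[ℝ] W =>
        gaussInt f (Ring.inverse C) / gaussInt (fun _ => 1) (Ring.inverse C)) L (v • 1) ∧
      ∀ H, L H = (2 * v)⁻¹ * ((∫ z, f z * ⟪z, H z⟫ ∂(stdGaussian W)) -
        (∫ z, f z ∂(stdGaussian W)) * ∫ z, ⟪z, H z⟫ ∂(stdGaussian W)) := by
  have hs := Real.sqrt_pos.2 hv
  obtain ⟨L1, hL1, hL1'⟩ := hasFDerivAt_gaussInt hm
    (fun c hc => integrable_exp_mul_of_homogeneous hf hh hc) (inv_pos.2 hv)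
  obtain ⟨L2, hL2, hL2'⟩ := hasFDerivAt_gaussInt (W := W) (f := fun _ => 1) measurable_const
    (fun c hc => by simpa using integrable_exp_neg_mul_norm_sq hc) (inv_pos.2 hv)
  -- The covariance `v • 1` as a unit, where inversion has derivative `H ↦ -v⁻² H`.
  let u : (W →L[ℝ] W)ˣ := ⟨v • 1, v⁻¹ • 1, by
    rw [smul_mul_smul_comm, mul_inv_cancel₀ hv.ne', one_smul, one_mul], by
    rw [smul_mul_smul_comm, inv_mul_cancel₀ hv.ne', one_smul, one_mul]⟩
  have hinv := hasFDerivAt_ringInverse (𝕜 := ℝ) u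
  have hval : Ring.inverse (v • (1 : W →L[ℝ] W)) = v⁻¹ • 1 := Ring.inverse_unit u
  have hinv' : HasFDerivAt (Ring.inverse : (W →L[ℝ] W) → (W →L[ℝ] W)) _ (v • 1) := hinv
  rw [← hval] at hL1 hL2
  have h1 := hL1.comp (v • (1 : W →L[ℝ] W)) hinv'
  have h2 := hL2.comp (v • (1 : W →L[ℝ] W)) hinv'
  have hK : 0 < √v ^ Module.finrank ℝ W * gaussNorm W := mul_pos (by positivity) gaussNorm_pos
  set K := √v ^ Module.finrank ℝ W * gaussNorm W
  have e2 : gaussInt (fun _ : W => (1 : ℝ)) (v⁻¹ • 1) = K := by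
    rw [gaussInt_smul_one hv]; simp [K]
  have e1 : gaussInt f (v⁻¹ • 1) = K * ∫ z, f z ∂(stdGaussian W) := by
    rw [gaussInt_smul_one hv]; simp_rw [hh _ hs]; rfl
  have hne : gaussInt (fun _ : W => (1 : ℝ)) (Ring.inverse (v • 1)) ≠ 0 := by
    rw [hval, e2]; exact hK.ne'
  have h3 := (hasDerivAt_inv hne).comp_hasFDerivAt (v • (1 : W →L[ℝ] W)) h2
  refine ⟨_, h1.mul h3, fun H => ?_⟩
  -- Substituting `y = √v z` cancels one of the two factors `v⁻¹` from the derivative of inversion.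
  have hq : ∀ z : W, ⟪√v • z, (-(v⁻¹ • (1 : W →L[ℝ] W)) * H * (v⁻¹ • (1 : W →L[ℝ] W))) (√v • z)⟫ =
      -v⁻¹ * ⟪z, H z⟫ := fun z => by
    simp only [mul_apply_eq_comp, neg_apply,
      smul_apply, one_apply_eq_self, map_smul, inner_neg_right,
      real_inner_smul_right, real_inner_smul_left]
    have : √v * √v = v := Real.mul_self_sqrt hv.le
    field_simp
    rw [sq, this]
  have d1 : L1 (-(v⁻¹ • (1 : W →L[ℝ] W)) * H * (v⁻¹ • 1)) =
      K * (2 * v)⁻¹ * ∫ z, f z * ⟪z, H z⟫ ∂(stdGaussian W) := by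
    rw [hL1', gaussInt_smul_one hv]
    simp_rw [hq, hh _ hs]
    rw [← integral_const_mul, ← integral_const_mul, ← integral_const_mul]
    congr 1 with z
    simp only [K, mul_inv]
    ring
  have d2 : L2 (-(v⁻¹ • (1 : W →L[ℝ] W)) * H * (v⁻¹ • 1)) =
      K * (2 * v)⁻¹ * ∫ z, ⟪z, H z⟫ ∂(stdGaussian W) := by
    rw [hL2', gaussInt_smul_one hv]
    simp_rw [hq, one_mul]
    rw [← integral_const_mul, ← integral_const_mul, ← integral_const_mul]
    congr 1 with z
    simp only [K, mul_inv]
    ring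
  have hH : (-ContinuousLinearMap.mulLeftRight ℝ (W →L[ℝ] W) ↑u⁻¹ ↑u⁻¹) H =
      -(v⁻¹ • (1 : W →L[ℝ] W)) * H * (v⁻¹ • 1) := by
    rw [neg_apply, ContinuousLinearMap.mulLeftRight_apply, neg_mul, neg_mul]
    rfl
  simp only [smul_apply, add_apply,
    ContinuousLinearMap.comp_apply, hH, d1, d2, smul_eq_mul, Function.comp_apply, hval, e1, e2]
  field_simp
  ring

end Density

/-! ### Several batches -/

section Batches

open scoped RealInnerProductSpace

variable {k B : ℕ}

/-- Tuples of centered batches. -/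
abbrev Batches (k B : ℕ) := PiLp 2 fun _ : Fin k => Hyp B

/-- The centering of each batch. -/
def centerBatches (hB : 4 ≤ B) : Preact k B →L[ℝ] Batches k B :=
  LinearMap.toContinuousLinearMap
    { toFun := fun h => WithLp.toLp 2 fun i => centerBatch hB (WithLp.toLp 2 fun p => h (i, p))
      map_add' := fun x y => by
        ext i : 1
        exact map_add (centerBatch hB) (WithLp.toLp 2 fun p => x (i, p))
          (WithLp.toLp 2 fun p => y (i, p))
      map_smul' := fun c x => by
        ext i : 1
        exact map_smul (centerBatch hB) c (WithLp.toLp 2 fun p => x (i, p)) }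

lemma centerBatches_apply (hB : 4 ≤ B) (h : Preact k B) (i : Fin k) :
    centerBatches hB h i = centerBatch hB (WithLp.toLp 2 fun p => h (i, p)) := rfl

lemma adjoint_centerBatches_apply (hB : 4 ≤ B) (w : Batches k B) (r : Fin k × Fin B) :
    (centerBatches hB).adjoint w r = (w r.1 : Batch B) r.2 := by
  have h1 : (centerBatches hB).adjoint w = WithLp.toLp 2 fun r => (w r.1 : Batch B) r.2 := by
    refine ext_inner_left ℝ fun x => ?_
    rw [ContinuousLinearMap.adjoint_inner_right, PiLp.inner_apply, PiLp.inner_apply,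
      Fintype.sum_prod_type]
    refine Finset.sum_congr rfl fun i _ => ?_
    rw [centerBatches_apply, inner_centerBatch, PiLp.inner_apply]
  rw [h1]

lemma multiBatchNorm_eq (hB : 4 ≤ B) (φ : ℝ → ℝ) (h : Preact k B) (r : Fin k × Fin B) :
    multiBatchNorm φ h r =
      rescale B φ ⟪unitVec hB r.2, dir (centerBatches hB h r.1)⟫ :=
  batchNorm_eq hB φ (WithLp.toLp 2 fun p => h (r.1, p)) r.2

/-- The covariance operator of the centered batches, for preactivations of covariance `T`. -/
def covOp (hB : 4 ≤ B) (T : BlockMat k B) : Batches k B →L[ℝ] Batches k B :=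
  centerBatches hB ∘L Matrix.toEuclideanCLM (𝕜 := ℝ) T ∘L (centerBatches hB).adjoint

lemma inner_covOp (hB : 4 ≤ B) (T : BlockMat k B) (w : Batches k B) :
    ⟪w, covOp hB T w⟫ = ∑ r : Fin k × Fin B, ∑ s : Fin k × Fin B,
      T r s * ((w r.1 : Batch B) r.2 * (w s.1 : Batch B) s.2) := by
  rw [covOp, ContinuousLinearMap.comp_apply, ← ContinuousLinearMap.adjoint_inner_left,
    ContinuousLinearMap.comp_apply, Matrix.inner_toEuclideanCLM, dotProduct]
  refine Finset.sum_congr rfl fun r _ => ?_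
  rw [Matrix.mulVec, dotProduct, Finset.mul_sum]
  refine Finset.sum_congr rfl fun s _ => ?_
  simp only [adjoint_centerBatches_apply]
  ring

lemma covOp_add (hB : 4 ≤ B) (T U : BlockMat k B) :
    covOp hB (T + U) = covOp hB T + covOp hB U := by
  simp only [covOp, map_add, ContinuousLinearMap.add_comp, ContinuousLinearMap.comp_add]

lemma covOp_smul (hB : 4 ≤ B) (c : ℝ) (T : BlockMat k B) :
    covOp hB (c • T) = c • covOp hB T := by
  simp only [covOp, map_smul, ContinuousLinearMap.smul_comp, ContinuousLinearMap.comp_smul]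

lemma isPositive_covOp (hB : 4 ≤ B) {T : BlockMat k B} (hT : T.PosSemidef) :
    (covOp hB T).IsPositive := by
  have h1 : (Matrix.toEuclideanCLM (𝕜 := ℝ) T).IsPositive := by
    rw [← ContinuousLinearMap.isPositive_toLinearMap_iff]
    exact Matrix.isPositive_toEuclideanLin_iff.2 hT
  exact h1.conj_adjoint (centerBatches hB)

lemma charFun_map_centerBatches (hB : 4 ≤ B) {T : BlockMat k B} (hT : T.PosSemidef)
    (t : Batches k B) :
    charFun ((multivariateGaussian 0 T).map (centerBatches hB)) t =
      Complex.exp (-(⟪t, covOp hB T t⟫ : ℝ) / 2) := by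
  rw [charFun_map_continuousLinearMap, charFun_multivariateGaussian hT, covOp,
    ContinuousLinearMap.comp_apply, ← ContinuousLinearMap.adjoint_inner_left,
    ContinuousLinearMap.comp_apply, Matrix.inner_toEuclideanCLM]
  congr 1
  simp
  ring

/-- A block matrix of the form of a cross-batch fixed point is a scalar on centered batches. -/
lemma covOp_of_cbsb1 (hB : 4 ≤ B) {S : BlockMat k B} {a b c : ℝ}
    (h : ∀ i j p q, S (i, p) (j, q) = if i = j then (if p = q then a else b) else c) :
    covOp hB S = (a - b) • 1 := by
  refine ContinuousLinearMap.ext fun w => ?_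
  ext i : 1
  have h1 : ∀ i p, (Matrix.toEuclideanCLM (𝕜 := ℝ) S ((centerBatches hB).adjoint w)) (i, p) =
      (a - b) * (w i : Batch B) p := fun i p => by
    rw [Matrix.ofLp_toEuclideanCLM, Matrix.mulVec, dotProduct, Fintype.sum_prod_type]
    simp only [adjoint_centerBatches_apply, h]
    -- The constants `b` and `c` multiply the coordinate sum of a centred batch, which is zero.
    have h2 : ∀ j, ∑ q, (if i = j then (if p = q then a else b) else c) * (w j : Batch B) q =
        if i = j then (a - b) * (w i : Batch B) p else 0 := fun j => by
      have h0 := mem_hyp_iff.1 (w j).2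
      split_ifs with hij
      · subst hij
        have h3 : ∀ q, (if p = q then a else b) * (w i : Batch B) q =
            (if p = q then (a - b) * (w i : Batch B) q else 0) + b * (w i : Batch B) q :=
          fun q => by split_ifs <;> ring
        simp_rw [h3]
        rw [Finset.sum_add_distrib, ← Finset.mul_sum, h0]
        simp
      · rw [← Finset.mul_sum, h0, mul_zero]
    simp_rw [h2]
    simp
  rw [covOp, ContinuousLinearMap.comp_apply, ContinuousLinearMap.comp_apply, centerBatches_apply]
  simp_rw [h1]
  refine Eq.trans ?_ ((map_smul (centerBatch hB) (a - b) (w i : Batch B)).trans ?_)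
  · rfl
  · rw [centerBatch_coe]; rfl

end Batches

/-! ### Independence of the batches -/

section Independence

open scoped RealInnerProductSpace

variable {k B : ℕ}

lemma measurable_batch (i : Fin k) : Measurable fun w : Batches k B => w i := by fun_prop

lemma map_batch (i : Fin k) :
    (stdGaussian (Batches k B)).map (fun w => w i) = stdGaussian (Hyp B) := by
  refine stdGaussian_map_of_norm_adjoint
    (PiLp.proj 2 (fun _ : Fin k => Hyp B) i : Batches k B →L[ℝ] Hyp B) fun t => ?_
  have h1 : (PiLp.proj 2 (fun _ : Fin k => Hyp B) i : Batches k B →L[ℝ] Hyp B).adjoint t =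
      PiLp.single 2 i t := by
    refine ext_inner_left ℝ fun w => ?_
    rw [ContinuousLinearMap.adjoint_inner_right, PiLp.inner_apply, PiLp.proj_apply,
      Finset.sum_eq_single i (fun j _ hj => by rw [PiLp.single_eq_of_ne 2 hj, inner_zero_right])
        (by simp), PiLp.single_eq_same]
  rw [h1, PiLp.norm_single]

/-- The joint characteristic function factors, because the squared norm of a vector supported on two
batches is the sum of their squared norms. -/
lemma indepFun_batch {i j : Fin k} (hij : i ≠ j) :
    IndepFun (fun w : Batches k B => w i) (fun w => w j) (stdGaussian (Batches k B)) := by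
  rw [indepFun_iff_charFun_prod (by fun_prop) (by fun_prop)]
  intro t
  rw [map_batch, map_batch, charFun_apply, integral_map (by fun_prop) (by fun_prop)]
  set u : Batches k B := PiLp.single 2 i t.ofLp.1 + PiLp.single 2 j t.ofLp.2 with hu
  have hsum : ∀ w : Batches k B, ⟪w, u⟫ = ⟪w i, t.ofLp.1⟫ + ⟪w j, t.ofLp.2⟫ := fun w => by
    rw [hu, inner_add_right, PiLp.inner_apply, PiLp.inner_apply,
      Finset.sum_eq_single i (fun l _ hl => by rw [PiLp.single_eq_of_ne 2 hl, inner_zero_right])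
        (by simp), PiLp.single_eq_same,
      Finset.sum_eq_single j (fun l _ hl => by rw [PiLp.single_eq_of_ne 2 hl, inner_zero_right])
        (by simp), PiLp.single_eq_same]
  have h1 : ∀ w : Batches k B, ⟪WithLp.toLp 2 (w i, w j), t⟫ = ⟪w, u⟫ := fun w => by
    rw [hsum, WithLp.prod_inner_apply]
  simp_rw [h1]
  rw [← charFun_apply, charFun_stdGaussian, charFun_stdGaussian, charFun_stdGaussian,
    ← Complex.exp_add]
  have hn : ‖u‖ ^ 2 = ‖t.ofLp.1‖ ^ 2 + ‖t.ofLp.2‖ ^ 2 := by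
    have e1 : u i = t.ofLp.1 := by
      rw [hu, PiLp.add_apply, PiLp.single_eq_same, PiLp.single_eq_of_ne 2 hij, add_zero]
    have e2 : u j = t.ofLp.2 := by
      rw [hu, PiLp.add_apply, PiLp.single_eq_same, PiLp.single_eq_of_ne 2 hij.symm, zero_add]
    rw [← real_inner_self_eq_norm_sq, hsum, e1, e2, real_inner_self_eq_norm_sq,
      real_inner_self_eq_norm_sq]
  congr 1
  rw [← Complex.ofReal_pow, hn]
  push_cast
  ring

lemma integral_batch {f : Hyp B → ℝ} (hf : Measurable f) (i : Fin k) :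
    ∫ w : Batches k B, f (w i) ∂(stdGaussian (Batches k B)) = ∫ z, f z ∂(stdGaussian (Hyp B)) := by
  rw [← map_batch (k := k) i, integral_map (by fun_prop) hf.aestronglyMeasurable]

lemma memLp_batch {f : Hyp B → ℝ} {p : ENNReal} (hf : MemLp f p (stdGaussian (Hyp B)))
    (i : Fin k) : MemLp (fun w : Batches k B => f (w i)) p (stdGaussian (Batches k B)) := by
  rw [← map_batch (k := k) i] at hf
  exact hf.comp_of_map (by fun_prop)

lemma integrable_batch {f : Hyp B → ℝ} (hf : Integrable f (stdGaussian (Hyp B))) (i : Fin k) :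
    Integrable (fun w : Batches k B => f (w i)) (stdGaussian (Batches k B)) := by
  rw [← memLp_one_iff_integrable] at hf ⊢
  exact memLp_batch hf i

lemma integral_batch_mul_batch {f g : Hyp B → ℝ} (hf : Measurable f) (hg : Measurable g)
    {i j : Fin k} (hij : i ≠ j) :
    ∫ w : Batches k B, f (w i) * g (w j) ∂(stdGaussian (Batches k B)) =
      (∫ z, f z ∂(stdGaussian (Hyp B))) * ∫ z, g z ∂(stdGaussian (Hyp B)) := by
  rw [(indepFun_batch (B := B) hij).integral_fun_comp_mul_comp (by fun_prop) (by fun_prop)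
    hf.aestronglyMeasurable hg.aestronglyMeasurable, integral_batch hf, integral_batch hg]

lemma integrable_batch_mul_batch {f g : Hyp B → ℝ} (hf : Measurable f) (hg : Measurable g)
    (hfi : Integrable f (stdGaussian (Hyp B))) (hgi : Integrable g (stdGaussian (Hyp B)))
    {i j : Fin k} (hij : i ≠ j) :
    Integrable (fun w : Batches k B => f (w i) * g (w j)) (stdGaussian (Batches k B)) :=
  ((indepFun_batch (B := B) hij).comp hf hg).integrable_mul (integrable_batch hfi i)
    (integrable_batch hgi j)

/-- The sign flip of one batch. -/
def flipBatch (i : Fin k) : Batches k B ≃ₗᵢ[ℝ] Batches k B :=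
  LinearIsometryEquiv.piLpCongrRight 2 fun j =>
    if j = i then LinearIsometryEquiv.neg ℝ else LinearIsometryEquiv.refl ℝ _

lemma flipBatch_self (i : Fin k) (w : Batches k B) : flipBatch i w i = -w i := by
  simp [flipBatch]

lemma flipBatch_of_ne {i j : Fin k} (h : j ≠ i) (w : Batches k B) : flipBatch i w j = w j := by
  simp [flipBatch, h]

lemma integral_eq_zero_of_flipBatch (i : Fin k) {f : Batches k B → ℝ}
    (hf : ∀ w, f (flipBatch i w) = -f w) : ∫ w, f w ∂(stdGaussian (Batches k B)) = 0 := by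
  have h := integral_stdGaussian_comp (flipBatch i) f
  simp_rw [hf] at h
  rw [integral_neg] at h
  linarith

/-- A coordinate of the batch-normalized tuple, as a function of the centered batches. -/
def coordFun (hB : 4 ≤ B) (ψ : ℝ → ℝ) (r : Fin k × Fin B) (w : Batches k B) : ℝ :=
  ψ ⟪unitVec hB r.2, dir (w r.1)⟫

lemma measurable_coordFun (hB : 4 ≤ B) {ψ : ℝ → ℝ} (hψ : Measurable ψ) (r : Fin k × Fin B) :
    Measurable (coordFun hB ψ r) :=
  hψ.comp ((measurable_inner_dir _).comp (measurable_batch _))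

lemma memLp_coordFun (hB : 4 ≤ B) {ψ : ℝ → ℝ} (hψ : MemLp ψ 2 (gegProb B))
    (r : Fin k × Fin B) : MemLp (coordFun hB ψ r) 2 (stdGaussian (Batches k B)) :=
  memLp_batch (memLp_coord hB hψ r.2) r.1

lemma coordFun_smul (hB : 4 ≤ B) (ψ : ℝ → ℝ) (r : Fin k × Fin B) {a : ℝ} (ha : 0 < a)
    (w : Batches k B) : coordFun hB ψ r (a • w) = coordFun hB ψ r w := by
  rw [coordFun, coordFun, PiLp.smul_apply, dir_smul ha]

/-- The mean of the product of a normalized coordinate and a coordinate of the centered batch is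
`linCoeff` times an entry of the centering matrix. -/
def linCoeff (B : ℕ) (ψ : ℝ → ℝ) : ℝ := (coordNorm B)⁻¹ * meanNorm (Hyp B) * firstMoment B ψ

/-- The mean norm brings `(B - 1) * idRate B`, and the length of the centred coordinate vectors
turns `B - 1` into `B`. -/
lemma linCoeff_sq (hB : 4 ≤ B) (ψ : ℝ → ℝ) :
    linCoeff B ψ ^ 2 = B * idRate B * firstMoment B ψ ^ 2 := by
  have hB' : (4 : ℝ) ≤ B := by exact_mod_cast hB
  rw [linCoeff, mul_pow, mul_pow, inv_pow, coordNorm_sq hB, meanNorm_sq hB (finrank_hyp hB)]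
  have h1 : (B : ℝ) - 1 ≠ 0 := by linarith
  field_simp

lemma integral_coord_mul (hB : 4 ≤ B) {ψ : ℝ → ℝ} (hm : Measurable ψ)
    (hψ : Integrable ψ (gegProb B)) (p q : Fin B) :
    ∫ z : Hyp B, ψ ⟪unitVec hB p, dir z⟫ * (z : Batch B) q ∂(stdGaussian (Hyp B)) =
      linCoeff B ψ * centering B p q := by
  simp_rw [← inner_coordVec hB]
  rw [integral_mul_inner hB (finrank_hyp hB) (norm_unitVec hB p) hm hψ, inner_unitVec_coordVec,
    linCoeff]
  ring

end Independence

/-! ### The derivative of the forward dynamics -/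

section ForwardDerivative

open scoped RealInnerProductSpace

variable {k B : ℕ}

/-- Half of the Gaussian exponent absorbs the quadratic growth of `g`; the other half is again a
Gaussian weight, for which homogeneity of `f` gives integrability. -/
lemma integrable_mul_of_homogeneous {W : Type*} [NormedAddCommGroup W] [InnerProductSpace ℝ W]
    [FiniteDimensional ℝ W] [MeasurableSpace W] [BorelSpace W] {f g : W → ℝ}
    (hf : Integrable f (stdGaussian W)) (hh : ∀ a : ℝ, 0 < a → ∀ y, f (a • y) = f y)
    (hg : Continuous g) {K : ℝ} (hgK : ∀ z, |g z| ≤ K * ‖z‖ ^ 2) :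
    Integrable (fun z => f z * g z) (stdGaussian W) := by
  rw [integrable_stdGaussian_iff]
  have h1 := (integrable_exp_mul_of_homogeneous hf hh (by norm_num : (0 : ℝ) < 1 / 4))
  refine (h1.norm.const_mul (4 * |K|)).mono' ?_ (ae_of_all _ fun z => ?_)
  · have h2 : AEStronglyMeasurable (fun z : W => Real.exp (1 / 4 * ‖z‖ ^ 2) *
        (Real.exp (-(1 / 4) * ‖z‖ ^ 2) * f z)) volume :=
      (Continuous.aestronglyMeasurable (by fun_prop)).mul h1.aestronglyMeasurable
    have h3 : f = fun z : W => Real.exp (1 / 4 * ‖z‖ ^ 2) *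
        (Real.exp (-(1 / 4) * ‖z‖ ^ 2) * f z) := by
      ext z
      rw [← mul_assoc, ← Real.exp_add]
      ring_nf
      simp
    rw [← h3] at h2
    have h4 : Continuous fun z : W => Real.exp (-(1 / 2) * ‖z‖ ^ 2) := by fun_prop
    exact h4.aestronglyMeasurable.smul (h2.mul hg.aestronglyMeasurable)
  · rw [smul_eq_mul, norm_mul, norm_mul, norm_mul, Real.norm_of_nonneg (Real.exp_pos _).le,
      Real.norm_of_nonneg (Real.exp_pos _).le, Real.norm_eq_abs, Real.norm_eq_abs]
    have e1 : Real.exp (-(1 / 2) * ‖z‖ ^ 2) =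
        Real.exp (-(1 / 4) * ‖z‖ ^ 2) * Real.exp (-(1 / 4 * ‖z‖ ^ 2)) := by
      rw [← Real.exp_add]; ring_nf
    have e2 : ‖z‖ ^ 2 * Real.exp (-(1 / 4 * ‖z‖ ^ 2)) ≤ 4 := by
      rw [Real.exp_neg, ← div_eq_mul_inv, div_le_iff₀ (Real.exp_pos _)]
      linarith [Real.add_one_le_exp (1 / 4 * ‖z‖ ^ 2)]
    have e3 : |g z| ≤ |K| * ‖z‖ ^ 2 := (hgK z).trans (by gcongr; exact le_abs_self K)
    rw [e1]
    calc _ ≤ Real.exp (-(1 / 4) * ‖z‖ ^ 2) * Real.exp (-(1 / 4 * ‖z‖ ^ 2)) *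
          (|f z| * (|K| * ‖z‖ ^ 2)) := by gcongr
      _ = |K| * (Real.exp (-(1 / 4) * ‖z‖ ^ 2) * |f z|) *
          (‖z‖ ^ 2 * Real.exp (-(1 / 4 * ‖z‖ ^ 2))) := by ring
      _ ≤ |K| * (Real.exp (-(1 / 4) * ‖z‖ ^ 2) * |f z|) * 4 := by gcongr
      _ = _ := by ring

lemma abs_coord_le (w : Batches k B) (r : Fin k × Fin B) :
    |(w r.1 : Batch B) r.2| ≤ ‖w‖ :=
  (PiLp.norm_apply_le (w r.1 : Batch B) r.2).trans (PiLp.norm_apply_le w r.1)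

lemma integrable_coordFun_mul (hB : 4 ≤ B) {ψ : ℝ → ℝ} (hψ : MemLp ψ 2 (gegProb B))
    (r s r' s' : Fin k × Fin B) :
    Integrable (fun w : Batches k B => coordFun hB ψ r w * coordFun hB ψ s w *
      ((w r'.1 : Batch B) r'.2 * (w s'.1 : Batch B) s'.2)) (stdGaussian (Batches k B)) := by
  refine integrable_mul_of_homogeneous
    ((memLp_coordFun hB hψ r).integrable_mul (memLp_coordFun hB hψ s))
    (fun a ha w => by simp only [coordFun_smul hB ψ _ ha]) (by fun_prop)
    (K := 1) fun w => ?_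
  rw [abs_mul, one_mul, sq]
  exact mul_le_mul (abs_coord_le w r') (abs_coord_le w s') (abs_nonneg _) (norm_nonneg _)

/-- Mixed moments of two normalized coordinates and two coordinates of distinct batches. -/
lemma integral_coordFun_mul (hB : 4 ≤ B) {ψ : ℝ → ℝ} (hm : Measurable ψ)
    (hψ : MemLp ψ 2 (gegProb B)) (r s r' s' : Fin k × Fin B) (h' : r'.1 ≠ s'.1) :
    ∫ w : Batches k B, coordFun hB ψ r w * coordFun hB ψ s w *
      ((w r'.1 : Batch B) r'.2 * (w s'.1 : Batch B) s'.2) ∂(stdGaussian (Batches k B)) =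
    linCoeff B ψ ^ 2 * (((1 : Matrix (Fin k) (Fin k) ℝ) ⊗ₖ centering B) r r' *
        ((1 : Matrix (Fin k) (Fin k) ℝ) ⊗ₖ centering B) s' s +
      ((1 : Matrix (Fin k) (Fin k) ℝ) ⊗ₖ centering B) r s' *
        ((1 : Matrix (Fin k) (Fin k) ℝ) ⊗ₖ centering B) r' s) := by
  have hψ1 := integrable_gegProb_of_memLp hB hψ
  have hsymm : ∀ p q, centering B p q = centering B q p := fun p q => by
    rw [centering_apply, centering_apply]
    simp only [eq_comm]
  have hmeas : ∀ p q : Fin B, Measurable fun z : Hyp B =>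
      ψ ⟪unitVec hB p, dir z⟫ * (z : Batch B) q := fun p q => by
    have h1 := hm.comp (measurable_inner_dir (unitVec hB p))
    exact h1.mul (by fun_prop)
  -- When the two normalized coordinates lie in the two distinct batches of the linear factors, the
  -- mean splits into two first moments.
  have hprod : ∀ r s r' s' : Fin k × Fin B, r'.1 ≠ s'.1 → r.1 = r'.1 → s.1 = s'.1 →
      ∫ w : Batches k B, coordFun hB ψ r w * coordFun hB ψ s w *
        ((w r'.1 : Batch B) r'.2 * (w s'.1 : Batch B) s'.2) ∂(stdGaussian (Batches k B)) =
      linCoeff B ψ ^ 2 * (centering B r.2 r'.2 * centering B s'.2 s.2) := by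
    intro r s r' s' h' h1 h2
    have h := integral_batch_mul_batch (hmeas r.2 r'.2) (hmeas s.2 s'.2) h'
    rw [integral_coord_mul hB hm hψ1, integral_coord_mul hB hm hψ1, hsymm s.2] at h
    refine Eq.trans ?_ (h.trans (by ring))
    congr 1 with w
    rw [coordFun, coordFun, h1, h2]
    ring
  -- If neither normalized coordinate lies in the batch of `r'`, flipping that batch changes the
  -- sign of the integrand.
  have hzero : ∀ r' s' : Fin k × Fin B, r'.1 ≠ s'.1 → r.1 ≠ r'.1 → s.1 ≠ r'.1 →
      ∫ w : Batches k B, coordFun hB ψ r w * coordFun hB ψ s w *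
        ((w r'.1 : Batch B) r'.2 * (w s'.1 : Batch B) s'.2) ∂(stdGaussian (Batches k B)) = 0 := by
    intro r' s' h' h1 h2
    refine integral_eq_zero_of_flipBatch r'.1 fun w => ?_
    rw [coordFun, coordFun, coordFun, coordFun, flipBatch_of_ne h1, flipBatch_of_ne h2,
      flipBatch_self, flipBatch_of_ne h'.symm]
    simp
  simp only [Matrix.kroneckerMap_apply, Matrix.one_apply]
  by_cases h1 : r.1 = r'.1
  · have h3 : r.1 ≠ s'.1 := fun h => h' (h1.symm.trans h)
    by_cases h2 : s'.1 = s.1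
    · rw [hprod r s r' s' h' h1 h2.symm, if_pos h1, if_pos h2, if_neg h3]
      ring
    · have h4 := hzero s' r' h'.symm h3 (Ne.symm h2)
      simp_rw [mul_comm ((_ : Batch B) s'.2) ((_ : Batch B) r'.2)] at h4
      rw [h4, if_neg h2, if_neg h3]
      ring
  · by_cases h2 : r'.1 = s.1
    · have h3 : s'.1 ≠ s.1 := fun h => h' (h2.trans h.symm)
      by_cases h4 : r.1 = s'.1
      · have h5 := hprod r s s' r' h'.symm h4 h2.symm
        simp_rw [mul_comm ((_ : Batch B) s'.2) ((_ : Batch B) r'.2)] at h5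
        rw [h5, if_neg h1, if_pos h4, if_pos h2]
        ring
      · have h5 := hzero s' r' h'.symm h4 (Ne.symm h3)
        simp_rw [mul_comm ((_ : Batch B) s'.2) ((_ : Batch B) r'.2)] at h5
        rw [h5, if_neg h1, if_neg h4]
        ring
    · rw [hzero r' s' h' h1 (Ne.symm h2), if_neg h1, if_neg h2]
      ring

/-- Expand the quadratic form. The two ways to match the batches contribute equally since `M` is
symmetric, hence the `2`; pairs within one batch drop out because there `M` vanishes. -/
lemma integral_coordFun_mul_covOp (hB : 4 ≤ B) {ψ : ℝ → ℝ} (hm : Measurable ψ)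
    (hψ : MemLp ψ 2 (gegProb B)) (r s : Fin k × Fin B) {M : BlockMat k B} (hM : M.IsSymm)
    (hM0 : ∀ i p q, M (i, p) (i, q) = 0) :
    ∫ w : Batches k B, (coordFun hB ψ r w * coordFun hB ψ s w) * ⟪w, covOp hB M w⟫
      ∂(stdGaussian (Batches k B)) = 2 * linCoeff B ψ ^ 2 * blockCenter M r s := by
  have h1 : ∀ w : Batches k B, (coordFun hB ψ r w * coordFun hB ψ s w) * ⟪w, covOp hB M w⟫ =
      ∑ r' : Fin k × Fin B, ∑ s' : Fin k × Fin B, M r' s' *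
        (coordFun hB ψ r w * coordFun hB ψ s w *
          ((w r'.1 : Batch B) r'.2 * (w s'.1 : Batch B) s'.2)) := fun w => by
    rw [inner_covOp, Finset.mul_sum]
    refine Finset.sum_congr rfl fun r' _ => ?_
    rw [Finset.mul_sum]
    exact Finset.sum_congr rfl fun s' _ => by ring
  simp_rw [h1]
  have hi := fun r' s' => (integrable_coordFun_mul hB hψ r s r' s').const_mul (M r' s')
  rw [integral_finsetSum _ fun r' _ => integrable_finsetSum _ fun s' _ => hi r' s']
  simp_rw [fun r' => integral_finsetSum _ fun s' (_ : s' ∈ Finset.univ) => hi r' s',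
    integral_const_mul]
  set P := (1 : Matrix (Fin k) (Fin k) ℝ) ⊗ₖ centering B with hP
  have h2 : ∀ r' s', M r' s' * ∫ w : Batches k B, coordFun hB ψ r w * coordFun hB ψ s w *
      ((w r'.1 : Batch B) r'.2 * (w s'.1 : Batch B) s'.2) ∂(stdGaussian (Batches k B)) =
      linCoeff B ψ ^ 2 * (P r r' * M r' s' * P s' s) +
        linCoeff B ψ ^ 2 * (P r s' * M s' r' * P r' s) := fun r' s' => by
    by_cases h : r'.1 = s'.1
    · have e1 : M r' s' = 0 := by
        have := hM0 r'.1 r'.2 s'.2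
        conv at this => enter [1, 2]; rw [h]
        exact this
      rw [hM.apply r' s', e1]
      ring
    · rw [integral_coordFun_mul hB hm hψ r s r' s' h, hM.apply r' s']
      ring
  simp_rw [h2, Finset.sum_add_distrib]
  rw [Finset.sum_comm (f := fun r' s' => linCoeff B ψ ^ 2 * (P r s' * M s' r' * P r' s))]
  have h3 : blockCenter M r s = ∑ r', ∑ s', P r r' * M r' s' * P s' s := by
    rw [blockCenter, Matrix.mul_apply, Finset.sum_comm]
    simp_rw [Matrix.mul_apply, Finset.sum_mul]
    rfl
  rw [h3]
  simp_rw [Finset.mul_sum, ← Finset.sum_add_distrib]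
  exact Finset.sum_congr rfl fun r' _ => Finset.sum_congr rfl fun s' _ => by ring

set_option maxSynthPendingDepth 3

/-- The forward dynamics as Gaussian means of functions of the centered batches. -/
lemma forward_apply (hB : 4 ≤ B) {φ : ℝ → ℝ} (hm : Measurable (rescale B φ)) (T : BlockMat k B)
    (r s : Fin k × Fin B) :
    forward φ T r s = ∫ w, coordFun hB (rescale B φ) r w * coordFun hB (rescale B φ) s w
      ∂((multivariateGaussian 0 T).map (centerBatches hB)) := by
  have h1 : Measurable fun w => coordFun hB (rescale B φ) r w * coordFun hB (rescale B φ) s w :=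
    (measurable_coordFun hB hm r).mul (measurable_coordFun hB hm s)
  rw [integral_map (by fun_prop) h1.aestronglyMeasurable]
  simp only [forward, Matrix.of_apply, multiBatchNorm_eq hB]
  rfl

/-! ### Differentiation of the entries of the forward map, with an auxiliary norm on matrices. -/

section Norm

attribute [local instance] Matrix.normedAddCommGroup Matrix.normedSpace

/-- `covOp` as a continuous linear map. -/
def covOpL (hB : 4 ≤ B) : BlockMat k B →L[ℝ] Batches k B →L[ℝ] Batches k B :=
  LinearMap.toContinuousLinearMap
    { toFun := covOp hB
      map_add' := covOp_add hB
      map_smul' := covOp_smul hB }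

lemma covOpL_apply (hB : 4 ≤ B) (T : BlockMat k B) : covOpL hB T = covOp hB T := rfl

/-- Chain rule through the linear map `covOpL`. Semidefiniteness identifies the forward entry with
the quotient of Gaussian integrals, so the derivative is taken within that cone. -/
lemma hasFDerivWithinAt_forward_apply (hB : 4 ≤ B) {φ : ℝ → ℝ} (hm : Measurable (rescale B φ))
    (hφ : MemLp (rescale B φ) 2 (gegProb B)) {S : BlockMat k B} {v : ℝ} (hv : 0 < v)
    (hS : S.PosSemidef) (hcov : covOp hB S = v • 1) (r s : Fin k × Fin B) :
    ∃ L : BlockMat k B →L[ℝ] ℝ,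
      HasFDerivWithinAt (fun T => forward φ T r s) L {T : BlockMat k B | T.PosSemidef} S ∧
      ∀ M : BlockMat k B, M.IsSymm → (∀ i p q, M (i, p) (i, q) = 0) →
        L M = linCoeff B (rescale B φ) ^ 2 / v * blockCenter M r s := by
  set ψ := rescale B φ with hψ
  obtain ⟨L, hL, hL'⟩ := hasFDerivAt_gaussInt_div (W := Batches k B)
    (f := fun w => coordFun hB ψ r w * coordFun hB ψ s w)
    ((measurable_coordFun hB hm r).mul (measurable_coordFun hB hm s))
    ((memLp_coordFun hB hφ r).integrable_mul (memLp_coordFun hB hφ s))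
    (fun a ha w => by simp only [coordFun_smul hB ψ _ ha]) hv
  have hone : MemLp (fun _ => (1 : ℝ)) 2 (gegProb B) :=
    have := isProbabilityMeasure_gegProb hB
    memLp_const 1
  refine ⟨L ∘L covOpL hB, ?_, fun M hM hM0 => ?_⟩
  · rw [← hcov, ← covOpL_apply] at hL
    have h1 := hL.comp_hasFDerivWithinAt (s := {T : BlockMat k B | T.PosSemidef}) S
      (covOpL hB).hasFDerivWithinAt
    have hloc : ∀ T : BlockMat k B, T.PosSemidef → IsUnit (covOp hB T) →
        forward φ T r s =
          gaussInt (fun w => coordFun hB ψ r w * coordFun hB ψ s w) (Ring.inverse (covOp hB T)) /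
            gaussInt (fun _ => 1) (Ring.inverse (covOp hB T)) := fun T hT hu => by
      have : IsProbabilityMeasure ((multivariateGaussian 0 T).map (centerBatches hB)) :=
        Measure.isProbabilityMeasure_map (by fun_prop)
      rw [forward_apply hB hm, integral_eq_gaussInt_div (isPositive_covOp hB hT) hu
        (charFun_map_centerBatches hB hT)]
    have hunit : IsUnit (covOp hB S) := by
      rw [hcov]
      exact isUnit_one.smul (Units.mk0 v hv.ne')
    refine h1.congr_of_eventuallyEq ?_ (hloc S hS hunit)
    -- Units form an open set, so nearby covariances stay nondegenerate on centred batches, even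
    -- where `S` itself is singular.
    have hopen : ∀ᶠ T in 𝓝[{T : BlockMat k B | T.PosSemidef}] S, IsUnit (covOpL hB T) :=
      ((covOpL hB).continuous.continuousAt.eventually
        (Units.isOpen.mem_nhds hunit)).filter_mono nhdsWithin_le_nhds
    filter_upwards [hopen, self_mem_nhdsWithin] with T hT1 hT2
    exact hloc T hT2 hT1
  · rw [ContinuousLinearMap.comp_apply, hL', covOpL_apply,
      integral_coordFun_mul_covOp hB hm hφ r s hM hM0]
    -- The product-of-means part of the covariance drops out: coordinates of distinct batches are
    -- uncorrelated, and `M` has no diagonal blocks.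
    have h2 : ∫ w, ⟪w, covOp hB M w⟫ ∂(stdGaussian (Batches k B)) = 0 := by
      have h1 : ∀ w : Batches k B, ⟪w, covOp hB M w⟫ = ∑ r' : Fin k × Fin B,
          ∑ s' : Fin k × Fin B, M r' s' * ((w r'.1 : Batch B) r'.2 * (w s'.1 : Batch B) s'.2) :=
        inner_covOp hB M
      have hi : ∀ r' s' : Fin k × Fin B, Integrable (fun w : Batches k B => M r' s' *
          ((w r'.1 : Batch B) r'.2 * (w s'.1 : Batch B) s'.2)) (stdGaussian (Batches k B)) :=
        fun r' s' => by
          have := (integrable_coordFun_mul (k := k) hB hone r r r' s').const_mul (M r' s')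
          simpa only [coordFun, one_mul] using this
      simp_rw [h1]
      rw [integral_finsetSum _ fun r' _ => integrable_finsetSum _ fun s' _ => hi r' s']
      refine Finset.sum_eq_zero fun r' _ => ?_
      rw [integral_finsetSum _ fun s' _ => hi r' s']
      refine Finset.sum_eq_zero fun s' _ => ?_
      rw [integral_const_mul]
      by_cases h : r'.1 = s'.1
      · have e1 : M r' s' = 0 := by
          have := hM0 r'.1 r'.2 s'.2
          conv at this => enter [1, 2]; rw [h]
          exact this
        rw [e1, zero_mul]
      · rw [integral_eq_zero_of_flipBatch r'.1 fun w => ?_, mul_zero]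
        rw [flipBatch_self, flipBatch_of_ne (Ne.symm h)]
        simp
    rw [h2, mul_zero, sub_zero]
    field_simp

lemma hasFDerivWithinAt_of_apply {F : BlockMat k B → BlockMat k B} {s : Set (BlockMat k B)}
    {S : BlockMat k B} {L : Fin k × Fin B → Fin k × Fin B → BlockMat k B →L[ℝ] ℝ}
    (h : ∀ r t, HasFDerivWithinAt (fun T => F T r t) (L r t) s S) :
    ∃ L' : BlockMat k B →L[ℝ] BlockMat k B, HasFDerivWithinAt F L' s S ∧
      ∀ M r t, L' M r t = L r t M :=
  ⟨ContinuousLinearMap.pi fun r => ContinuousLinearMap.pi fun t => L r t,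
    hasFDerivWithinAt_pi.2 fun r => hasFDerivWithinAt_pi.2 fun t => h r t, fun _ _ _ => rfl⟩

end Norm

lemma isForwardRate_of_covOp (hB : 4 ≤ B) {φ : ℝ → ℝ} (hm : Measurable (rescale B φ))
    (hφ : MemLp (rescale B φ) 2 (gegProb B)) {S : BlockMat k B} {v : ℝ} (hv : 0 < v)
    (hS : S.PosSemidef) (hcov : covOp hB S = v • 1) :
    IsForwardRate φ S (linCoeff B (rescale B φ) ^ 2 / v) := by
  choose L hL hL' using hasFDerivWithinAt_forward_apply hB hm hφ hv hS hcov
  obtain ⟨L', h1, h2⟩ := hasFDerivWithinAt_of_apply hL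
  refine ⟨L', h1, fun M hM hM0 => ?_⟩
  ext r s
  rw [h2, hL' r s M hM hM0]
  rfl

end ForwardDerivative

/-! ### The law at a fixed point -/

section FixedPoint

open scoped RealInnerProductSpace

variable {k B : ℕ}

lemma map_centerBatches_of_covOp (hB : 4 ≤ B) {S : BlockMat k B} {v : ℝ} (hv : 0 < v)
    (hS : S.PosSemidef) (hcov : covOp hB S = v • 1) :
    (multivariateGaussian 0 S).map (centerBatches hB) =
      (stdGaussian (Batches k B)).map (√v • (1 : Batches k B →L[ℝ] Batches k B)) := by
  have h1 : IsProbabilityMeasure ((multivariateGaussian 0 S).map (centerBatches hB)) :=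
    Measure.isProbabilityMeasure_map (by fun_prop)
  have h2 : IsProbabilityMeasure ((stdGaussian (Batches k B)).map
      (√v • (1 : Batches k B →L[ℝ] Batches k B))) :=
    Measure.isProbabilityMeasure_map (by fun_prop)
  apply Measure.ext_of_charFun
  ext t
  have h3 : (√v • (1 : Batches k B →L[ℝ] Batches k B)).adjoint t = √v • t := by
    refine ext_inner_left ℝ fun w => ?_
    rw [ContinuousLinearMap.adjoint_inner_right, smul_apply, one_apply_eq_self,
      real_inner_smul_left, real_inner_smul_right]
  rw [charFun_map_centerBatches hB hS, charFun_map_continuousLinearMap, h3, charFun_stdGaussian,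
    hcov, smul_apply, one_apply_eq_self, real_inner_smul_right, real_inner_self_eq_norm_sq,
    norm_smul, Real.norm_of_nonneg (Real.sqrt_nonneg v), ← Complex.ofReal_pow, mul_pow,
    Real.sq_sqrt hv.le]

lemma integral_centerBatches (hB : 4 ≤ B) {S : BlockMat k B} {v : ℝ} (hv : 0 < v)
    (hS : S.PosSemidef) (hcov : covOp hB S = v • 1) {f : Batches k B → ℝ} (hf : Measurable f) :
    ∫ h, f (centerBatches hB h) ∂(multivariateGaussian 0 S) =
      ∫ w, f (√v • w) ∂(stdGaussian (Batches k B)) := by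
  rw [← integral_map (by fun_prop) hf.aestronglyMeasurable,
    map_centerBatches_of_covOp hB hv hS hcov, integral_map (by fun_prop) hf.aestronglyMeasurable]
  rfl

lemma integrable_centerBatches (hB : 4 ≤ B) {S : BlockMat k B} {v : ℝ} (hv : 0 < v)
    (hS : S.PosSemidef) (hcov : covOp hB S = v • 1) {f : Batches k B → ℝ}
    (hf : Measurable f) (hi : Integrable (fun w => f (√v • w)) (stdGaussian (Batches k B))) :
    Integrable (fun h => f (centerBatches hB h)) (multivariateGaussian 0 S) := by
  refine Integrable.comp_aemeasurable (f := centerBatches hB) (g := f) ?_ (by fun_prop)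
  rw [map_centerBatches_of_covOp hB hv hS hcov,
    integrable_map_measure hf.aestronglyMeasurable (by fun_prop)]
  exact hi

lemma ae_centerBatches (hB : 4 ≤ B) {S : BlockMat k B} {v : ℝ} (hv : 0 < v)
    (hS : S.PosSemidef) (hcov : covOp hB S = v • 1) {P : Hyp B → Prop}
    (hP : MeasurableSet {z | P z}) (hs : ∀ z, P z → P (√v • z))
    (h : ∀ᵐ z ∂(stdGaussian (Hyp B)), P z) (i : Fin k) :
    ∀ᵐ h ∂(multivariateGaussian 0 S), P (centerBatches hB h i) := by
  have hm : MeasurableSet {w : Batches k B | P (w i)} := measurable_batch i hP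
  have h1 : ∀ᵐ w ∂(stdGaussian (Batches k B)), P (w i) := by
    rw [← map_batch (k := k) i] at h
    exact ae_of_ae_map (by fun_prop) h
  have h2 : ∀ᵐ w ∂((stdGaussian (Batches k B)).map
      (√v • (1 : Batches k B →L[ℝ] Batches k B))), P (w i) :=
    (ae_map_iff (by fun_prop) hm).2 (h1.mono fun w hw => hs _ hw)
  rw [← map_centerBatches_of_covOp hB hv hS hcov] at h2
  exact ae_of_ae_map (f := centerBatches hB) (p := fun w => P (w i)) (by fun_prop) h2

lemma forward_of_covOp (hB : 4 ≤ B) {φ : ℝ → ℝ} (hm : Measurable (rescale B φ))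
    {S : BlockMat k B} {v : ℝ} (hv : 0 < v) (hS : S.PosSemidef) (hcov : covOp hB S = v • 1)
    (r s : Fin k × Fin B) :
    forward φ S r s = ∫ w, coordFun hB (rescale B φ) r w * coordFun hB (rescale B φ) s w
      ∂(stdGaussian (Batches k B)) := by
  have hf := (measurable_coordFun (k := k) hB hm r).mul (measurable_coordFun (k := k) hB hm s)
  have h1 := integral_centerBatches hB hv hS hcov hf
  simp only [Pi.mul_apply, coordFun_smul hB _ _ (Real.sqrt_pos.2 hv)] at h1
  rw [← h1]
  simp only [forward, Matrix.of_apply, multiBatchNorm_eq hB]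
  rfl

lemma forward_same_batch (hB : 4 ≤ B) {φ : ℝ → ℝ} (hm : Measurable (rescale B φ))
    {S : BlockMat k B} {v : ℝ} (hv : 0 < v) (hS : S.PosSemidef) (hcov : covOp hB S = v • 1)
    (i : Fin k) (p q : Fin B) :
    forward φ S (i, p) (i, q) = pairMean hB (rescale B φ) (rescale B φ) p q := by
  rw [forward_of_covOp hB hm hv hS hcov]
  exact integral_batch ((hm.comp (measurable_inner_dir (unitVec hB p))).mul
    (hm.comp (measurable_inner_dir (unitVec hB q)))) i

lemma forward_distinct_batch (hB : 4 ≤ B) {φ : ℝ → ℝ} (hm : Measurable (rescale B φ))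
    {S : BlockMat k B} {v : ℝ} (hv : 0 < v) (hS : S.PosSemidef) (hcov : covOp hB S = v • 1)
    {i j : Fin k} (hij : i ≠ j) (p q : Fin B) :
    forward φ S (i, p) (j, q) =
      (∫ x, rescale B φ x ∂(gegProb B)) * ∫ x, rescale B φ x ∂(gegProb B) := by
  rw [forward_of_covOp hB hm hv hS hcov]
  refine (integral_batch_mul_batch (hm.comp (measurable_inner_dir (unitVec hB p)))
    (hm.comp (measurable_inner_dir (unitVec hB q))) hij).trans (congrArg₂ _ ?_ ?_)
  · exact integral_comp_inner_dir hB (finrank_hyp hB) (norm_unitVec hB p) hm.aestronglyMeasurable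
  · exact integral_comp_inner_dir hB (finrank_hyp hB) (norm_unitVec hB q) hm.aestronglyMeasurable

/-- The within-batch gap of a fixed point. -/
lemma IsFixedPoint.exists_covOp (hB : 4 ≤ B) (hk : 0 < k) {φ : ℝ → ℝ}
    (hm : Measurable (rescale B φ)) {S : BlockMat k B} (hS : IsFixedPoint φ S) :
    ∃ v : ℝ, 0 < v ∧ covOp hB S = v • 1 ∧ ∀ p q : Fin B, p ≠ q →
      v = pairMean hB (rescale B φ) (rescale B φ) p p -
        pairMean hB (rescale B φ) (rescale B φ) p q := by
  obtain ⟨a, b, c, hab, h⟩ := hS.cbsb1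
  have hcov := covOp_of_cbsb1 hB h
  have hv : 0 < a - b := by
    -- Testing semidefiniteness on a unit vector in one batch gives `a - b ≥ 0`; strictness is the
    -- requirement `a ≠ b`.
    refine lt_of_le_of_ne ?_ (Ne.symm (sub_ne_zero.2 hab))
    have h1 := (isPositive_covOp hB hS.posSemidef).inner_nonneg_right
      (PiLp.single 2 ⟨0, hk⟩ (unitVec hB ⟨0, by omega⟩))
    rwa [hcov, smul_apply, one_apply_eq_self, real_inner_smul_right, real_inner_self_eq_norm_sq,
      PiLp.norm_single, norm_unitVec, one_pow, mul_one] at h1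
  refine ⟨a - b, hv, hcov, fun p q hpq => ?_⟩
  rw [← forward_same_batch hB hm hv hS.posSemidef hcov ⟨0, hk⟩,
    ← forward_same_batch hB hm hv hS.posSemidef hcov ⟨0, hk⟩, hS.fixed, h, h, if_pos rfl,
    if_pos rfl, if_pos rfl, if_neg hpq]

end FixedPoint

/-! ### The backward dynamics -/

section Backward

open scoped RealInnerProductSpace

variable {k B : ℕ}

lemma absolutelyContinuousOnInterval_comp_mul_left {f : ℝ → ℝ} {s r : ℝ} (hs : 0 < s)
    (hr : 0 < r) (hf : AbsolutelyContinuousOnInterval f (-(s * r)) (s * r)) :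
    AbsolutelyContinuousOnInterval (fun x => f (s * x)) (-r) r := by
  rw [absolutelyContinuousOnInterval_iff] at hf ⊢
  intro ε hε
  obtain ⟨δ, hδ, h⟩ := hf ε hε
  refine ⟨δ / s, by positivity, fun E hE hlen => ?_⟩
  refine h (E.1, fun i => (s * (E.2 i).1, s * (E.2 i).2)) ⟨fun i hi => ?_, fun i hi j hj hij => ?_⟩ ?_
  · obtain ⟨h1, h2⟩ := hE.1 i hi
    rw [Set.uIcc_of_le (by linarith)] at h1 h2
    rw [Set.uIcc_of_le (by nlinarith)]
    exact ⟨⟨by nlinarith [h1.1], by nlinarith [h1.2]⟩, ⟨by nlinarith [h2.1], by nlinarith [h2.2]⟩⟩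
  · have hd := Set.disjoint_left.1 (hE.2 hi hj hij)
    refine Set.disjoint_left.2 fun x hx hx' => ?_
    have key : ∀ a b : ℝ, x ∈ Set.uIoc (s * a) (s * b) → x / s ∈ Set.uIoc a b := fun a b hab => by
      rw [Set.mem_uIoc] at hab ⊢
      rw [lt_div_iff₀' hs, div_le_iff₀' hs, lt_div_iff₀' hs, div_le_iff₀' hs]
      exact hab
    exact hd (key _ _ hx) (key _ _ hx')
  · simp only [Real.dist_eq, ← mul_sub, abs_mul, abs_of_pos hs, ← Finset.mul_sum] at hlen ⊢
    rwa [lt_div_iff₀' hs] at hlen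

lemma deriv_rescale (B : ℕ) (φ : ℝ → ℝ) (x : ℝ) :
    deriv (rescale B φ) x = √((B : ℝ) - 1) * deriv φ (√((B : ℝ) - 1) * x) := by
  have := deriv_comp_mul_left (√((B : ℝ) - 1)) φ x
  rwa [smul_eq_mul] at this

lemma HasBackward.absCont_rescale (hB : 4 ≤ B) {φ : ℝ → ℝ} (h : HasBackward B φ) {r : ℝ}
    (hr : 0 < r) (hr1 : r < 1) : AbsolutelyContinuousOnInterval (rescale B φ) (-r) r := by
  have hB' : (4 : ℝ) ≤ B := by exact_mod_cast hB
  have hs : 0 < √((B : ℝ) - 1) := Real.sqrt_pos.2 (by linarith)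
  exact absolutelyContinuousOnInterval_comp_mul_left hs hr
    (h.absCont _ (by positivity) (by nlinarith))

lemma HasBackward.integrableOn_rescale {φ : ℝ → ℝ} (h : HasBackward B φ) :
    IntegrableOn (fun x => deriv (rescale B φ) x * (1 - x ^ 2) ^ (((B : ℝ) - 3) / 2))
      (Set.Ioo (-1) 1) := by
  simp_rw [deriv_rescale, mul_assoc]
  exact h.integrable.const_mul _

lemma ae_differentiableAt_gegProb (hB : 4 ≤ B) {ψ : ℝ → ℝ}
    (hac : ∀ r, 0 < r → r < 1 → AbsolutelyContinuousOnInterval ψ (-r) r) :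
    ∀ᵐ x ∂(gegProb B), DifferentiableAt ℝ ψ x := by
  rw [ae_gegProb_iff hB, ae_gegMeasure_iff]
  -- Compact intervals exhausting `(-1, 1)`; the shift by `2` keeps their radii strictly between `0`
  -- and `1`, as `hac` requires.
  have h1 : ∀ n : ℕ, ∀ᵐ x : ℝ, x ∈ Set.uIcc (-(1 - 1 / ((n : ℝ) + 2))) (1 - 1 / ((n : ℝ) + 2)) →
      DifferentiableAt ℝ ψ x := fun n => by
    refine (hac _ ?_ ?_).ae_differentiableAt
    · rw [sub_pos, div_lt_one (by positivity)]
      have : (0 : ℝ) ≤ n := by positivity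
      linarith
    · have : 0 < 1 / ((n : ℝ) + 2) := by positivity
      linarith
  filter_upwards [ae_all_iff.2 h1] with x hx hx1
  have h2 : 0 < 1 - |x| := by
    have := abs_lt.2 hx1
    linarith
  obtain ⟨n, hn⟩ := exists_nat_one_div_lt h2
  have h3 : 1 / ((n : ℝ) + 2) ≤ 1 / ((n : ℝ) + 1) :=
    one_div_le_one_div_of_le (by positivity) (by linarith)
  have h4 : |x| ≤ 1 - 1 / ((n : ℝ) + 2) := by linarith
  refine hx n ?_
  rw [Set.uIcc_of_le (by linarith [abs_nonneg x])]
  exact abs_le.1 h4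

/-- The derivative of the direction is `‖z‖⁻¹` times the projection orthogonal to it. -/
lemma hasFDerivAt_inner_dir {E : Type*} [NormedAddCommGroup E] [InnerProductSpace ℝ E]
    (u : E) {z : E} (hz : z ≠ 0) :
    HasFDerivAt (fun z => ⟪u, dir z⟫)
      (‖z‖⁻¹ • (innerSL ℝ u - ⟪u, dir z⟫ • innerSL ℝ (dir z))) z := by
  have hz' : ‖z‖ ≠ 0 := norm_ne_zero_iff.2 hz
  have h1 : HasFDerivAt (fun z : E => ‖z‖) (‖z‖⁻¹ • innerSL ℝ z) z := by
    have h := (hasStrictFDerivAt_norm_sq z).hasFDerivAt.sqrt (by positivity)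
    simp_rw [Real.sqrt_sq (norm_nonneg _)] at h
    convert h using 1
    rw [← Nat.cast_smul_eq_nsmul ℝ, smul_smul]
    congr 1
    push_cast
    field_simp
  have h2 := ((hasDerivAt_inv hz').comp_hasFDerivAt z h1).mul (innerSL ℝ u).hasFDerivAt
  have h3 : (fun z => ⟪u, dir z⟫) = fun z : E => ‖z‖⁻¹ * ⟪u, z⟫ := by
    ext z
    rw [dir, real_inner_smul_right]
  rw [h3]
  refine h2.congr_fderiv ?_
  ext x
  simp only [add_apply, sub_apply, smul_apply, innerSL_apply_apply, smul_eq_mul, dir,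
    real_inner_smul_left, real_inner_smul_right, Function.comp_apply]
  field_simp
  ring

/-- The derivative of the `p`-th normalized coordinate of a batch along the `q`-th coordinate. -/
def gradFun (hB : 4 ≤ B) (ψ : ℝ → ℝ) (p q : Fin B) (z : Hyp B) : ℝ :=
  ‖z‖⁻¹ * (deriv ψ ⟪unitVec hB p, dir z⟫ *
    (⟪unitVec hB p, coordVec hB q⟫ - ⟪unitVec hB p, dir z⟫ * ⟪coordVec hB q, dir z⟫))

lemma measurable_gradFun (hB : 4 ≤ B) (ψ : ℝ → ℝ) (p q : Fin B) :
    Measurable (gradFun hB ψ p q) := by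
  have h1 := measurable_inner_dir (unitVec hB p)
  have h2 := measurable_inner_dir (coordVec hB q)
  have h3 := (measurable_deriv ψ).comp h1
  exact measurable_norm.inv.mul (h3.mul (measurable_const.sub (h1.mul h2)))

lemma gradFun_smul (hB : 4 ≤ B) (ψ : ℝ → ℝ) (p q : Fin B) {a : ℝ} (ha : 0 < a) (z : Hyp B) :
    gradFun hB ψ p q (a • z) = a⁻¹ * gradFun hB ψ p q z := by
  rw [gradFun, gradFun, dir_smul ha, norm_smul, Real.norm_of_nonneg ha.le, mul_inv]
  ring

lemma centerBatches_single (hB : 4 ≤ B) (s : Fin k × Fin B) (i : Fin k) :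
    centerBatches hB (EuclideanSpace.single s 1) i =
      if i = s.1 then coordVec hB s.2 else 0 := by
  rw [centerBatches_apply, coordVec]
  split_ifs with h
  · congr 1
    ext p
    simp [PiLp.single_apply, Prod.ext_iff, h]
  · rw [← map_zero (centerBatch hB)]
    congr 1
    ext p
    simp [Prod.ext_iff, h]

/-- The chain rule away from constant batches and from points where `ψ` is not differentiable; both
exceptions will be null events. -/
lemma jac_apply (hB : 4 ≤ B) (φ : ℝ → ℝ) (h : Preact k B) (r s : Fin k × Fin B)
    (hz : centerBatches hB h r.1 ≠ 0)
    (hd : DifferentiableAt ℝ (rescale B φ) ⟪unitVec hB r.2, dir (centerBatches hB h r.1)⟫) :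
    jac φ h r s = if r.1 = s.1 then gradFun hB (rescale B φ) r.2 s.2 (centerBatches hB h s.1)
      else 0 := by
  set A : Preact k B →L[ℝ] Hyp B :=
    (PiLp.proj 2 (fun _ : Fin k => Hyp B) r.1 : Batches k B →L[ℝ] Hyp B) ∘L centerBatches hB
  have hA : ∀ x, A x = centerBatches hB x r.1 := fun x => rfl
  have h1 := (hasFDerivAt_inner_dir (unitVec hB r.2) (z := A h) hz).comp h A.hasFDerivAt
  have h2 := (HasDerivAt.comp_hasFDerivAt (f := fun x => ⟪unitVec hB r.2, dir (A x)⟫) h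
    (hd.hasDerivAt) h1)
  have h3 : (fun x : Preact k B => multiBatchNorm φ x r) =
      rescale B φ ∘ fun x => ⟪unitVec hB r.2, dir (A x)⟫ := by
    ext x
    exact multiBatchNorm_eq hB φ x r
  rw [jac, Matrix.of_apply, h3, h2.fderiv]
  simp only [smul_apply, ContinuousLinearMap.comp_apply, sub_apply, innerSL_apply_apply,
    smul_eq_mul, hA, centerBatches_single]
  split_ifs with h
  · rw [gradFun, h, real_inner_comm (dir _) (coordVec hB s.2)]
    ring
  · simp

/-- A number of the form of the forward rate is the backward rate. -/
lemma isBackwardRate_of_covOp (hB : 4 ≤ B) {φ : ℝ → ℝ} (hb : HasBackward B φ)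
    (hφ : MemLp (rescale B φ) 2 (gegProb B)) {S : BlockMat k B} {v : ℝ} (hv : 0 < v)
    (hS : S.PosSemidef) (hcov : covOp hB S = v • 1) :
    IsBackwardRate φ S (linCoeff B (rescale B φ) ^ 2 / v) := by
  have hs := Real.sqrt_pos.2 hv
  set ψ := rescale B φ with hψ
  have hac : ∀ r, 0 < r → r < 1 → AbsolutelyContinuousOnInterval ψ (-r) r :=
    fun r hr hr1 => hb.absCont_rescale hB hr hr1
  have : Nontrivial (Hyp B) := Module.nontrivial_of_finrank_pos (R := ℝ) (by
    have := finrank_hyp hB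
    omega)
  have hgrad := fun p q => integral_gradient hB (finrank_hyp hB) (norm_unitVec hB p) hac
    hb.integrableOn_rescale (integrable_gegProb_of_memLp hB hφ) (coordVec hB q)
  have hgi : ∀ p q, Integrable (gradFun hB ψ p q) (stdGaussian (Hyp B)) := fun p q => (hgrad p q).1
  have hgm : ∀ p q, ∫ z, gradFun hB ψ p q z ∂(stdGaussian (Hyp B)) =
      linCoeff B ψ * centering B p q := fun p q => by
    refine (hgrad p q).2.trans ?_
    rw [inner_unitVec_coordVec, linCoeff]
    ring
  have hne : ∀ i : Fin k, ∀ᵐ h ∂(multivariateGaussian 0 S), centerBatches hB h i ≠ 0 := by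
    refine ae_centerBatches hB hv hS hcov (P := fun z => z ≠ 0)
      (measurableSet_singleton (0 : Hyp B)).compl (fun z hz => smul_ne_zero hs.ne' hz) ?_
    exact stdGaussian_absolutelyContinuous.ae_le (compl_mem_ae_iff.2 (measure_singleton _))
  have hdiff : ∀ (i : Fin k) (p : Fin B), ∀ᵐ h ∂(multivariateGaussian 0 S),
      DifferentiableAt ℝ ψ ⟪unitVec hB p, dir (centerBatches hB h i)⟫ := fun i p => by
    refine ae_centerBatches hB hv hS hcov
      (P := fun z => DifferentiableAt ℝ ψ ⟪unitVec hB p, dir z⟫)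
      (measurable_inner_dir (unitVec hB p) (measurableSet_of_differentiableAt ℝ ψ))
      (fun z hz => by rwa [dir_smul hs]) ?_ i
    have h1 := ae_differentiableAt_gegProb hB hac
    rw [← map_inner_dir hB (finrank_hyp hB) (norm_unitVec hB p)] at h1
    exact ae_of_ae_map (measurable_inner_dir _).aemeasurable h1
  -- A version of the Jacobian entry, defined everywhere and depending on one centred batch only,
  -- which makes independence applicable.
  set J : Fin k × Fin B → Fin k × Fin B → Hyp B → ℝ := fun r s z =>
    if r.1 = s.1 then gradFun hB ψ r.2 s.2 z else 0 with hJ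
  have hJm : ∀ r s, Measurable (J r s) := fun r s => by
    simp only [hJ]
    split_ifs
    · exact measurable_gradFun hB ψ _ _
    · exact measurable_const
  have hJi : ∀ r s, Integrable (J r s) (stdGaussian (Hyp B)) := fun r s => by
    simp only [hJ]
    split_ifs
    · exact hgi _ _
    · exact integrable_zero _ _ _
  have hJs : ∀ r s z, J r s (√v • z) = (√v)⁻¹ * J r s z := fun r s z => by
    simp only [hJ]
    split_ifs
    · exact gradFun_smul hB ψ _ _ hs z
    · rw [mul_zero]
  have hJint : ∀ r s, ∫ z, J r s z ∂(stdGaussian (Hyp B)) =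
      linCoeff B ψ * ((1 : Matrix (Fin k) (Fin k) ℝ) ⊗ₖ centering B) r s := fun r s => by
    rw [Matrix.kroneckerMap_apply, Matrix.one_apply]
    simp only [hJ]
    split_ifs
    · rw [hgm, one_mul]
    · simp
  have hjac : ∀ᵐ h ∂(multivariateGaussian 0 S), ∀ r s : Fin k × Fin B,
      jac φ h r s = J r s (centerBatches hB h s.1) := by
    filter_upwards [ae_all_iff.2 hne, ae_all_iff.2 fun i => ae_all_iff.2 fun p => hdiff i p]
      with h h1 h2 r s
    exact jac_apply hB φ h r s (h1 r.1) (h2 r.1 r.2)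
  have hsymm : ∀ r s : Fin k × Fin B, ((1 : Matrix (Fin k) (Fin k) ℝ) ⊗ₖ centering B) r s =
      ((1 : Matrix (Fin k) (Fin k) ℝ) ⊗ₖ centering B) s r := fun r s => by
    simp only [Matrix.kroneckerMap_apply, Matrix.one_apply, centering_apply, eq_comm]
  intro P i j hij p q
  -- Column `(i, p)` of the Jacobian depends on batch `i` and column `(j, q)` on batch `j`, so for
  -- `i ≠ j` each mean factors. Both columns scale with `(√v)⁻¹`, which yields the denominator `v`.
  set F : Batches k B → ℝ := fun w => ∑ r, ∑ s, P r s * (J r (i, p) (w i) * J s (j, q) (w j))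
    with hF
  have hFm : Measurable F := by
    have h1 : ∀ r s i, Measurable fun w : Batches k B => J r s (w i) :=
      fun r s i => (hJm r s).comp (measurable_batch i)
    fun_prop
  have hpull : (fun h => F (centerBatches hB h)) =ᵐ[multivariateGaussian 0 S]
      fun h => pullback φ P h (i, p) (j, q) := by
    filter_upwards [hjac] with h hh
    rw [pullback, Matrix.mul_apply]
    simp_rw [Matrix.mul_apply, Finset.sum_mul, Matrix.transpose_apply, hh]
    rw [Finset.sum_comm, hF]
    exact Finset.sum_congr rfl fun r _ => Finset.sum_congr rfl fun s _ => by ring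
  have hterm : ∀ r s, Integrable (fun w : Batches k B => P r s * ((√v)⁻¹ * (√v)⁻¹ *
      (J r (i, p) (w i) * J s (j, q) (w j)))) (stdGaussian (Batches k B)) := fun r s =>
    ((integrable_batch_mul_batch (hJm _ _) (hJm _ _) (hJi _ _) (hJi _ _) hij).const_mul _).const_mul _
  have hFs : ∀ w : Batches k B, F (√v • w) = ∑ r, ∑ s, P r s * ((√v)⁻¹ * (√v)⁻¹ *
      (J r (i, p) (w i) * J s (j, q) (w j))) := fun w => by
    simp only [hF, PiLp.smul_apply, hJs]
    exact Finset.sum_congr rfl fun r _ => Finset.sum_congr rfl fun s _ => by ring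
  have hFi : Integrable (fun w => F (√v • w)) (stdGaussian (Batches k B)) := by
    simp_rw [hFs]
    exact integrable_finsetSum _ fun r _ => integrable_finsetSum _ fun s _ => hterm r s
  refine ⟨(integrable_centerBatches hB hv hS hcov hFm hFi).congr hpull, ?_⟩
  rw [backward, Matrix.of_apply, ← integral_congr_ae hpull,
    integral_centerBatches hB hv hS hcov hFm]
  simp_rw [hFs]
  rw [integral_finsetSum _ fun r _ => integrable_finsetSum _ fun s _ => hterm r s]
  simp_rw [fun r => integral_finsetSum _ fun s (_ : s ∈ Finset.univ) => hterm r s,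
    integral_const_mul, integral_batch_mul_batch (hJm _ _) (hJm _ _) hij, hJint]
  rw [blockCenter, Matrix.mul_apply]
  simp_rw [Matrix.mul_apply, Finset.sum_mul, Finset.mul_sum]
  rw [Finset.sum_comm]
  refine Finset.sum_congr rfl fun s _ => Finset.sum_congr rfl fun r _ => ?_
  rw [hsymm r (i, p), ← mul_inv, Real.mul_self_sqrt hv.le]
  ring

end Backward

/-! ### The forward rate is determined -/

section Uniqueness

variable {k B : ℕ}

attribute [local instance] Matrix.normedAddCommGroup Matrix.normedSpace

/-- By convexity the segment from `S` to `T` stays in the cone, so both maps compute the same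
one-sided derivative along it. -/
lemma eq_on_posSemidef {F : BlockMat k B → BlockMat k B} {L L' : BlockMat k B →L[ℝ] BlockMat k B}
    {S T : BlockMat k B} (h : HasFDerivWithinAt F L {T : BlockMat k B | T.PosSemidef} S)
    (h' : HasFDerivWithinAt F L' {T : BlockMat k B | T.PosSemidef} S) (hS : S.PosSemidef)
    (hT : T.PosSemidef) : L (T - S) = L' (T - S) := by
  have hpath : HasDerivWithinAt (fun t : ℝ => S + t • (T - S)) (T - S) (Set.Icc 0 1) 0 := by
    have := ((hasDerivWithinAt_id (0 : ℝ) (Set.Icc 0 1)).smul_const (T - S)).const_add S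
    rwa [one_smul] at this
  have hmaps : Set.MapsTo (fun t : ℝ => S + t • (T - S)) (Set.Icc 0 1)
      {T : BlockMat k B | T.PosSemidef} := fun t ht => by
    have h1 : S + t • (T - S) = (1 - t) • S + t • T := by
      rw [smul_sub, sub_smul, one_smul]; abel
    simp only [Set.mem_ofPred_eq, h1]
    exact (hS.smul (sub_nonneg.2 ht.2)).add (hT.smul ht.1)
  have h0 : S = S + (0 : ℝ) • (T - S) := by rw [zero_smul, add_zero]
  exact (uniqueDiffOn_Icc zero_lt_one 0 (by simp)).eq_deriv _
    (h.comp_hasDerivWithinAt_of_eq _ hpath hmaps h0)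
    (h'.comp_hasDerivWithinAt_of_eq _ hpath hmaps h0)

/-- The test matrix `x yᵀ + y xᵀ`, with `x` and `y` in distinct batches, is a difference of two
directions from `S` into the cone, by polarization. It has zero diagonal blocks, and its centring
has the nonzero entry `(1 - 1/B)²`. -/
lemma IsForwardRate.unique (hB : 4 ≤ B) (hk : 2 ≤ k) {φ : ℝ → ℝ} {S : BlockMat k B}
    (hS : S.PosSemidef) {lam lam' : ℝ} (h : IsForwardRate φ S lam)
    (h' : IsForwardRate φ S lam') : lam = lam' := by
  obtain ⟨L, hL, hLM⟩ := h
  obtain ⟨L', hL', hLM'⟩ := h'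
  have hB' : (4 : ℝ) ≤ B := by exact_mod_cast hB
  set i : Fin k := ⟨0, by omega⟩ with hi
  set j : Fin k := ⟨1, by omega⟩ with hj
  have hij : i ≠ j := by simp [hi, hj]
  set p : Fin B := ⟨0, by omega⟩
  set x : Fin k × Fin B → ℝ := Pi.single (i, p) 1 with hx
  set y : Fin k × Fin B → ℝ := Pi.single (j, p) 1 with hy
  have hpsd : ∀ u : Fin k × Fin B → ℝ, (Matrix.vecMulVec u u).PosSemidef := fun u => by
    simpa using Matrix.posSemidef_vecMulVec_self_star u
  set M : BlockMat k B := Matrix.vecMulVec x y + Matrix.vecMulVec y x with hM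
  have hMd : M = (Matrix.vecMulVec (x + y) (x + y) - S) -
      (Matrix.vecMulVec x x + Matrix.vecMulVec y y - S) := by
    rw [hM, Matrix.add_vecMulVec, Matrix.vecMulVec_add, Matrix.vecMulVec_add]
    abel
  have hLeq : L M = L' M := by
    rw [hMd]
    exact (map_sub L _ _).trans ((congrArg₂ _ (eq_on_posSemidef hL hL' hS (hpsd _))
      (eq_on_posSemidef hL hL' hS ((hpsd _).add (hpsd _)))).trans (map_sub L' _ _).symm)
  have hsymm : M.IsSymm := by
    rw [Matrix.IsSymm, hM, Matrix.transpose_add, Matrix.transpose_vecMulVec,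
      Matrix.transpose_vecMulVec, add_comm]
  have hMe : ∀ r s, M r s = (if r = (i, p) then 1 else 0) * (if s = (j, p) then 1 else 0) +
      (if r = (j, p) then 1 else 0) * (if s = (i, p) then 1 else 0) := fun r s => by
    simp only [hM, Matrix.add_apply, Matrix.vecMulVec_apply, hx, hy, Pi.single_apply]
  have hdiag : ∀ l q q', M (l, q) (l, q') = 0 := fun l q q' => by
    rw [hMe]
    by_cases h1 : l = i
    · subst h1
      simp [hij]
    · simp [h1]
  rw [hLM M hsymm hdiag, hLM' M hsymm hdiag] at hLeq
  have hc : blockCenter M (i, p) (j, p) = (1 - (B : ℝ)⁻¹) ^ 2 := by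
    simp only [blockCenter, Matrix.mul_apply, hMe, Matrix.kroneckerMap_apply, Matrix.one_apply,
      Fintype.sum_prod_type, Prod.mk.injEq, centering_apply]
    simp [hij, ite_and, Finset.sum_add_distrib, mul_add, sq]
  have h1 := congrFun (congrFun hLeq (i, p)) (j, p)
  simp only [Matrix.smul_apply, hc, smul_eq_mul] at h1
  have h2 : (B : ℝ)⁻¹ < 1 := inv_lt_one_of_one_lt₀ (by linarith)
  exact mul_right_cancel₀ (pow_ne_zero 2 (sub_pos.2 h2).ne') h1

end Uniqueness

/-! ### The rate -/

section Rate

variable {k B : ℕ}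

lemma measurable_rescale (B : ℕ) {φ : ℝ → ℝ} (hφ : Measurable φ) : Measurable (rescale B φ) :=
  hφ.comp (measurable_const.mul measurable_id)

lemma idRate_nonneg (hB : 4 ≤ B) : 0 ≤ idRate B := by
  have hB' : (4 : ℝ) ≤ B := by exact_mod_cast hB
  have h1 : 0 ≤ poch ((B : ℝ) / 2) (1 / 2) ^ (-2 : ℤ) := Even.zpow_nonneg (by decide) _
  exact mul_nonneg (by linarith) h1

/-- From `Γ(1/2) = √π` the squared Beta value is `π` times the inverse square of `poch`, which
explains the factor `1 / (2π)`. -/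
lemma mul_idRate_eq_beta (hB : 4 ≤ B) (a : ℝ) :
    B * idRate B * a ^ 2 = 1 / (2 * Real.pi) * B * ((B : ℝ) - 1) * a ^ 2 *
      (ProbabilityTheory.beta ((B : ℝ) / 2) (1 / 2)) ^ 2 := by
  have hB' : (4 : ℝ) ≤ B := by exact_mod_cast hB
  have h1 : Real.Gamma ((B : ℝ) / 2) ≠ 0 := (Real.Gamma_pos_of_pos (by linarith)).ne'
  have h2 : Real.Gamma ((B : ℝ) / 2 + 1 / 2) ≠ 0 := (Real.Gamma_pos_of_pos (by linarith)).ne'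
  have h3 : √Real.pi ^ 2 = Real.pi := Real.sq_sqrt Real.pi_pos.le
  have h4 := Real.pi_ne_zero
  rw [idRate, poch, ProbabilityTheory.beta, Real.Gamma_one_half_eq, zpow_neg,
    show (2 : ℤ) = ((2 : ℕ) : ℤ) from rfl, zpow_natCast, div_pow, div_pow, mul_pow, h3]
  field_simp

lemma linCoeff_sq_div_le (hB : 4 ≤ B) {ψ : ℝ → ℝ} (hψ : MemLp ψ 2 (gegProb B)) {v : ℝ}
    (hv : 0 < v) {p q : Fin B} (hpq : p ≠ q) (h : v = pairMean hB ψ ψ p p - pairMean hB ψ ψ p q) :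
    linCoeff B ψ ^ 2 / v ≤ idRate B := by
  rw [div_le_iff₀ hv, linCoeff_sq hB]
  have h1 := firstMoment_sq_le hB hψ hpq
  rw [← h] at h1
  calc B * idRate B * firstMoment B ψ ^ 2 = idRate B * (B * firstMoment B ψ ^ 2) := by ring
    _ ≤ idRate B * v := mul_le_mul_of_nonneg_left h1 (idRate_nonneg hB)

end Rate

/-! ### The identity nonlinearity -/

section Identity

open scoped RealInnerProductSpace

variable {k B : ℕ}

lemma rescale_id (B : ℕ) : rescale B id = fun x => √((B : ℝ) - 1) * x := rfl

lemma memLp_rescale_id (hB : 4 ≤ B) : MemLp (rescale B id) 2 (gegProb B) :=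
  (memLp_id_gegProb hB).const_mul _

lemma firstMoment_rescale_id (hB : 4 ≤ B) :
    firstMoment B (rescale B id) = √((B : ℝ) - 1) / ((B : ℝ) - 1) := by
  have h := firstMoment_id hB
  rw [firstMoment] at h ⊢
  simp_rw [rescale_id, mul_left_comm _ (√((B : ℝ) - 1))]
  rw [integral_const_mul, h]
  ring

lemma pairMean_rescale_id (hB : 4 ≤ B) (p q : Fin B) :
    pairMean hB (rescale B id) (rescale B id) p q = if p = q then 1 else -1 / ((B : ℝ) - 1) := by
  have hB' : (4 : ℝ) ≤ B := by exact_mod_cast hB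
  have h1 : (B : ℝ) - 1 ≠ 0 := by linarith
  have h := pairMean_id_right hB (memLp_rescale_id hB) p q
  rw [firstMoment_rescale_id hB] at h
  have h2 : pairMean hB (rescale B id) (rescale B id) p q =
      √((B : ℝ) - 1) * pairMean hB (rescale B id) (fun x => x) p q := by
    rw [pairMean, pairMean, ← integral_const_mul]
    congr 1 with z
    simp only [rescale_id]
    ring
  rw [h2, h, mul_left_comm, ← mul_div_assoc, Real.mul_self_sqrt (by linarith), div_self h1, mul_one]

lemma integral_rescale_id (hB : 4 ≤ B) : ∫ x, rescale B id x ∂(gegProb B) = 0 := by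
  have hB' : (4 : ℝ) ≤ B := by exact_mod_cast hB
  have h := (isGegenbauerFunctional_gegFun hB).map_eq_zero 1
  have h2 : ((1 - Polynomial.X ^ 2) * Polynomial.derivative (1 : ℝ[X]) -
      Polynomial.C (2 * (((B : ℝ) - 3) / 2) + 1) * Polynomial.X * 1) =
      Polynomial.C (-(2 * (((B : ℝ) - 3) / 2) + 1)) * Polynomial.X := by
    rw [Polynomial.derivative_one, Polynomial.C_neg]
    ring
  rw [h2, IsGegenbauerFunctional.map_C_mul, gegFun_apply, mul_eq_zero] at h
  simp only [Polynomial.eval_X] at h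
  simp_rw [rescale_id]
  rw [integral_const_mul, h.resolve_left (by linarith), mul_zero]

/-- For the identity the gap is forced to be `B / (B - 1)`, whatever the fixed point, and
`firstMoment_sq_le` is an equality. -/
lemma linCoeff_sq_div_id (hB : 4 ≤ B) {v : ℝ} {p q : Fin B} (hpq : p ≠ q)
    (h : v = pairMean hB (rescale B id) (rescale B id) p p -
      pairMean hB (rescale B id) (rescale B id) p q) :
    linCoeff B (rescale B id) ^ 2 / v = idRate B := by
  have hB' : (4 : ℝ) ≤ B := by exact_mod_cast hB
  have h0 : (B : ℝ) ≠ 0 := by linarith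
  have h1 : (B : ℝ) - 1 ≠ 0 := by linarith
  rw [pairMean_rescale_id, pairMean_rescale_id, if_pos rfl, if_neg hpq] at h
  have hv : v = B / ((B : ℝ) - 1) := by
    rw [h]; field_simp; ring
  rw [hv, linCoeff_sq hB, firstMoment_rescale_id hB, div_pow, Real.sq_sqrt (by linarith)]
  field_simp

lemma hasBackward_id (hB : 4 ≤ B) : HasBackward B id where
  absCont r _ _ := by
    rw [absolutelyContinuousOnInterval_iff]
    exact fun ε hε => ⟨ε, hε, fun E _ h => h⟩
  integrable := by
    have hB' : (4 : ℝ) ≤ B := by exact_mod_cast hB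
    simp only [deriv_id, one_mul]
    have hc : Continuous fun x : ℝ => (1 - x ^ 2) ^ (((B : ℝ) - 3) / 2) :=
      (continuous_const.sub (continuous_pow 2)).rpow_const fun x => Or.inr (by linarith)
    exact (hc.integrableOn_Icc).mono_set Set.Ioo_subset_Icc_self

/-- The fixed point for the identity. -/
def idFixedPoint (k B : ℕ) : BlockMat k B :=
  (1 : Matrix (Fin k) (Fin k) ℝ) ⊗ₖ (((B : ℝ) / ((B : ℝ) - 1)) • centering B)

lemma idFixedPoint_apply (hB : 4 ≤ B) (i j : Fin k) (p q : Fin B) :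
    idFixedPoint k B (i, p) (j, q) =
      if i = j then (if p = q then 1 else -1 / ((B : ℝ) - 1)) else 0 := by
  have hB' : (4 : ℝ) ≤ B := by exact_mod_cast hB
  have h0 : (B : ℝ) ≠ 0 := by linarith
  have h1 : (B : ℝ) - 1 ≠ 0 := by linarith
  rw [idFixedPoint, Matrix.kroneckerMap_apply, Matrix.one_apply, Matrix.smul_apply, centering_apply,
    smul_eq_mul]
  split_ifs
  · field_simp
  · field_simp
    ring
  · rw [zero_mul]
  · rw [zero_mul]

/-- The centering matrix is the Gram matrix of the centred coordinate vectors. -/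
lemma posSemidef_idFixedPoint (hB : 4 ≤ B) : (idFixedPoint k B).PosSemidef := by
  have hB' : (4 : ℝ) ≤ B := by exact_mod_cast hB
  have h1 : (centering B).PosSemidef := by
    have : centering B = Matrix.gram ℝ (coordVec hB) := by
      ext p q
      rw [Matrix.gram_apply, inner_coordVec_coordVec]
    rw [this]
    exact Matrix.posSemidef_gram ℝ _
  exact Matrix.PosSemidef.one.kronecker
    (h1.smul (div_nonneg (by linarith) (by linarith) : (0 : ℝ) ≤ (B : ℝ) / ((B : ℝ) - 1)))

/-- Within a batch the moments are the cosines of the simplex; across batches they are products of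
means, which vanish for an odd function. -/
lemma isFixedPoint_idFixedPoint (hB : 4 ≤ B) : IsFixedPoint id (idFixedPoint k B) := by
  have hB' : (4 : ℝ) ≤ B := by exact_mod_cast hB
  have hform := idFixedPoint_apply (k := k) hB
  have hgap : (1 : ℝ) - -1 / ((B : ℝ) - 1) > 0 := by
    have : 0 < 1 / ((B : ℝ) - 1) := by
      have : 0 < (B : ℝ) - 1 := by linarith
      positivity
    rw [neg_div]
    linarith
  have hcov := covOp_of_cbsb1 hB hform
  have hm := measurable_rescale B measurable_id
  have hpsd := posSemidef_idFixedPoint (k := k) hB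
  refine ⟨hpsd, ⟨1, -1 / ((B : ℝ) - 1), 0, fun h => by linarith, hform⟩, ?_⟩
  ext ⟨i, p⟩ ⟨j, q⟩
  rw [hform]
  split_ifs with hij hpq
  · subst hij
    rw [forward_same_batch hB hm hgap hpsd hcov, pairMean_rescale_id, if_pos hpq]
  · subst hij
    rw [forward_same_batch hB hm hgap hpsd hcov, pairMean_rescale_id, if_neg hpq]
  · rw [forward_distinct_batch hB hm hgap hpsd hcov hij, integral_rescale_id hB, zero_mul]

lemma IsFixedPoint.isForwardRate_id (hB : 4 ≤ B) (hk : 2 ≤ k) {S : BlockMat k B}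
    (hS : IsFixedPoint id S) : IsForwardRate id S (idRate B) ∧ IsBackwardRate id S (idRate B) := by
  have hm := measurable_rescale B measurable_id
  obtain ⟨v, hv, hcov, hgap⟩ := hS.exists_covOp hB (by omega) hm
  have hpq : (⟨0, by omega⟩ : Fin B) ≠ ⟨1, by omega⟩ := by simp
  rw [← linCoeff_sq_div_id hB hpq (hgap _ _ hpq)]
  exact ⟨isForwardRate_of_covOp hB hm (memLp_rescale_id hB) hv hS.posSemidef hcov,
    isBackwardRate_of_covOp hB (hasBackward_id hB) (memLp_rescale_id hB) hv hS.posSemidef hcov⟩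

end Identity

end CrossBatchNorm

end

theorem mainTheorem4 :
    (∀ (B k : ℕ), 4 ≤ B → 2 ≤ k → ∀ φ : ℝ → ℝ, Measurable φ →
      MemLp (rescale B φ) 2 (gegMeasure B) →
      ∀ S : BlockMat k B, IsFixedPoint φ S →
        ∃ lam : ℝ,
          IsForwardRate φ S lam ∧
          (HasBackward B φ → IsBackwardRate φ S lam) ∧
          (∀ a : ℕ → ℝ, HasGegenbauerExpansion B φ a →
            Summable (gegTerm B a) ∧ 0 < ∑' l, gegTerm B a l ∧
            lam = (1 / (2 * Real.pi) * B * ((B : ℝ) - 1) * a 1 ^ 2 *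
                (ProbabilityTheory.beta ((B : ℝ) / 2) (1 / 2)) ^ 2) / ∑' l, gegTerm B a l) ∧
          lam < 1 ∧
          (∀ (Sid : BlockMat k B) (lamId : ℝ), IsFixedPoint id Sid →
            IsForwardRate id Sid lamId → lam ≤ lamId)) ∧
    (∀ (B k : ℕ), 4 ≤ B → 2 ≤ k →
      (∃ S : BlockMat k B, IsFixedPoint id S) ∧
      ∀ S : BlockMat k B, IsFixedPoint id S →
        IsForwardRate id S (idRate B) ∧ IsBackwardRate id S (idRate B)) ∧
    StrictMonoOn idRate (Set.Ici 4) ∧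
    (∀ B : ℕ, 4 ≤ B → idRate B < 1) ∧
    Tendsto idRate atTop (𝓝 1) := by
  refine ⟨fun B k hB hk φ hφm hφ S hS => ?_, fun B k hB hk => ?_, strictMonoOn_idRate,
    fun B hB => idRate_lt_one hB, tendsto_idRate⟩
  · have hm := measurable_rescale B hφm
    have hφ' := memLp_gegProb hφ
    obtain ⟨v, hv, hcov, hgap⟩ := hS.exists_covOp hB (by omega) hm
    have hpq : (⟨0, by omega⟩ : Fin B) ≠ ⟨1, by omega⟩ := by simp
    have hle := linCoeff_sq_div_le hB hφ' hv hpq (hgap _ _ hpq)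
    refine ⟨linCoeff B (rescale B φ) ^ 2 / v, isForwardRate_of_covOp hB hm hφ' hv hS.posSemidef hcov,
      fun hb => isBackwardRate_of_covOp hB hb hφ' hv hS.posSemidef hcov, fun a ha => ?_,
      hle.trans_lt (idRate_lt_one hB), fun Sid lamId hSid hlam => ?_⟩
    · have hsum := hasSum_gegTerm hB hφ' ha hpq
      rw [← hgap _ _ hpq] at hsum
      refine ⟨hsum.summable, by rwa [hsum.tsum_eq], ?_⟩
      rw [hsum.tsum_eq, linCoeff_sq hB, firstMoment_eq_coeff hB hφ' ha, mul_idRate_eq_beta hB]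
    -- The given `lamId` is an arbitrary forward rate; uniqueness identifies it with `idRate B`, the
    -- bound in `hle`.
    · rw [hlam.unique hB hk hSid.posSemidef (hSid.isForwardRate_id hB hk).1]
      exact hle
  · exact ⟨⟨idFixedPoint k B, isFixedPoint_idFixedPoint hB⟩, fun S hS => hS.isForwardRate_id hB hk⟩
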